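/- Let $m,n,p$ be positive integers with $\frac1m+\frac1n+\frac1p<1$, and put $\alpha=\frac1m$, $\beta=\frac1n$, $\gamma=\frac1p$. Let $$a=\tfrac12(1-\alpha+\beta-\gamma),\quad b=\tfrac12(1-\alpha-\beta-\gamma),\quad c=1-\alpha,\qquad a'=a-c+1,\quad b'=b-c+1,\quad c'=2-c,$$ let $F(a,b;c;z)$ be the hypergeometric function (the holomorphic continuation of the Gauss series to $\mathbb C\setminus[1,\infty)$), and let $$\varphi(z)=\frac{z^{1-c}F(a',b';c';z)}{F(a,b;c;z)},\qquad z\in\mathbb C_+=\{\operatorname{Im}z>0\}$$ (principal branch), be the Schwarz triangle function. Let $$\nu=\nu(\alpha,\beta,\gamma)=\sqrt{\frac{\cos(\pi\alpha+\pi\beta)+\cos(\pi\gamma)}{\cos(\pi\alpha-\pi\beta)+\cos(\pi\gamma)}\cdot\frac{\cos(\pi\alpha-\pi\beta-\pi\gamma)+1}{\cos(\pi\alpha+\pi\beta+\pi\gamma)+1}}\cdot\frac{\Gamma(a')\Gamma(b')}{\Gamma(c')}\cdot\frac{\Gamma(c)}{\Gamma(a)\Gamma(b)},$$ and write $\nu_B=\nu(\beta,\gamma,\alpha)$,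 $\nu_C=\nu(\gamma,\alpha,\beta)$. These are positive numbers. The limits $A=\varphi(0)=0$, $B=\varphi(\infty)$, $C=\varphi(1)$ (taken from within $\mathbb C_+$) exist, $B$ and $C$ lie in the disc $|w|<\nu^{-1}$, $\operatorname{Im}B>0$, and $C$ is a positive real number. Moreover $\varphi$ is holomorphic on $\mathbb C_+$ and maps it bijectively onto the open hyperbolic triangle $\Delta$ with vertices $A,B,C$ in the Poincaré disc $|w|<\nu^{-1}$; the angles of $\Delta$ at $A,B,C$ are $\pi\alpha,\pi\beta,\pi\gamma$. Let $\rho$ be the hyperbolic reflection in any one of the three sides of $\Delta$. Then $\mathcal F=\Delta\cup\rho\Delta$ is (up to its sides) a fundamental domain of the triangle group. Let $\psi$ be the inverse of $\varphi$ on $\Delta$, continued to $\rho\Delta$ by reflection, $\psi(w)=\overline{\psi(\rho w)}$. Then $\psi$ has rational Taylor coefficients (rational Laurent coefficients at its pole $B$) about every vertex of $\mathcal F$, in the following coordinates. 1. About $A$, for $w\in\mathcal F$ near $0$, $$\psi(w)=w^m+c_2w^{2m}+c_3w^{3m}+\cdots,\qquad c_i\in\mathbb Q.$$ 2. About $B$: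 there is a real $t$ such that $$u=S(w)=\frac{\nu}{\nu_B}\,e^{it}\,\frac{w-B}{1-\nu^2\bar B w},$$ which maps the disc of radius $\nu^{-1}$ onto the disc of radius $\nu_B^{-1}$ and $B$ to $0$, satisfies $S(A)>0$ and $\operatorname{Im}S(C)>0$; and with $T(z)=\frac{-1}{z-1}$, for $w\in\mathcal F$ near $B$, $$T(\psi(w))=u^n+c_2u^{2n}+c_3u^{3n}+\cdots,\qquad u^n\psi(w)=-1+e_1u^n+e_2u^{2n}+\cdots,\qquad c_i,e_i\in\mathbb Q.$$ 3. About $C$: there is a real $t$ such that $$u=S(w)=\frac{\nu}{\nu_C}\,e^{it}\,\frac{w-C}{1-\nu^2\bar C w}$$ satisfies $S(B)>0$ and $\operatorname{Im}S(A)>0$; and with $T(z)=\frac{z-1}{z}$, for $w\in\mathcal F$ near $C$, $$T(\psi(w))=u^p+c_2u^{2p}+c_3u^{3p}+\cdots,\qquad \psi(w)=1+u^p+e_2u^{2p}+\cdots,\qquad c_i,e_i\in\mathbb Q.$$ 4. About the image $\rho V$ of a vertex $V\in\{A,B,C\}$, the same expansions, with the same coefficients, hold in the coordinate $u=\overline{S(\rho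 w)}$ (with $S(w)=w$ if $V=A$). All these power series have positive radius of convergence. -/

import Mathlib

open Complex Filter Topology ComplexConjugate

noncomputable section

namespace SchwarzTriangle

/-- The open upper half plane. -/
def upperHalf : Set ℂ := {z | 0 < z.im}

/-- The plane cut along the real ray `[1, ∞)`. -/
def cutPlane : Set ℂ := {z | 1 - z ∈ Complex.slitPlane}

open Classical in
/-- Gauss' hypergeometric function `F(a, b; c; z)` on the cut plane: the (unique) holomorphic
continuation of the hypergeometric series from the unit disc to the cut plane. -/
def gaussF (a b c : ℝ) : ℂ → ℂ :=
  if h : ∃ f : ℂ → ℂ, DifferentiableOn ℂ f cutPlane ∧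
      ∀ z : ℂ, ‖z‖ < 1 → f z = ₂F₁ (a : ℂ) (b : ℂ) (c : ℂ) z
  then h.choose else ₂F₁ (a : ℂ) (b : ℂ) (c : ℂ)

/-- The parameters of the hypergeometric equation; the angles are `π α`, `π β`, `π γ`. -/
def parA (α β γ : ℝ) : ℝ := (1 - α + β - γ) / 2
def parB (α β γ : ℝ) : ℝ := (1 - α - β - γ) / 2
def parC (α : ℝ) : ℝ := 1 - α
def parA' (α β γ : ℝ) : ℝ := parA α β γ - parC α + 1
def parB' (α β γ : ℝ) : ℝ := parB α β γ - parC α + 1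
def parC' (α : ℝ) : ℝ := 2 - parC α

/-- The Schwarz triangle function `z ^ (1 - c) * F(a', b'; c'; z) / F(a, b; c; z)`, with the
principal branch of the power. -/
def phi (α β γ : ℝ) (z : ℂ) : ℂ :=
  z ^ ((1 - parC α : ℝ) : ℂ) * gaussF (parA' α β γ) (parB' α β γ) (parC' α) z /
    gaussF (parA α β γ) (parB α β γ) (parC α) z

/-- The normalising constant: the Poincaré disc which contains the image triangle of `phi α β γ`
is the disc of radius `(nu α β γ)⁻¹` about `0`. -/
def nu (α β γ : ℝ) : ℝ :=
  Real.sqrt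
    ((Real.cos (Real.pi * α + Real.pi * β) + Real.cos (Real.pi * γ)) /
        (Real.cos (Real.pi * α - Real.pi * β) + Real.cos (Real.pi * γ)) *
      ((Real.cos (Real.pi * α - Real.pi * β - Real.pi * γ) + 1) /
        (Real.cos (Real.pi * α + Real.pi * β + Real.pi * γ) + 1))) *
    (Real.Gamma (parA' α β γ) * Real.Gamma (parB' α β γ) / Real.Gamma (parC' α)) *
    (Real.Gamma (parC α) / (Real.Gamma (parA α β γ) * Real.Gamma (parB α β γ)))

/-- The automorphism `w ↦ (w - d) / (1 - ν² d̄ w)` of the disc of radius `ν⁻¹`, which moves `d`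
to the origin. Its inverse is `discMove ν (-d)`. -/
def discMove (ν : ℝ) (d w : ℂ) : ℂ := (w - d) / (1 - (ν : ℂ) ^ 2 * conj d * w)

/-- The open sector spanned by the rays from `0` through `u` and `v`. -/
def openSector (u v : ℂ) : Set ℂ :=
  {w | ∃ s t : ℝ, 0 < s ∧ 0 < t ∧ w = (s : ℂ) * u + (t : ℂ) * v}

/-- The hyperbolic angle at the vertex `P` between the geodesic rays `PQ` and `PR`. -/
def hypAngle (ν : ℝ) (P Q R : ℂ) : ℝ :=
  InnerProductGeometry.angle (discMove ν P Q) (discMove ν P R)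

/-- The open hyperbolic triangle with vertices `P`, `Q`, `R` in the disc of radius `ν⁻¹`: the
points of the disc which lie strictly inside the angle at each of the three vertices. -/
def hypTriangle (ν : ℝ) (P Q R : ℂ) : Set ℂ :=
  {w | ‖w‖ < ν⁻¹ ∧
    discMove ν P w ∈ openSector (discMove ν P Q) (discMove ν P R) ∧
    discMove ν Q w ∈ openSector (discMove ν Q R) (discMove ν Q P) ∧
    discMove ν R w ∈ openSector (discMove ν R P) (discMove ν R Q)}

/-- Hyperbolic reflection of the disc of radius `ν⁻¹` in the geodesic through `P` and `Q`. -/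
def hypReflect (ν : ℝ) (P Q w : ℂ) : ℂ :=
  discMove ν (-P) (discMove ν P Q * conj (discMove ν P w / discMove ν P Q))

open Classical in
/-- The inverse `ψ` of the Schwarz triangle function `φ` on the fundamental domain formed by the
triangle `Δ` (the image of the upper half plane) and its reflection `ρ Δ` in a side: on `Δ` it is
the inverse of `φ`, and it is continued to `ρ Δ` by the reflection principle. Only its values on
`Δ ∪ ρ Δ` are meaningful. -/
def psi (φ : ℂ → ℂ) (Δ : Set ℂ) (ρ : ℂ → ℂ) (w : ℂ) : ℂ :=
  if w ∈ Δ then Function.invFunOn φ upperHalf w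
  else conj (Function.invFunOn φ upperHalf (ρ w))

/-- In the coordinate `u = S w`, the function `f` is given, on the part of `D` near `u = 0`, by the
power series `∑ cᵢ u ^ (k i)` with rational coefficients and positive radius of convergence. -/
def HasRationalExpansion (c : ℕ → ℚ) (k : ℕ) (S : ℂ → ℂ) (D : Set ℂ) (f : ℂ → ℂ) : Prop :=
  ∃ r : ℝ, 0 < r ∧
    (∀ u : ℂ, ‖u‖ < r → Summable fun i : ℕ => (c i : ℂ) * u ^ (k * i)) ∧
    ∀ w ∈ D, ‖S w‖ < r → HasSum (fun i : ℕ => (c i : ℂ) * S w ^ (k * i)) (f w)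

/-- The coordinate about a vertex `d` of the triangle in the disc of radius `ν⁻¹`: the disc
automorphism which moves `d` to the origin, a rotation by the angle `t`, and the dilation from the
disc of radius `ν⁻¹` onto the disc of radius `ν'⁻¹`. -/
def coordS (ν ν' t : ℝ) (d w : ℂ) : ℂ :=
  ((ν / ν' : ℝ) : ℂ) * (Complex.exp (Complex.I * (t : ℂ)) * discMove ν d w)

/-- The Möbius shifts of `{0, 1, ∞}` to `{1, ∞, 0}` and to `{∞, 0, 1}`. -/
def shiftB (z : ℂ) : ℂ := -1 / (z - 1)
def shiftC (z : ℂ) : ℂ := (z - 1) / z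

/-- Rational expansion of a function of `ψ` about a vertex `V` of the triangle and about its mirror
image. Let `ρ` be the reflection in any side of the triangle `Δ` with vertices `0`, `B`, `C`, let
`F = Δ ∪ ρ Δ` be the fundamental domain, and let `S` be a coordinate with `S V = 0`. In the
coordinate `u = S w` about `V`, and in the mirrored coordinate `u = conj (S (ρ w))` about the vertex
`ρ V`, the quantity `f u (ψ w)` has the expansion `∑ cᵢ u ^ (k i)` on `F` near `u = 0`. -/
def RationalAtVertex (ν : ℝ) (φ : ℂ → ℂ) (B C : ℂ) (c : ℕ → ℚ) (k : ℕ) (S : ℂ → ℂ)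
    (f : ℂ → ℂ → ℂ) : Prop :=
  ∀ ρ : ℂ → ℂ, (ρ = hypReflect ν 0 B ∨ ρ = hypReflect ν B C ∨ ρ = hypReflect ν C 0) →
    let Δ := hypTriangle ν 0 B C
    let F := Δ ∪ ρ '' Δ
    let ψ := psi φ Δ ρ
    let S' := fun w => conj (S (ρ w))
    HasRationalExpansion c k S F (fun w => f (S w) (ψ w)) ∧
    HasRationalExpansion c k S' F (fun w => f (S' w) (ψ w))

end SchwarzTriangle

end

noncomputable section

namespace SchwarzTriangle

/-! ### The Euler integral -/

/-! The function `φ` is a quotient of two solutions of the hypergeometric equation with exponent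
differences `α`, `γ`, `β` at `0`, `1`, `∞`. The substitution `z ↦ 1 / (1 - z)` permutes the singular
points and the angles cyclically. Hence the triangle function of `(β, γ, α)` at `1 / (1 - z)` is
again a quotient of solutions of the equation for `(α, β, γ)`, and so a Möbius transform of `φ`.
Gauss' value at `1` and Pfaff's transformation express the coefficients of this Möbius map by Gamma
values, and the constants `ν` are exactly those which make it an isometry from the disc of radius
`ν⁻¹` onto that of radius `ν_B⁻¹` (`exists_connection`, `connection_constants`,
`phi_shiftB_and_ne`). Statements about one vertex can therefore be proved at `0` and carried around
the triangle.

Mapping. Euler's integral has positive real part, so the denominator of `φ` has no zeros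
(`eulerIntegral_re_pos`); by the Wronskian the derivative of `φ` has none either (`hasDerivAt_phi`,
`deriv_phi_ne_zero`). On `[0, 1)` the function is real and increasing. The neighbouring functions
treat the two remaining boundary arcs in the same way, so the boundary goes into three geodesics
(`boundaryLimit`). The maximum principle puts the image inside the triangle
(`norm_le_of_boundaryLimit`). The image is open and relatively closed in the connected triangle,
hence all of it (`tri_subset_image_phi`). The set of values taken twice is open and relatively
closed as well, and it is not everything, because `φ` is injective near the boundary point `1 / 2`
(`injOn_phi`).

Rationality. For `α = 1 / m` one has `φ ^ m = z * G ^ m`, where `G` has rational Taylor coefficients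
and `G 0 = 1`. Inverting this relation expresses `z` as a rational power series in `φ ^ m`
(`exists_expansion`). All transcendental constants are absorbed in the discs and the coordinates. In
the coordinate about a vertex, reflection in a side through the vertex is conjugation up to a root
of unity, which the powers of `u ^ k` do not see; reflection in the opposite side moves the triangle
away from the vertex (`reflection_spec`, `rationalAtVertex_of_expansion`). -/

/-- The density `t ^ (s - 1) * (1 - t) ^ (r - 1)` of the Beta integral. -/
def betaDensity (s r : ℝ) (t : ℝ) : ℂ := (t : ℂ) ^ ((s : ℂ) - 1) * (1 - (t : ℂ)) ^ ((r : ℂ) - 1)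

/-- The Euler integral `∫₀¹ t ^ (s - 1) * (1 - t) ^ (r - 1) * (1 - z * t) ^ (-b)`. -/
def eulerIntegral (s r b : ℝ) (z : ℂ) : ℂ :=
  ∫ t in (0 : ℝ)..1, betaDensity s r t * (1 - z * (t : ℂ)) ^ (-(b : ℂ))

lemma intervalIntegrable_betaDensity {s r : ℝ} (hs : 0 < s) (hr : 0 < r) :
    IntervalIntegrable (betaDensity s r) MeasureTheory.volume 0 1 :=
  betaIntegral_convergent (by simpa using hs) (by simpa using hr)

lemma isOpen_cutPlane : IsOpen cutPlane :=
  isOpen_slitPlane.preimage (by fun_prop : Continuous fun z : ℂ => 1 - z)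

/-- The point lies on the segment from `1` to `1 - z`, and the slit plane is star-shaped about `1`.
Thus the principal branch of the kernel is holomorphic in `z` on the whole cut plane. -/
lemma one_sub_mul_mem_slitPlane {z : ℂ} (hz : z ∈ cutPlane) {t : ℝ} (ht : t ∈ Set.Icc (0 : ℝ) 1) :
    1 - z * (t : ℂ) ∈ slitPlane := by
  obtain ⟨h0, h1⟩ := ht
  have hz' : 0 < (1 - z).re ∨ (1 - z).im ≠ 0 := hz
  rw [mem_slitPlane_iff]
  simp only [sub_re, one_re, sub_im, one_im, mul_re, mul_im, ofReal_re, ofReal_im] at hz' ⊢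
  rcases hz' with h | h
  · left
    have : 0 < (1 - t) + t * (1 - z.re) := by
      rcases h1.eq_or_lt with h1 | h1
      · rw [h1]; linarith
      · have := mul_nonneg h0 h.le
        linarith
    linarith
  · rcases h0.eq_or_lt with h0 | h0
    · left; simp [← h0]
    · right
      intro h'
      apply h
      have : z.im * t = 0 := by linarith
      rcases mul_eq_zero.mp this with h2 | h2 <;> [simp [h2]; linarith]

lemma zero_mem_cutPlane : (0 : ℂ) ∈ cutPlane := by simp [cutPlane]

lemma starConvex_cutPlane : StarConvex ℝ 0 cutPlane := by
  rw [starConvex_zero_iff]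
  intro z hz t h0 h1
  have := one_sub_mul_mem_slitPlane hz ⟨h0, h1⟩
  simpa [cutPlane, mul_comm] using this

lemma isPreconnected_cutPlane : IsPreconnected cutPlane :=
  (starConvex_cutPlane.isPathConnected zero_mem_cutPlane).isConnected.isPreconnected

lemma ball_subset_cutPlane : Metric.ball (0 : ℂ) 1 ⊆ cutPlane := by
  intro z hz
  left
  have := (abs_re_le_norm z).trans_lt (mem_ball_zero_iff.mp hz)
  have := (abs_lt.mp this).2
  simpa using this

lemma continuousOn_eulerKernel {z : ℂ} (hz : z ∈ cutPlane) (b : ℂ) :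
    ContinuousOn (fun t : ℝ => (1 - z * (t : ℂ)) ^ b) (Set.uIcc 0 1) := by
  rw [Set.uIcc_of_le zero_le_one]
  exact ContinuousOn.cpow_const (by fun_prop) fun t ht => one_sub_mul_mem_slitPlane hz ht

lemma intervalIntegrable_euler {s r : ℝ} (hs : 0 < s) (hr : 0 < r) (b : ℂ) {z : ℂ}
    (hz : z ∈ cutPlane) :
    IntervalIntegrable (fun t : ℝ => betaDensity s r t * (1 - z * (t : ℂ)) ^ b)
      MeasureTheory.volume 0 1 :=
  (intervalIntegrable_betaDensity hs hr).mul_continuousOn (continuousOn_eulerKernel hz b)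

lemma betaDensity_add_one_left {s r t : ℝ} (ht : t ∈ Set.Ioo (0 : ℝ) 1) :
    betaDensity (s + 1) r t = t * betaDensity s r t := by
  have h0 : (t : ℂ) ≠ 0 := ofReal_ne_zero.mpr ht.1.ne'
  simp only [betaDensity]
  push_cast
  rw [show (s : ℂ) + 1 - 1 = (s - 1) + 1 by ring, cpow_add _ _ h0, cpow_one]
  ring

lemma integral_congr_Ioo {f g : ℝ → ℂ} (h : ∀ t ∈ Set.Ioo (0 : ℝ) 1, f t = g t) :
    ∫ t in (0 : ℝ)..1, f t = ∫ t in (0 : ℝ)..1, g t := by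
  apply intervalIntegral.integral_congr_ae
  have h1 : ∀ᵐ t : ℝ, t ≠ 1 := by simp [MeasureTheory.ae_iff]
  filter_upwards [h1] with t ht1 ht
  rw [Set.uIoc_of_le zero_le_one] at ht
  exact h t ⟨ht.1, lt_of_le_of_ne ht.2 ht1⟩

/-- Differentiating the kernel in `z` produces a factor `b * t` and lowers the exponent by one; the
`t` is absorbed by the density. Derivatives of all orders are thus Euler integrals again. -/
lemma hasDerivAt_eulerIntegral {s r : ℝ} (hs : 0 < s) (hr : 0 < r) (b : ℝ) {z : ℂ}
    (hz : z ∈ cutPlane) :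
    HasDerivAt (eulerIntegral s r b) (b * eulerIntegral (s + 1) r (b + 1) z) z := by
  obtain ⟨ε, hε, hball⟩ := Metric.nhds_basis_closedBall.mem_iff.mp (isOpen_cutPlane.mem_nhds hz)
  set K' : ℂ → ℝ → ℂ := fun z t => (b * t) * (1 - z * (t : ℂ)) ^ (-(b : ℂ) - 1) with hK'
  have hcont : ContinuousOn (fun p : ℂ × ℝ => K' p.1 p.2)
      (Metric.closedBall z ε ×ˢ Set.Icc (0 : ℝ) 1) := by
    apply ContinuousOn.mul (by fun_prop)
    apply ContinuousOn.cpow_const (by fun_prop)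
    rintro ⟨w, t⟩ ⟨hw, ht⟩
    exact one_sub_mul_mem_slitPlane (hball hw) ht
  -- The derivative of the kernel is bounded on a compact set, so a multiple of the integrable
  -- density dominates the differentiated integrand.
  obtain ⟨M, hM⟩ := ((isCompact_closedBall z ε).prod isCompact_Icc).exists_bound_of_continuousOn
    hcont
  have hsub : Set.uIoc (0 : ℝ) 1 ⊆ Set.Icc 0 1 := by
    rw [Set.uIoc_of_le zero_le_one]; exact Set.Ioc_subset_Icc_self
  have key := intervalIntegral.hasDerivAt_integral_of_dominated_loc_of_deriv_le
    (μ := MeasureTheory.volume) (a := (0 : ℝ)) (b := 1)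
    (F := fun w t => betaDensity s r t * (1 - w * (t : ℂ)) ^ (-(b : ℂ)))
    (F' := fun w t => betaDensity s r t * K' w t) (x₀ := z) (s := Metric.closedBall z ε)
    (bound := fun t => ‖betaDensity s r t‖ * M)
    (Metric.closedBall_mem_nhds z hε)
    (by
      filter_upwards [isOpen_cutPlane.mem_nhds hz] with w hw
      have := (intervalIntegrable_euler hs hr (-(b : ℂ)) hw).aestronglyMeasurable
      rwa [Set.uIoc_of_le zero_le_one])
    (intervalIntegrable_euler hs hr _ hz)
    (by
      have : IntervalIntegrable (fun t => betaDensity s r t * K' z t)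
          MeasureTheory.volume 0 1 := by
        apply (intervalIntegrable_betaDensity hs hr).mul_continuousOn
        exact ContinuousOn.mul (by fun_prop) (continuousOn_eulerKernel hz _)
      have := this.aestronglyMeasurable
      rwa [Set.uIoc_of_le zero_le_one])
    (by
      filter_upwards with t ht w hw
      rw [norm_mul]
      exact mul_le_mul_of_nonneg_left (hM (w, t) ⟨hw, hsub ht⟩) (norm_nonneg _))
    ((intervalIntegrable_betaDensity hs hr).norm.mul_const M)
    (by
      filter_upwards with t ht w hw
      have h1 : HasDerivAt (fun w : ℂ => 1 - w * (t : ℂ)) (-(t : ℂ)) w := by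
        simpa using ((hasDerivAt_id w).mul_const (t : ℂ)).const_sub 1
      have h2 := (h1.cpow_const (c := -(b : ℂ))
        (one_sub_mul_mem_slitPlane (hball hw) (hsub ht))).const_mul (betaDensity s r t)
      refine h2.congr_deriv ?_
      rw [hK']
      ring)
  refine HasDerivAt.congr_deriv key.2 ?_
  symm
  rw [eulerIntegral, ← intervalIntegral.integral_const_mul]
  apply integral_congr_Ioo
  intro t ht
  rw [betaDensity_add_one_left ht]
  push_cast
  rw [show -((b : ℂ) + 1) = -(b : ℂ) - 1 by ring, hK']
  ring

/-- The total derivative whose integral vanishes gives the hypergeometric equation. -/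
lemma eulerIntegral_ode {s r : ℝ} (hs : 0 < s) (hr : 0 < r) (b : ℝ) {z : ℂ} (hz : z ∈ cutPlane) :
    z * (1 - z) * ((b + 1) * eulerIntegral (s + 1 + 1) r (b + 1 + 1) z) +
      ((s + r) - (s + b + 1) * z) * eulerIntegral (s + 1) r (b + 1) z -
      s * eulerIntegral s r b z = 0 := by
  -- The primitive vanishes at both ends because `s` and `r` are positive. Written over the common
  -- factor `(1 - z t) ^ (-b - 2)`, its derivative is the integrand of the left side of the
  -- equation.
  set f : ℝ → ℂ := fun t => -((t : ℂ) ^ (s : ℂ) * (1 - (t : ℂ)) ^ (r : ℂ) *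
    (1 - z * (t : ℂ)) ^ (-(b : ℂ) - 1)) with hf
  set f' : ℝ → ℂ := fun t => betaDensity s r t *
    ((z * (1 - z) * (b + 1) * t ^ 2 + ((s + r) - (s + b + 1) * z) * (t * (1 - z * t)) -
    s * (1 - z * t) ^ 2) * (1 - z * (t : ℂ)) ^ (-(b : ℂ) - 2)) with hf'
  have hslit : ∀ t ∈ Set.Ioo (0 : ℝ) 1, 1 - z * (t : ℂ) ∈ slitPlane := fun t ht =>
    one_sub_mul_mem_slitPlane hz (Set.Ioo_subset_Icc_self ht)
  have hint : IntervalIntegrable f' MeasureTheory.volume 0 1 := by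
    apply (intervalIntegrable_betaDensity hs hr).mul_continuousOn
    exact ContinuousOn.mul (by fun_prop) (continuousOn_eulerKernel hz _)
  have hcont : ContinuousOn f (Set.Icc 0 1) := by
    rw [← Set.uIcc_of_le (zero_le_one' ℝ)]
    apply ContinuousOn.neg
    refine ContinuousOn.mul (Continuous.continuousOn ?_) (continuousOn_eulerKernel hz _)
    refine Continuous.mul (continuous_ofReal_cpow_const (by simpa using hs)) ?_
    have := (continuous_ofReal_cpow_const (y := (r : ℂ)) (by simpa using hr)).comp
      (continuous_const.sub continuous_id : Continuous fun t : ℝ => 1 - t)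
    simpa [Function.comp_def] using this
  have hderiv : ∀ t ∈ Set.Ioo (0 : ℝ) 1, HasDerivAt f (f' t) t := by
    intro t ht
    have ht0 : (t : ℂ) ∈ slitPlane := by simpa [mem_slitPlane_iff] using ht.1
    have ht1 : (1 - t : ℂ) ∈ slitPlane := by left; simpa using ht.2
    have e1 : HasDerivAt (fun w : ℂ => w ^ (s : ℂ)) (s * (t : ℂ) ^ ((s : ℂ) - 1)) (t : ℂ) :=
      (hasStrictDerivAt_cpow_const ht0).hasDerivAt
    have e2 : HasDerivAt (fun w : ℂ => (1 - w) ^ (r : ℂ)) (r * (1 - t : ℂ) ^ ((r : ℂ) - 1) * -1)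
        (t : ℂ) := ((hasDerivAt_id (t : ℂ)).const_sub 1).cpow_const ht1
    have e3 : HasDerivAt (fun w : ℂ => (1 - z * w) ^ (-(b : ℂ) - 1))
        ((-(b : ℂ) - 1) * (1 - z * t) ^ (-(b : ℂ) - 1 - 1) * -z) (t : ℂ) := by
      refine HasDerivAt.cpow_const ?_ (hslit t ht)
      simpa using ((hasDerivAt_id (t : ℂ)).const_mul z).const_sub 1
    have e := (((e1.mul e2).mul e3).neg).comp_ofReal
    refine HasDerivAt.congr_deriv e ?_
    have n0 := slitPlane_ne_zero ht0
    have n1 := slitPlane_ne_zero ht1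
    have n2 := slitPlane_ne_zero (hslit t ht)
    rw [hf']
    simp only [betaDensity, Pi.mul_apply]
    have c1 : (t : ℂ) ^ (s : ℂ) = t * (t : ℂ) ^ ((s : ℂ) - 1) := by
      rw [cpow_sub _ _ n0, cpow_one]; field_simp
    have c2 : (1 - t : ℂ) ^ (r : ℂ) = (1 - t) * (1 - t : ℂ) ^ ((r : ℂ) - 1) := by
      rw [cpow_sub _ _ n1, cpow_one]; field_simp
    have c3 : (1 - z * t : ℂ) ^ (-(b : ℂ) - 1) = (1 - z * t) * (1 - z * t) ^ (-(b : ℂ) - 2) := by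
      rw [show -(b : ℂ) - 1 = 1 + (-b - 2) by ring, cpow_add _ _ n2, cpow_one]
    rw [c1, c2, c3, show -(b : ℂ) - 1 - 1 = -b - 2 by ring]
    ring
  have h0 := intervalIntegral.integral_eq_sub_of_hasDerivAt_of_le zero_le_one hcont hderiv hint
  have hf0 : f 0 = 0 := by
    have : (s : ℂ) ≠ 0 := by exact_mod_cast hs.ne'
    simp [hf, this]
  have hf1 : f 1 = 0 := by
    have : (r : ℂ) ≠ 0 := by exact_mod_cast hr.ne'
    simp [hf, this]
  rw [hf0, hf1, sub_zero] at h0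
  rw [← h0]
  have i1 := ((intervalIntegrable_euler (s := s + 1 + 1) (by linarith) hr (-((b + 1 + 1 : ℝ) : ℂ))
    hz).const_mul ((b : ℂ) + 1)).const_mul (z * (1 - z))
  have i2 := (intervalIntegrable_euler (s := s + 1) (by linarith) hr (-((b + 1 : ℝ) : ℂ))
    hz).const_mul ((s + r : ℂ) - (s + b + 1) * z)
  have i3 := (intervalIntegrable_euler hs hr (-(b : ℂ)) hz).const_mul (s : ℂ)
  simp only [eulerIntegral]
  rw [← intervalIntegral.integral_const_mul, ← intervalIntegral.integral_const_mul,
    ← intervalIntegral.integral_const_mul, ← intervalIntegral.integral_const_mul,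
    ← intervalIntegral.integral_add, ← intervalIntegral.integral_sub]
  · apply integral_congr_Ioo
    intro t ht
    have n2 := slitPlane_ne_zero (hslit t ht)
    rw [betaDensity_add_one_left ht, betaDensity_add_one_left ht]
    have c1 : (1 - z * t : ℂ) ^ (-(b : ℂ) - 1) = (1 - z * t) * (1 - z * t) ^ (-(b : ℂ) - 2) := by
      rw [show -(b : ℂ) - 1 = 1 + (-b - 2) by ring, cpow_add _ _ n2, cpow_one]
    have c2 : (1 - z * t : ℂ) ^ (-(b : ℂ)) = (1 - z * t) ^ 2 * (1 - z * t) ^ (-(b : ℂ) - 2) := by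
      rw [show -(b : ℂ) = 2 + (-b - 2) by ring, cpow_add _ _ n2, cpow_ofNat]
      ring_nf
    push_cast
    rw [show -((b : ℂ) + 1 + 1) = -b - 2 by ring, show -((b : ℂ) + 1) = -b - 1 by ring, c1, c2]
    ring
  exacts [i1.add i2, i3, i1, i2]

/-! ### Identification of the Euler integral with the Gauss series -/

lemma eulerIntegral_zero (s r b : ℝ) : eulerIntegral s r b 0 = betaIntegral s r := by
  simp [eulerIntegral, betaIntegral, betaDensity]

lemma differentiableOn_eulerIntegral {s r : ℝ} (hs : 0 < s) (hr : 0 < r) (b : ℝ) :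
    DifferentiableOn ℂ (eulerIntegral s r b) cutPlane := fun _ hz =>
  (hasDerivAt_eulerIntegral hs hr b hz).differentiableAt.differentiableWithinAt

lemma iteratedDeriv_eulerIntegral {s r : ℝ} (hs : 0 < s) (hr : 0 < r) (b : ℝ) (n : ℕ) {z : ℂ}
    (hz : z ∈ cutPlane) :
    iteratedDeriv n (eulerIntegral s r b) z =
      (ascPochhammer ℂ n).eval (b : ℂ) * eulerIntegral (s + n) r (b + n) z := by
  induction n generalizing z with
  | zero => simp
  | succ n ih =>
    have hev : iteratedDeriv n (eulerIntegral s r b) =ᶠ[𝓝 z]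
        fun w => (ascPochhammer ℂ n).eval (b : ℂ) * eulerIntegral (s + n) r (b + n) w := by
      filter_upwards [isOpen_cutPlane.mem_nhds hz] with w hw using ih hw
    rw [iteratedDeriv_succ, hev.deriv_eq]
    have hsn : 0 < s + n := by positivity
    rw [((hasDerivAt_eulerIntegral hsn hr (b + n) hz).const_mul _).deriv, ascPochhammer_succ_eval]
    push_cast
    rw [← add_assoc, ← add_assoc]
    ring

lemma betaIntegral_eq_Gamma {s r : ℝ} (hs : 0 < s) (hr : 0 < r) :
    betaIntegral s r = ((Real.Gamma s * Real.Gamma r / Real.Gamma (s + r) : ℝ) : ℂ) := by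
  have h := Gamma_mul_Gamma_eq_betaIntegral (s := s) (t := r) (by simpa using hs) (by simpa using hr)
  have h0 : Gamma ((s : ℂ) + r) ≠ 0 := Gamma_ne_zero_of_re_pos (by simp; positivity)
  have h2 : ((Real.Gamma (s + r) : ℝ) : ℂ) = Gamma ((s : ℂ) + r) := by
    rw [← Complex.Gamma_ofReal]; push_cast; rfl
  push_cast
  rw [h2, ← Complex.Gamma_ofReal, ← Complex.Gamma_ofReal, h]
  field_simp

lemma betaIntegral_ne_zero {s r : ℝ} (hs : 0 < s) (hr : 0 < r) : betaIntegral s r ≠ 0 := by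
  rw [betaIntegral_eq_Gamma hs hr, ofReal_ne_zero]
  have := Real.Gamma_pos_of_pos hs
  have := Real.Gamma_pos_of_pos hr
  have := Real.Gamma_pos_of_pos (add_pos hs hr)
  positivity

/-- Pochhammer symbols are the quotients `Γ(x + n) / Γ(x)`. Their ratio is what turns the Taylor
coefficients of the Euler integral into those of the Gauss series. -/
lemma betaIntegral_add_nat {s r : ℝ} (hs : 0 < s) (hr : 0 < r) (n : ℕ) :
    betaIntegral (s + n : ℝ) r = betaIntegral s r * (ascPochhammer ℂ n).eval (s : ℂ) *
      ((ascPochhammer ℂ n).eval ((s + r : ℝ) : ℂ))⁻¹ := by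
  have key : ∀ x : ℝ, 0 < x → (ascPochhammer ℂ n).eval (x : ℂ) =
      ((Real.Gamma (x + n) / Real.Gamma x : ℝ) : ℂ) := by
    intro x hx
    rw [← Complex.Gamma_add_nat_div_Gamma_eq (n := n) (x : ℂ)]
    · push_cast [← Complex.Gamma_ofReal]; rfl
    · intro k hk
      have := congrArg Complex.re hk
      simp only [ofReal_re, neg_re, natCast_re] at this
      have : (0 : ℝ) ≤ k := k.cast_nonneg
      linarith
  have hsr := add_pos hs hr
  rw [key s hs, key _ hsr, betaIntegral_eq_Gamma (by positivity) hr, betaIntegral_eq_Gamma hs hr,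
    ← ofReal_inv, ← ofReal_mul, ← ofReal_mul]
  congr 1
  have h1 := (Real.Gamma_pos_of_pos hs).ne'
  have h2 := (Real.Gamma_pos_of_pos hsr).ne'
  have h3 := (Real.Gamma_pos_of_pos (show 0 < s + r + n by positivity)).ne'
  rw [show s + n + r = s + r + n by ring]
  field_simp

/-- Both sides have the same Taylor coefficients at `0`, and the integral is holomorphic on the unit
disc; no series has to be integrated term by term. -/
lemma eulerIntegral_eq_hypergeometric {a b c : ℝ} (ha : 0 < a) (hc : a < c) {z : ℂ}
    (hz : ‖z‖ < 1) :
    eulerIntegral a (c - a) b z = betaIntegral a (c - a : ℝ) * ₂F₁ (a : ℂ) (b : ℂ) (c : ℂ) z := by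
  have hr := sub_pos.mpr hc
  have h := hasSum_taylorSeries_on_ball
    ((differentiableOn_eulerIntegral ha hr b).mono ball_subset_cutPlane)
    (mem_ball_zero_iff.mpr hz)
  rw [← h.tsum_eq, ordinaryHypergeometric_eq_tsum, ← tsum_mul_left]
  congr 1
  ext n
  have h0 : eulerIntegral (a + n) (c - a) (b + n) 0 = _ := eulerIntegral_zero _ _ _
  rw [iteratedDeriv_eulerIntegral ha hr b n zero_mem_cutPlane, h0, betaIntegral_add_nat ha hr]
  simp only [smul_eq_mul, sub_zero, add_sub_cancel]
  ring

/-- The normalised Euler integral is the required continuation, so the definition of `gaussF` takes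
its first branch. -/
lemma gaussF_spec {a b c : ℝ} (ha : 0 < a) (hc : a < c) :
    DifferentiableOn ℂ (gaussF a b c) cutPlane ∧
      ∀ z : ℂ, ‖z‖ < 1 → gaussF a b c z = ₂F₁ (a : ℂ) (b : ℂ) (c : ℂ) z := by
  have hr := sub_pos.mpr hc
  have h : ∃ f : ℂ → ℂ, DifferentiableOn ℂ f cutPlane ∧
      ∀ z : ℂ, ‖z‖ < 1 → f z = ₂F₁ (a : ℂ) (b : ℂ) (c : ℂ) z := by
    refine ⟨fun z => (betaIntegral a (c - a : ℝ))⁻¹ * eulerIntegral a (c - a) b z,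
      (differentiableOn_eulerIntegral ha hr b).const_mul _, fun z hz => ?_⟩
    simp only [eulerIntegral_eq_hypergeometric ha hc hz]
    exact inv_mul_cancel_left₀ (betaIntegral_ne_zero ha hr) _
  rw [gaussF, dif_pos h]
  exact h.choose_spec

/-- Euler's integral formula for `F(a, b; c; z)` on the cut plane. -/
lemma gaussF_eq_eulerIntegral {a b c : ℝ} (ha : 0 < a) (hc : a < c) {z : ℂ} (hz : z ∈ cutPlane) :
    gaussF a b c z = (betaIntegral a (c - a : ℝ))⁻¹ * eulerIntegral a (c - a) b z := by
  have hr := sub_pos.mpr hc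
  obtain ⟨hd, he⟩ := gaussF_spec (b := b) ha hc
  refine AnalyticOnNhd.eqOn_of_preconnected_of_eventuallyEq (hd.analyticOnNhd isOpen_cutPlane)
    (((differentiableOn_eulerIntegral ha hr b).const_mul _).analyticOnNhd isOpen_cutPlane)
    isPreconnected_cutPlane zero_mem_cutPlane ?_ hz
  filter_upwards [Metric.ball_mem_nhds (0 : ℂ) one_pos] with w hw
  rw [mem_ball_zero_iff] at hw
  simp only [he w hw, eulerIntegral_eq_hypergeometric ha hc hw]
  exact (inv_mul_cancel_left₀ (betaIntegral_ne_zero ha hr) _).symm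

lemma gaussF_zero {a b c : ℝ} (ha : 0 < a) (hc : a < c) : gaussF a b c 0 = 1 := by
  rw [(gaussF_spec ha hc).2 0 (by simp), ordinaryHypergeometric_zero]

lemma betaIntegral_add_one_left {a c : ℝ} (ha : 0 < a) (hc : a < c) :
    betaIntegral (a + 1 : ℝ) (c - a : ℝ) = betaIntegral a (c - a : ℝ) * (a / c) := by
  have h := betaIntegral_add_nat ha (sub_pos.mpr hc) 1
  rw [add_sub_cancel] at h
  simp only [ascPochhammer_one, Polynomial.eval_X, Nat.cast_one] at h
  rw [h, mul_assoc, div_eq_mul_inv]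

lemma hasDerivAt_gaussF {a b c : ℝ} (ha : 0 < a) (hc : a < c) {z : ℂ} (hz : z ∈ cutPlane) :
    HasDerivAt (gaussF a b c) (a * b / c * gaussF (a + 1) (b + 1) (c + 1) z) z := by
  have hr := sub_pos.mpr hc
  have h := (hasDerivAt_eulerIntegral ha hr b hz).const_mul (betaIntegral a (c - a : ℝ))⁻¹
  have hev : gaussF a b c =ᶠ[𝓝 z]
      fun w => (betaIntegral a (c - a : ℝ))⁻¹ * eulerIntegral a (c - a) b w := by
    filter_upwards [isOpen_cutPlane.mem_nhds hz] with w hw using gaussF_eq_eulerIntegral ha hc hw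
  refine (h.congr_of_eventuallyEq hev).congr_deriv ?_
  rw [gaussF_eq_eulerIntegral (by linarith) (by linarith) hz,
    show c + 1 - (a + 1) = c - a by ring, betaIntegral_add_one_left ha hc]
  have h1 : (a : ℂ) ≠ 0 := ofReal_ne_zero.mpr ha.ne'
  have h2 : (c : ℂ) ≠ 0 := ofReal_ne_zero.mpr (ha.trans hc).ne'
  have h3 := betaIntegral_ne_zero ha hr
  field_simp

/-- The hypergeometric differential equation. -/
lemma gaussF_ode {a b c : ℝ} (ha : 0 < a) (hc : a < c) {z : ℂ} (hz : z ∈ cutPlane) :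
    z * (1 - z) * (a * b / c * ((a + 1) * (b + 1) / (c + 1) *
        gaussF (a + 1 + 1) (b + 1 + 1) (c + 1 + 1) z)) +
      (c - (a + b + 1) * z) * (a * b / c * gaussF (a + 1) (b + 1) (c + 1) z) -
      a * b * gaussF a b c z = 0 := by
  have hr := sub_pos.mpr hc
  have h := eulerIntegral_ode ha hr b hz
  have h4 := betaIntegral_add_one_left (a := a + 1) (c := c + 1) (by linarith) (by linarith)
  rw [show c + 1 - (a + 1) = c - a by ring, betaIntegral_add_one_left ha hc] at h4
  push_cast at h4
  rw [gaussF_eq_eulerIntegral (by linarith) (by linarith) hz,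
    gaussF_eq_eulerIntegral (by linarith) (by linarith) hz, gaussF_eq_eulerIntegral ha hc hz,
    show c + 1 - (a + 1) = c - a by ring, show c + 1 + 1 - (a + 1 + 1) = c - a by ring,
    betaIntegral_add_one_left ha hc]
  push_cast
  rw [h4]
  have h1 : (a : ℂ) ≠ 0 := ofReal_ne_zero.mpr ha.ne'
  have h2 : (c : ℂ) ≠ 0 := ofReal_ne_zero.mpr (ha.trans hc).ne'
  have h5 : (a + 1 : ℂ) ≠ 0 := by exact_mod_cast (by linarith : a + 1 ≠ 0)
  have h6 : (c + 1 : ℂ) ≠ 0 := by exact_mod_cast (by linarith : c + 1 ≠ 0)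
  have h3 := betaIntegral_ne_zero ha hr
  push_cast at h h3 ⊢
  rw [add_sub_cancel] at h
  field_simp
  linear_combination b * h

/-! ### Positivity of the Euler integral -/

lemma betaDensity_eq_ofReal {s r t : ℝ} (ht : t ∈ Set.Ioo (0 : ℝ) 1) :
    betaDensity s r t = ((t ^ (s - 1) * (1 - t) ^ (r - 1) : ℝ) : ℂ) := by
  rw [betaDensity, ofReal_mul, ofReal_cpow ht.1.le, ofReal_cpow (sub_pos.mpr ht.2).le]
  push_cast
  rfl

/-- Since `|arg (1 - z t)| ≤ π` and `0 < b < 1 / 2`, the argument of the kernel stays strictly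
between `-π / 2` and `π / 2`, and the density is positive. -/
lemma eulerIntegral_re_pos {s r b : ℝ} (hs : 0 < s) (hr : 0 < r) (hb : 0 < b) (hb' : b < 1 / 2)
    {z : ℂ} (hz : z ∈ cutPlane) : 0 < (eulerIntegral s r b z).re := by
  have hi := intervalIntegrable_euler hs hr (-(b : ℂ)) hz
  have h : (eulerIntegral s r b z).re =
      ∫ t in (0 : ℝ)..1, (betaDensity s r t * (1 - z * (t : ℂ)) ^ (-(b : ℂ))).re := by
    simp only [eulerIntegral, intervalIntegral.integral_of_le zero_le_one]
    exact (integral_re hi.1).symm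
  rw [h]
  refine intervalIntegral.intervalIntegral_pos_of_pos_on
    ⟨hi.1.re, hi.2.re⟩ (fun t ht => ?_) one_pos
  have hslit := one_sub_mul_mem_slitPlane hz (Set.Ioo_subset_Icc_self ht)
  rw [betaDensity_eq_ofReal ht, re_ofReal_mul]
  refine mul_pos (mul_pos (Real.rpow_pos_of_pos ht.1 _)
    (Real.rpow_pos_of_pos (sub_pos.mpr ht.2) _)) ?_
  rw [cpow_def_of_ne_zero (slitPlane_ne_zero hslit), exp_re]
  refine mul_pos (Real.exp_pos _) (Real.cos_pos_of_mem_Ioo ?_)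
  have him : (log (1 - z * t) * -(b : ℂ)).im = -(b * arg (1 - z * t)) := by
    simp [mul_im, log_im, mul_comm]
  rw [him]
  have h1 := neg_pi_lt_arg (1 - z * t)
  have h2 := arg_le_pi (1 - z * t)
  have := Real.pi_pos
  constructor <;> nlinarith

/-- For real argument the Euler integral is a positive real number. -/
lemma eulerIntegral_ofReal {s r : ℝ} (b : ℝ) (hs : 0 < s) (hr : 0 < r) {x : ℝ} (hx : x < 1) :
    ∃ y : ℝ, 0 < y ∧ eulerIntegral s r b x = y := by
  have hz : (x : ℂ) ∈ cutPlane := by left; simpa using hx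
  have hi := intervalIntegrable_euler hs hr (-(b : ℂ)) hz
  set g : ℝ → ℝ := fun t => t ^ (s - 1) * (1 - t) ^ (r - 1) * (1 - x * t) ^ (-b) with hg
  have hpos : ∀ t ∈ Set.Ioo (0 : ℝ) 1, 0 < 1 - x * t := by
    intro t ht
    nlinarith [ht.1, ht.2, mul_pos ht.1 (sub_pos.mpr hx)]
  have hgk : ∀ t ∈ Set.Ioo (0 : ℝ) 1,
      betaDensity s r t * (1 - (x : ℂ) * (t : ℂ)) ^ (-(b : ℂ)) = g t := by
    intro t ht
    rw [betaDensity_eq_ofReal ht, hg]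
    simp only [ofReal_mul (_ * _), ofReal_cpow (hpos t ht).le]
    push_cast
    rfl
  refine ⟨∫ t in (0 : ℝ)..1, g t, ?_, ?_⟩
  · refine intervalIntegral.intervalIntegral_pos_of_pos_on ?_ (fun t ht => ?_) one_pos
    · have hre : IntervalIntegrable (fun t : ℝ =>
          (betaDensity s r t * (1 - (x : ℂ) * (t : ℂ)) ^ (-(b : ℂ))).re) MeasureTheory.volume 0 1 :=
        ⟨hi.1.re, hi.2.re⟩
      refine hre.congr_ae ?_
      rw [Set.uIoc_of_le zero_le_one, ← MeasureTheory.Measure.restrict_congr_set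
        MeasureTheory.Ioo_ae_eq_Ioc]
      filter_upwards [MeasureTheory.ae_restrict_mem measurableSet_Ioo] with t ht
      rw [hgk t ht, ofReal_re]
    · exact mul_pos (mul_pos (Real.rpow_pos_of_pos ht.1 _)
        (Real.rpow_pos_of_pos (sub_pos.mpr ht.2) _)) (Real.rpow_pos_of_pos (hpos t ht) _)
  · rw [eulerIntegral, integral_congr_Ioo hgk, intervalIntegral.integral_ofReal]

/-! ### Limits of the hypergeometric function at `1` and at `-∞` -/

lemma one_sub_mul_pos {x t : ℝ} (hx : x < 1) (ht : t ∈ Set.Ioo (0 : ℝ) 1) : 0 < 1 - x * t := by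
  nlinarith [ht.1, ht.2, mul_pos ht.1 (sub_pos.mpr hx)]

lemma eulerKernel_eq_ofReal {x t : ℝ} (b : ℝ) (hx : x < 1) (ht : t ∈ Set.Ioo (0 : ℝ) 1) :
    (1 - (x : ℂ) * (t : ℂ)) ^ (-(b : ℂ)) = (((1 - x * t) ^ (-b) : ℝ) : ℂ) := by
  rw [ofReal_cpow (one_sub_mul_pos hx ht).le]
  push_cast
  rfl

/-- At `z = 1` the kernel becomes a power of `1 - t`, which lowers the second exponent of the
density by `b`. -/
lemma betaDensity_sub {s r b t : ℝ} (ht : t ∈ Set.Ioo (0 : ℝ) 1) :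
    betaDensity s (r - b) t = betaDensity s r t * (1 - (t : ℂ)) ^ (-(b : ℂ)) := by
  have h0 : (1 - t : ℂ) ≠ 0 := by
    have := ofReal_ne_zero.mpr (sub_pos.mpr ht.2).ne'
    simpa using this
  simp only [betaDensity]
  push_cast
  rw [mul_assoc, ← cpow_add _ _ h0]
  ring_nf

lemma ae_mem_Ioo_of_mem_uIoc :
    ∀ᵐ t : ℝ, t ∈ Set.uIoc (0 : ℝ) 1 → t ∈ Set.Ioo (0 : ℝ) 1 := by
  have h1 : ∀ᵐ t : ℝ, t ≠ 1 := by simp [MeasureTheory.ae_iff]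
  filter_upwards [h1] with t ht1 ht
  rw [Set.uIoc_of_le zero_le_one] at ht
  exact ⟨ht.1, lt_of_le_of_ne ht.2 ht1⟩

/-- Gauss' summation of the Euler integral at `1`. -/
lemma tendsto_eulerIntegral_one {s r b : ℝ} (hs : 0 < s) (hb : 0 < b) (hbr : b < r) :
    Tendsto (fun x : ℝ => eulerIntegral s r b x) (𝓝[<] 1) (𝓝 (betaIntegral s (r - b : ℝ))) := by
  have hr : 0 < r := hb.trans hbr
  have hx0 : ∀ᶠ x : ℝ in 𝓝[<] 1, x ∈ Set.Ioo (0 : ℝ) 1 := Ioo_mem_nhdsLT one_pos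
  -- The limit integrand itself dominates: `1 - t ≤ 1 - x t`, and the exponent `-b` is negative.
  refine intervalIntegral.tendsto_integral_filter_of_dominated_convergence
    (fun t => ‖betaDensity s (r - b) t‖) ?_ ?_
    (intervalIntegrable_betaDensity hs (sub_pos.mpr hbr)).norm ?_
  · filter_upwards [hx0] with x hx
    have hz : (x : ℂ) ∈ cutPlane := by left; simpa using hx.2
    have := (intervalIntegrable_euler hs hr (-(b : ℂ)) hz).aestronglyMeasurable
    rwa [Set.uIoc_of_le zero_le_one]
  · filter_upwards [hx0] with x hx
    filter_upwards [ae_mem_Ioo_of_mem_uIoc] with t ht h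
    have ht := ht h
    rw [betaDensity_sub ht, norm_mul, norm_mul]
    refine mul_le_mul_of_nonneg_left ?_ (norm_nonneg _)
    have h1 : (1 - (t : ℂ)) ^ (-(b : ℂ)) = (((1 - t) ^ (-b) : ℝ) : ℂ) := by
      rw [ofReal_cpow (sub_pos.mpr ht.2).le]
      push_cast
      rfl
    rw [eulerKernel_eq_ofReal b hx.2 ht, h1, norm_real, norm_real,
      Real.norm_of_nonneg (Real.rpow_nonneg (one_sub_mul_pos hx.2 ht).le _),
      Real.norm_of_nonneg (Real.rpow_nonneg (sub_pos.mpr ht.2).le _)]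
    refine Real.rpow_le_rpow_of_nonpos (sub_pos.mpr ht.2) ?_ (by linarith)
    nlinarith [ht.1, hx.2]
  · filter_upwards [ae_mem_Ioo_of_mem_uIoc] with t ht h
    have ht := ht h
    change Tendsto _ _ (𝓝 (betaDensity s (r - b) t))
    rw [betaDensity_sub ht]
    refine Tendsto.const_mul _ ?_
    have hc : ContinuousAt (fun x : ℝ => (1 - (x : ℂ) * (t : ℂ)) ^ (-(b : ℂ))) 1 := by
      refine ContinuousAt.cpow (by fun_prop) continuousAt_const ?_
      left
      simpa using ht.2
    have := hc.tendsto
    simp only [ofReal_one, one_mul] at this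
    exact this.mono_left nhdsWithin_le_nhds

/-- Pfaff's transformation on the negative real axis. -/
lemma eulerIntegral_pfaff (s r b : ℝ) {x : ℝ} (hx : x < 0) :
    eulerIntegral s r b x =
      (((1 - x) ^ (-b) : ℝ) : ℂ) * eulerIntegral r s b ((x / (x - 1) : ℝ) : ℂ) := by
  -- Substitute `t ↦ 1 - t` and use `1 - x (1 - t) = (1 - x) (1 - x / (x - 1) * t)`.
  have h := intervalIntegral.integral_comp_sub_left (a := 0) (b := 1)
    (fun t : ℝ => betaDensity s r t * (1 - (x : ℂ) * (t : ℂ)) ^ (-(b : ℂ))) 1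
  rw [sub_self, sub_zero] at h
  rw [eulerIntegral, ← h, eulerIntegral, ← intervalIntegral.integral_const_mul]
  apply integral_congr_Ioo
  intro t ht
  have ht' : 1 - t ∈ Set.Ioo (0 : ℝ) 1 := ⟨by linarith [ht.2], by linarith [ht.1]⟩
  have hx' : x / (x - 1) < 1 := by
    rw [div_lt_one_of_neg (by linarith)]; linarith
  rw [eulerKernel_eq_ofReal b (by linarith) ht', eulerKernel_eq_ofReal b hx' ht,
    show 1 - x * (1 - t) = (1 - x) * (1 - x / (x - 1) * t) by
      have : x - 1 ≠ 0 := by linarith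
      field_simp
      ring,
    Real.mul_rpow (by linarith) (one_sub_mul_pos hx' ht).le]
  simp only [betaDensity]
  push_cast
  ring_nf

lemma tendsto_div_sub_one_atBot :
    Tendsto (fun x : ℝ => x / (x - 1)) atBot (𝓝[<] 1) := by
  rw [tendsto_nhdsWithin_iff]
  constructor
  · have h : Tendsto (fun x : ℝ => 1 + (x - 1)⁻¹) atBot (𝓝 (1 + 0)) :=
      (tendsto_inv_atBot_zero.comp (tendsto_atBot_add_const_right _ (-1) tendsto_id)).const_add 1
    rw [add_zero] at h
    refine h.congr' ?_
    filter_upwards [eventually_lt_atBot 0] with x hx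
    have : x - 1 ≠ 0 := by linarith
    field_simp
    ring
  · filter_upwards [eventually_lt_atBot 0] with x hx
    rw [Set.mem_Iio, div_lt_one_of_neg (by linarith)]
    linarith

lemma ofReal_mem_cutPlane {x : ℝ} (hx : x < 1) : (x : ℂ) ∈ cutPlane := by left; simpa using hx

/-- `Γ(c) Γ(c - a - b) / (Γ(c - a) Γ(c - b))`, the value of `F(a, b; c; z)` at `1`. -/
def gaussValue (a b c : ℝ) : ℝ :=
  Real.Gamma c * Real.Gamma (c - a - b) / (Real.Gamma (c - a) * Real.Gamma (c - b))

lemma tendsto_gaussF_one {a b c : ℝ} (ha : 0 < a) (hb : 0 < b) (h : a + b < c) :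
    Tendsto (fun x : ℝ => gaussF a b c x) (𝓝[<] 1) (𝓝 (gaussValue a b c)) := by
  have hc : a < c := by linarith
  have h1 := (tendsto_eulerIntegral_one (r := c - a) ha hb (by linarith)).const_mul
    (betaIntegral a (c - a : ℝ))⁻¹
  have h2 : (betaIntegral a (c - a : ℝ))⁻¹ * betaIntegral a (c - a - b : ℝ) =
      gaussValue a b c := by
    rw [betaIntegral_eq_Gamma ha (by linarith), betaIntegral_eq_Gamma ha (by linarith),
      ← ofReal_inv, ← ofReal_mul, gaussValue, add_sub_cancel, show a + (c - a - b) = c - b by ring]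
    congr 1
    have := (Real.Gamma_pos_of_pos ha).ne'
    have := (Real.Gamma_pos_of_pos (sub_pos.mpr hc)).ne'
    have := (Real.Gamma_pos_of_pos (show 0 < c by linarith)).ne'
    field_simp
  rw [h2] at h1
  refine h1.congr' ?_
  filter_upwards [self_mem_nhdsWithin] with x hx
  exact (gaussF_eq_eulerIntegral ha hc (ofReal_mem_cutPlane hx)).symm

/-- Pfaff's transformation carries `-∞` to `1` and exchanges the two exponents of the density; then
the summation at `1` applies, with `b < a` as the condition of convergence. -/
lemma tendsto_gaussF_atBot {a b c : ℝ} (hb : 0 < b) (hab : b < a) (hc : a < c) :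
    Tendsto (fun x : ℝ => (((1 - x) ^ b : ℝ) : ℂ) * gaussF a b c x) atBot
      (𝓝 ((Real.Gamma c * Real.Gamma (a - b) / (Real.Gamma a * Real.Gamma (c - b)) : ℝ) : ℂ)) := by
  have ha : 0 < a := hb.trans hab
  have hca : 0 < c - a := sub_pos.mpr hc
  have h1 := ((tendsto_eulerIntegral_one hca hb hab).comp tendsto_div_sub_one_atBot).const_mul
    (betaIntegral a (c - a : ℝ))⁻¹
  have h2 : (betaIntegral a (c - a : ℝ))⁻¹ * betaIntegral (c - a : ℝ) (a - b : ℝ) =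
      ((Real.Gamma c * Real.Gamma (a - b) / (Real.Gamma a * Real.Gamma (c - b)) : ℝ) : ℂ) := by
    rw [betaIntegral_eq_Gamma ha hca, betaIntegral_eq_Gamma hca (by linarith),
      ← ofReal_inv, ← ofReal_mul, add_sub_cancel, show c - a + (a - b) = c - b by ring]
    congr 1
    have := (Real.Gamma_pos_of_pos ha).ne'
    have := (Real.Gamma_pos_of_pos hca).ne'
    have := (Real.Gamma_pos_of_pos (show 0 < c by linarith)).ne'
    field_simp
  rw [h2] at h1
  refine h1.congr' ?_
  filter_upwards [eventually_lt_atBot 0] with x hx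
  rw [gaussF_eq_eulerIntegral ha hc (ofReal_mem_cutPlane (by linarith)),
    eulerIntegral_pfaff _ _ _ hx, Function.comp_apply]
  have h3 : (((1 - x) ^ b : ℝ) : ℂ) * (((1 - x) ^ (-b) : ℝ) : ℂ) = 1 := by
    rw [← ofReal_mul, ← Real.rpow_add (by linarith), add_neg_cancel, Real.rpow_zero, ofReal_one]
  linear_combination (-(betaIntegral a (c - a : ℝ))⁻¹ *
    eulerIntegral (c - a) a b ((x / (x - 1) : ℝ) : ℂ)) * h3

lemma gaussF_ofReal {a b c : ℝ} (ha : 0 < a) (hc : a < c) {x : ℝ} (hx : x < 1) :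
    ∃ y : ℝ, 0 < y ∧ gaussF a b c x = y := by
  have hr := sub_pos.mpr hc
  obtain ⟨y, hy, h⟩ := eulerIntegral_ofReal b ha hr hx
  refine ⟨(Real.Gamma a * Real.Gamma (c - a) / Real.Gamma (a + (c - a)))⁻¹ * y, ?_, ?_⟩
  · have := Real.Gamma_pos_of_pos ha
    have := Real.Gamma_pos_of_pos hr
    have := Real.Gamma_pos_of_pos (add_pos ha hr)
    positivity
  · rw [gaussF_eq_eulerIntegral ha hc (ofReal_mem_cutPlane hx), h, betaIntegral_eq_Gamma ha hr,
      ofReal_mul, ofReal_inv]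

lemma gaussF_ne_zero {a b c : ℝ} (ha : 0 < a) (hc : a < c) (hb : 0 < b) (hb' : b < 1 / 2) {z : ℂ}
    (hz : z ∈ cutPlane) : gaussF a b c z ≠ 0 := by
  have hr := sub_pos.mpr hc
  rw [gaussF_eq_eulerIntegral ha hc hz]
  refine mul_ne_zero (inv_ne_zero (betaIntegral_ne_zero ha hr)) fun h => ?_
  have := eulerIntegral_re_pos ha hr hb hb' hz
  rw [h] at this
  exact this.false

/-! ### The hypergeometric differential equation with given angles -/

/-- The angles `π α`, `π β`, `π γ` are those of a hyperbolic triangle. -/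
structure Hyperbolic (α β γ : ℝ) : Prop where
  pos₁ : 0 < α
  pos₂ : 0 < β
  pos₃ : 0 < γ
  sum_lt : α + β + γ < 1

/-- Facts proved at the vertex `0` pass to the other two vertices by this cyclic permutation. -/
lemma Hyperbolic.rotate {α β γ : ℝ} (h : Hyperbolic α β γ) : Hyperbolic β γ α :=
  ⟨h.pos₂, h.pos₃, h.pos₁, by linarith [h.sum_lt]⟩

/-- The denominator of the Schwarz triangle function. -/
def denF (α β γ : ℝ) : ℂ → ℂ := gaussF (parA α β γ) (parB α β γ) (parC α)

/-- The numerator of the Schwarz triangle function without the power of `z`. -/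
def numF (α β γ : ℝ) : ℂ → ℂ := gaussF (parA' α β γ) (parB' α β γ) (parC' α)

lemma phi_eq (α β γ : ℝ) (z : ℂ) :
    phi α β γ z = z ^ (α : ℂ) * numF α β γ z / denF α β γ z := by
  simp [phi, numF, denF, parC]

variable {α β γ : ℝ}

lemma Hyperbolic.parA_pos (h : Hyperbolic α β γ) : 0 < parA α β γ := by
  obtain ⟨h1, h2, h3, h4⟩ := h; simp only [parA]; linarith
lemma Hyperbolic.parA_lt (h : Hyperbolic α β γ) : parA α β γ < parC α := by
  obtain ⟨h1, h2, h3, h4⟩ := h; simp only [parA, parC]; linarith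
lemma Hyperbolic.parB_pos (h : Hyperbolic α β γ) : 0 < parB α β γ := by
  obtain ⟨h1, h2, h3, h4⟩ := h; simp only [parB]; linarith
lemma Hyperbolic.parB_lt (h : Hyperbolic α β γ) : parB α β γ < 1 / 2 := by
  obtain ⟨h1, h2, h3, h4⟩ := h; simp only [parB]; linarith
lemma Hyperbolic.parA'_pos (h : Hyperbolic α β γ) : 0 < parA' α β γ := by
  obtain ⟨h1, h2, h3, h4⟩ := h; simp only [parA', parA, parC]; linarith
lemma Hyperbolic.parA'_lt (h : Hyperbolic α β γ) : parA' α β γ < parC' α := by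
  obtain ⟨h1, h2, h3, h4⟩ := h; simp only [parA', parC', parA, parC]; linarith
lemma Hyperbolic.parB'_pos (h : Hyperbolic α β γ) : 0 < parB' α β γ := by
  obtain ⟨h1, h2, h3, h4⟩ := h; simp only [parB', parB, parC]; linarith

/-- `f`, with derivative `f'`, solves on `D` the hypergeometric equation with the exponent
differences `α`, `γ`, `β` at `0`, `1`, `∞`. -/
def HypSol (α β γ : ℝ) (D : Set ℂ) (f f' : ℂ → ℂ) : Prop :=
  ∀ z ∈ D, HasDerivAt f (f' z) z ∧ ∃ d, HasDerivAt f' d z ∧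
    z * (1 - z) * d + ((1 - α) - (2 - α - γ) * z) * f' z -
      parA α β γ * parB α β γ * f z = 0

/-- The derivative of `denF`. -/
def denF' (α β γ : ℝ) (z : ℂ) : ℂ :=
  parA α β γ * parB α β γ / parC α * gaussF (parA α β γ + 1) (parB α β γ + 1) (parC α + 1) z

/-- The derivative of `numF`. -/
def numF' (α β γ : ℝ) (z : ℂ) : ℂ :=
  parA' α β γ * parB' α β γ / parC' α *
    gaussF (parA' α β γ + 1) (parB' α β γ + 1) (parC' α + 1) z

lemma hypSol_denF (h : Hyperbolic α β γ) : HypSol α β γ cutPlane (denF α β γ) (denF' α β γ) := by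
  intro z hz
  refine ⟨hasDerivAt_gaussF h.parA_pos h.parA_lt hz, _,
    (hasDerivAt_gaussF (by linarith [h.parA_pos]) (by linarith [h.parA_lt]) hz).const_mul _, ?_⟩
  have := gaussF_ode (b := parB α β γ) h.parA_pos h.parA_lt hz
  simp only [denF, denF', parA, parB, parC] at this ⊢
  push_cast at this ⊢
  linear_combination this

/-- The constant term comes from `a' = a + α` and `b' = b + α`, whence `a' b' = a b + α (1 - γ)`. -/
lemma numF_ode (h : Hyperbolic α β γ) {z : ℂ} (hz : z ∈ cutPlane) :
    HasDerivAt (numF α β γ) (numF' α β γ z) z ∧ ∃ d, HasDerivAt (numF' α β γ) d z ∧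
      z * (1 - z) * d + ((1 + α) - (2 + α - γ) * z) * numF' α β γ z -
        (parA α β γ * parB α β γ + α * (1 - γ)) * numF α β γ z = 0 := by
  refine ⟨hasDerivAt_gaussF h.parA'_pos h.parA'_lt hz, _,
    (hasDerivAt_gaussF (by linarith [h.parA'_pos]) (by linarith [h.parA'_lt]) hz).const_mul _, ?_⟩
  have := gaussF_ode (b := parB' α β γ) h.parA'_pos h.parA'_lt hz
  simp only [numF, numF', parA', parB', parC', parA, parB, parC] at this ⊢
  push_cast at this ⊢
  linear_combination this

/-- Multiplication of `numF` by a branch of `z ^ α` gives a solution. -/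
lemma hypSol_mul_numF (h : Hyperbolic α β γ) {D : Set ℂ} (hD : D ⊆ cutPlane) (h0 : (0 : ℂ) ∉ D)
    {k : ℂ → ℂ} (hk : ∀ z ∈ D, HasDerivAt k (α / z * k z) z) :
    HypSol α β γ D (fun z => k z * numF α β γ z)
      (fun z => α / z * k z * numF α β γ z + k z * numF' α β γ z) := by
  intro z hz
  have hz0 : z ≠ 0 := fun h => h0 (h ▸ hz)
  obtain ⟨e1, d, e2, hode⟩ := numF_ode h (hD hz)
  have e3 : HasDerivAt (fun z : ℂ => α / z) (-α / z ^ 2) z := by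
    have := (hasDerivAt_inv hz0).const_mul (α : ℂ)
    simpa [div_eq_mul_inv] using this
  refine ⟨(hk z hz).mul e1, _, (((e3.mul (hk z hz)).mul e1).add ((hk z hz).mul e2)), ?_⟩
  simp only [Pi.mul_apply]
  have hi : z * z⁻¹ = 1 := mul_inv_cancel₀ hz0
  simp only [div_eq_mul_inv]
  rw [show (z ^ 2)⁻¹ = z⁻¹ * z⁻¹ by rw [pow_two, mul_inv]]
  linear_combination k z * hode + (k z * numF α β γ z * α * ((α - 1) * (1 - z) * z⁻¹ -
    (2 - α - γ) + 1 - α) + 2 * α * (1 - z) * k z * numF' α β γ z) * hi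

/-- The substitution `z ↦ 1 / (1 - z)` permutes the exponent differences cyclically. -/
lemma hypSol_comp {G G' : ℂ → ℂ} {D D' : Set ℂ} (hG : HypSol β γ α D' G G') (hD : D ⊆ cutPlane)
    (hDD' : ∀ z ∈ D, (1 - z)⁻¹ ∈ D') :
    HypSol α β γ D (fun z => (1 - z) ^ (-(parB α β γ : ℂ)) * G (1 - z)⁻¹)
      (fun z => (1 - z) ^ (-(parB α β γ : ℂ)) * (parB α β γ * (1 - z)⁻¹ * G (1 - z)⁻¹ +
        ((1 - z)⁻¹) ^ 2 * G' (1 - z)⁻¹)) := by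
  intro z hz
  have hslit : 1 - z ∈ slitPlane := hD hz
  have hne := slitPlane_ne_zero hslit
  obtain ⟨g1, d, g2, hode⟩ := hG _ (hDD' z hz)
  have hs : HasDerivAt (fun z : ℂ => 1 - z) (-1) z := (hasDerivAt_id z).const_sub 1
  have hi : HasDerivAt (fun z : ℂ => (1 - z)⁻¹) (((1 - z)⁻¹) ^ 2) z := by
    refine (hs.inv hne).congr_deriv ?_
    field_simp
  have hk : HasDerivAt (fun z : ℂ => (1 - z) ^ (-(parB α β γ : ℂ)))
      ((1 - z) ^ (-(parB α β γ : ℂ)) * (parB α β γ * (1 - z)⁻¹)) z := by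
    refine (hs.cpow_const hslit).congr_deriv ?_
    rw [cpow_sub _ _ hne, cpow_one]
    field_simp
  have g1' := g1.comp z hi
  have g2' := g2.comp z hi
  refine ⟨(hk.mul g1').congr_deriv ?_, _,
    hk.mul (((hi.const_mul (parB α β γ : ℂ)).mul g1').add ((hi.pow 2).mul g2')), ?_⟩
  · simp only [Function.comp_apply]; ring
  · simp only [Function.comp_apply, Pi.pow_apply]
    have hi1 : (1 - z) * (1 - z)⁻¹ = 1 := mul_inv_cancel₀ hne
    set i := (1 - z)⁻¹
    set k := (1 - z) ^ (-(parB α β γ : ℂ))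
    simp only [parA, parB] at hode ⊢
    push_cast at hode ⊢
    have h2 : z * i = i - 1 := by linear_combination -hi1
    have h1 : z * (1 - z) * i ^ 2 = i - 1 := by linear_combination (z * i) * hi1 + h2
    linear_combination (-(k * i)) * hode + (k * ((1 - α - β - γ) / 2 * ((1 - α - β - γ) / 2 + 1) *
      G i + (1 - α - β - γ + 2) * i * G' i + i ^ 2 * d)) * h1 - ((2 - α - γ) * k *
      ((1 - α - β - γ) / 2 * G i + i * G' i)) * h2

/-- Two solutions with nowhere vanishing Wronskian span the space of solutions. -/
lemma HypSol.exists_linear_combination {D : Set ℂ} (hD : IsOpen D) (hD' : IsPreconnected D)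
    (h0 : (0 : ℂ) ∉ D) (h1 : (1 : ℂ) ∉ D) {f f' g g' y y' : ℂ → ℂ} (hf : HypSol α β γ D f f')
    (hg : HypSol α β γ D g g') (hy : HypSol α β γ D y y')
    (hW : ∀ z ∈ D, f z * g' z - f' z * g z ≠ 0) :
    ∃ P Q : ℂ, ∀ z ∈ D, y z = P * f z + Q * g z := by
  -- By Abel's identity all Wronskians satisfy the same first order linear equation, so the quotient
  -- of two of them is constant. Cramer's rule then gives the coefficients of `y`.
  have key : ∀ {u u' v v' : ℂ → ℂ}, HypSol α β γ D u u' → HypSol α β γ D v v' →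
      ∃ P : ℂ, ∀ z ∈ D, (u z * v' z - u' z * v z) / (f z * g' z - f' z * g z) = P := by
    intro u u' v v' hu hv
    have hd : ∀ z ∈ D, HasDerivAt
        (fun z => (u z * v' z - u' z * v z) / (f z * g' z - f' z * g z)) 0 z := by
      intro z hz
      obtain ⟨u1, du, u2, hu⟩ := hu z hz
      obtain ⟨v1, dv, v2, hv⟩ := hv z hz
      obtain ⟨f1, df, f2, hf⟩ := hf z hz
      obtain ⟨g1, dg, g2, hg⟩ := hg z hz
      refine (((u1.mul v2).sub (u2.mul v1)).div ((f1.mul g2).sub (f2.mul g1)) (hW z hz)).congr_deriv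
        ?_
      have hz0 : z * (1 - z) ≠ 0 := mul_ne_zero (fun h => h0 (h ▸ hz))
        (sub_ne_zero.mpr fun h => h1 (h ▸ hz))
      rw [div_eq_zero_iff]
      left
      simp only [Pi.mul_apply, Pi.sub_apply]
      apply mul_left_cancel₀ hz0
      linear_combination (f z * g' z - f' z * g z) * (u z * hv - v z * hu) -
        (u z * v' z - u' z * v z) * (f z * hg - g z * hf)
    rcases D.eq_empty_or_nonempty with rfl | ⟨z₀, hz₀⟩
    · exact ⟨0, by simp⟩
    · exact ⟨_, fun z hz => hD.is_const_of_deriv_eq_zero hD'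
        (fun z hz => (hd z hz).differentiableAt.differentiableWithinAt)
        (fun z hz => (hd z hz).deriv) hz hz₀⟩
  obtain ⟨P, hP⟩ := key hy hg
  obtain ⟨Q, hQ⟩ := key hf hy
  refine ⟨P, Q, fun z hz => ?_⟩
  rw [← hP z hz, ← hQ z hz]
  rw [div_mul_eq_mul_div, div_mul_eq_mul_div, ← add_div, eq_div_iff (hW z hz)]
  ring

/-- The Wronskian of the two standard solutions at `0`. -/
lemma wronskian_eq (h : Hyperbolic α β γ) {z : ℂ} (hz : z ∈ cutPlane) :
    α * denF α β γ z * numF α β γ z +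
      z * (denF α β γ z * numF' α β γ z - denF' α β γ z * numF α β γ z) =
      α * (1 - z) ^ ((γ : ℂ) - 1) := by
  -- The Wronskian of `denF` and `z ^ α * numF` is `z ^ (α - 1)` times the left side of the claim.
  -- Without that power the expression is holomorphic at `0`, and multiplied by the integrating
  -- factor it is constant with value `α`, read off at `0`.
  set K : ℂ → ℂ := fun z => (1 - z) ^ (1 - (γ : ℂ)) * (α * (denF α β γ z * numF α β γ z) +
      z * (denF α β γ z * numF' α β γ z - denF' α β γ z * numF α β γ z)) with hK
  have hd : ∀ z ∈ cutPlane, HasDerivAt K 0 z := by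
    intro z hz
    have hslit : 1 - z ∈ slitPlane := hz
    have hne := slitPlane_ne_zero hslit
    obtain ⟨f1, d, f2, hf⟩ := hypSol_denF h z hz
    obtain ⟨e1, e, e2, hg⟩ := numF_ode h hz
    have hs : HasDerivAt (fun z : ℂ => 1 - z) (-1) z := (hasDerivAt_id z).const_sub 1
    have hk : HasDerivAt (fun z : ℂ => (1 - z) ^ (1 - (γ : ℂ)))
        ((1 - z) ^ (1 - (γ : ℂ)) * ((γ - 1) * (1 - z)⁻¹)) z := by
      refine (hs.cpow_const hslit).congr_deriv ?_
      rw [cpow_sub (x := 1 - z) (1 - (γ : ℂ)) 1 hne, cpow_one]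
      field_simp
      ring
    refine (hk.mul (((f1.mul e1).const_mul (α : ℂ)).add
      ((hasDerivAt_id z).mul ((f1.mul e2).sub (f2.mul e1))))).congr_deriv ?_
    apply mul_left_cancel₀ hne
    simp only [Pi.mul_apply, Pi.sub_apply, Pi.add_apply, id]
    have hi : (1 - z) * (1 - z)⁻¹ = 1 := mul_inv_cancel₀ hne
    set k := (1 - z) ^ (1 - (γ : ℂ))
    linear_combination k * (denF α β γ z * hg - numF α β γ z * hf) + k * (γ - 1) *
      (α * (denF α β γ z * numF α β γ z) + z * (denF α β γ z * numF' α β γ z -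
        denF' α β γ z * numF α β γ z)) * hi
  have h0 : K z = K 0 := isOpen_cutPlane.is_const_of_deriv_eq_zero isPreconnected_cutPlane
    (fun z hz => (hd z hz).differentiableAt.differentiableWithinAt)
    (fun z hz => (hd z hz).deriv) hz zero_mem_cutPlane
  have hne : 1 - z ≠ 0 := slitPlane_ne_zero hz
  have h1 : K 0 = α := by
    simp [hK, denF, numF, gaussF_zero h.parA_pos h.parA_lt, gaussF_zero h.parA'_pos h.parA'_lt]
  rw [h1] at h0
  have h2 : (1 - z) ^ ((γ : ℂ) - 1) * (1 - z) ^ (1 - (γ : ℂ)) = 1 := by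
    rw [← cpow_add _ _ hne]
    simp
  simp only [hK] at h0
  linear_combination (1 - z) ^ ((γ : ℂ) - 1) * h0 - (α * denF α β γ z * numF α β γ z +
      z * (denF α β γ z * numF' α β γ z - denF' α β γ z * numF α β γ z)) * h2

/-! ### The connection formula -/

/-- The plane cut along `[0, ∞)`. -/
def posCut : Set ℂ := {z | -z ∈ slitPlane}

lemma isOpen_posCut : IsOpen posCut := isOpen_slitPlane.preimage continuous_neg

lemma isPreconnected_posCut : IsPreconnected posCut := by
  have h : posCut = (fun z : ℂ => -z) '' slitPlane := by
    ext z
    simp [posCut]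
  rw [h]
  have h1 := (starConvex_one_slitPlane.isPathConnected one_mem_slitPlane).isConnected.isPreconnected
  exact h1.image _ continuous_neg.continuousOn

lemma posCut_subset : posCut ⊆ cutPlane := by
  intro z hz
  have hz : 0 < (-z).re ∨ (-z).im ≠ 0 := hz
  change 0 < (1 - z).re ∨ (1 - z).im ≠ 0
  simp only [neg_re, neg_im, sub_re, one_re, sub_im, one_im] at hz ⊢
  rcases hz with h | h
  · left; linarith
  · right; simpa using h

lemma one_add_mem_slitPlane {z : ℂ} (hz : z ∈ slitPlane) : 1 + z ∈ slitPlane := by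
  rw [mem_slitPlane_iff] at hz ⊢
  simp only [add_re, one_re, add_im, one_im, zero_add]
  rcases hz with h | h
  · left; linarith
  · right; exact h

lemma inv_mem_slitPlane' {z : ℂ} (hz : z ∈ slitPlane) : z⁻¹ ∈ slitPlane := by
  rw [mem_slitPlane_iff_arg] at hz ⊢
  refine ⟨?_, inv_ne_zero hz.2⟩
  rw [arg_inv, if_neg hz.1]
  have := neg_pi_lt_arg z
  linarith

/-- The identity `1 - (1 - z)⁻¹ = (1 + (-z)⁻¹)⁻¹` reduces the second membership to the stability of
the slit plane under inversion and under adding `1`. On `posCut` the solutions at `0` and those at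
`∞` are thus holomorphic together. -/
lemma inv_one_sub_mem {z : ℂ} (hz : z ∈ posCut) : (1 - z)⁻¹ ∈ slitPlane ∩ cutPlane := by
  have h1 : 1 - z ∈ slitPlane := posCut_subset hz
  refine ⟨inv_mem_slitPlane' h1, ?_⟩
  have h2 := inv_mem_slitPlane' (one_add_mem_slitPlane (inv_mem_slitPlane' hz))
  have h0 : z ≠ 0 := fun h => slitPlane_ne_zero (show -z ∈ slitPlane from hz) (by simp [h])
  have h3 : 1 - (1 - z)⁻¹ = (1 + (-z)⁻¹)⁻¹ := by
    have h4 := slitPlane_ne_zero h1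
    have h5 : 1 + (-z)⁻¹ ≠ 0 := slitPlane_ne_zero (one_add_mem_slitPlane (inv_mem_slitPlane' hz))
    have h6 : 1 + (-z)⁻¹ = -(1 - z) / z := by field_simp; ring
    rw [h6] at h5 ⊢
    field_simp
    ring
  change 1 - (1 - z)⁻¹ ∈ slitPlane
  rwa [h3]

lemma ofReal_mem_posCut {x : ℝ} (hx : x < 0) : (x : ℂ) ∈ posCut := by left; simpa using hx

lemma hasDerivAt_cpow_div {z : ℂ} (hz : z ∈ slitPlane) (a : ℂ) :
    HasDerivAt (fun z : ℂ => z ^ a) (a / z * z ^ a) z := by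
  refine (hasStrictDerivAt_cpow_const hz).hasDerivAt.congr_deriv ?_
  rw [cpow_sub _ _ (slitPlane_ne_zero hz), cpow_one]
  ring

lemma hasDerivAt_neg_cpow_div {z : ℂ} (hz : z ∈ posCut) (a : ℂ) :
    HasDerivAt (fun z : ℂ => (-z) ^ a) (a / z * (-z) ^ a) z := by
  refine ((hasDerivAt_cpow_div hz a).comp z (hasDerivAt_neg z)).congr_deriv ?_
  rw [div_neg]
  ring

/-- `Γ(1 + α) Γ(β) / (Γ(a') Γ(1 - b))` over `Γ(1 - α) Γ(β) / (Γ(a) Γ(c - b))`: the modulus of the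
vertex `φ(∞)`. -/
def infRadius (α β γ : ℝ) : ℝ :=
  (Real.Gamma (parC' α) * Real.Gamma (parA' α β γ - parB' α β γ) /
      (Real.Gamma (parA' α β γ) * Real.Gamma (parC' α - parB' α β γ))) /
    (Real.Gamma (parC α) * Real.Gamma (parA α β γ - parB α β γ) /
      (Real.Gamma (parA α β γ) * Real.Gamma (parC α - parB α β γ)))

lemma denF_ofReal (h : Hyperbolic α β γ) {x : ℝ} (hx : x < 1) :
    ∃ y : ℝ, 0 < y ∧ denF α β γ x = y := gaussF_ofReal h.parA_pos h.parA_lt hx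

lemma numF_ofReal (h : Hyperbolic α β γ) {x : ℝ} (hx : x < 1) :
    ∃ y : ℝ, 0 < y ∧ numF α β γ x = y := gaussF_ofReal h.parA'_pos h.parA'_lt hx

lemma denF_ne_zero (h : Hyperbolic α β γ) {z : ℂ} (hz : z ∈ cutPlane) : denF α β γ z ≠ 0 :=
  gaussF_ne_zero h.parA_pos h.parA_lt h.parB_pos h.parB_lt hz

lemma denF_zero (h : Hyperbolic α β γ) : denF α β γ 0 = 1 := gaussF_zero h.parA_pos h.parA_lt
lemma numF_zero (h : Hyperbolic α β γ) : numF α β γ 0 = 1 := gaussF_zero h.parA'_pos h.parA'_lt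

lemma continuousAt_denF (h : Hyperbolic α β γ) {z : ℂ} (hz : z ∈ cutPlane) :
    ContinuousAt (denF α β γ) z := (hasDerivAt_gaussF h.parA_pos h.parA_lt hz).continuousAt
lemma continuousAt_numF (h : Hyperbolic α β γ) {z : ℂ} (hz : z ∈ cutPlane) :
    ContinuousAt (numF α β γ) z := (hasDerivAt_gaussF h.parA'_pos h.parA'_lt hz).continuousAt

lemma tendsto_ofReal_zero : Tendsto (fun x : ℝ => (x : ℂ)) (𝓝[<] 0) (𝓝 0) := by
  have : Tendsto (fun x : ℝ => (x : ℂ)) (𝓝 0) (𝓝 ((0 : ℝ) : ℂ)) := continuous_ofReal.tendsto 0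
  rw [ofReal_zero] at this
  exact this.mono_left nhdsWithin_le_nhds

lemma tendsto_inv_one_sub_zero : Tendsto (fun x : ℝ => (1 - x)⁻¹) (𝓝[<] 0) (𝓝[<] 1) := by
  rw [tendsto_nhdsWithin_iff]
  constructor
  · have : ContinuousAt (fun x : ℝ => (1 - x)⁻¹) 0 := by
      apply ContinuousAt.inv₀ (by fun_prop); simp
    have := this.tendsto
    simp only [sub_zero, inv_one] at this
    exact this.mono_left nhdsWithin_le_nhds
  · filter_upwards [self_mem_nhdsWithin] with x hx
    have hx : x < 0 := hx
    have : 1 < 1 - x := by linarith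
    exact inv_lt_one_of_one_lt₀ this

lemma tendsto_inv_one_sub_atBot : Tendsto (fun x : ℝ => (1 - x)⁻¹) atBot (𝓝 0) := by
  apply tendsto_inv_atTop_zero.comp
  exact tendsto_atTop_add_const_left _ 1 tendsto_neg_atBot_atTop

lemma one_sub_cpow_ofReal {x : ℝ} (hx : x < 1) (b : ℝ) :
    (1 - (x : ℂ)) ^ (b : ℂ) = (((1 - x) ^ b : ℝ) : ℂ) := by
  rw [ofReal_cpow (by linarith)]
  push_cast
  rfl

/-- Both solutions at `∞` in terms of the solutions at `0`, up to a common factor. -/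
lemma exists_connection (h : Hyperbolic α β γ) :
    ∃ Q S : ℂ,
      1 = gaussValue (parA β γ α) (parB β γ α) (parC β) *
        ((Real.Gamma (parC α) * Real.Gamma (parA α β γ - parB α β γ) /
          (Real.Gamma (parA α β γ) * Real.Gamma (parC α - parB α β γ)) : ℝ) : ℂ) + Q *
        ((Real.Gamma (parC' α) * Real.Gamma (parA' α β γ - parB' α β γ) /
          (Real.Gamma (parA' α β γ) * Real.Gamma (parC' α - parB' α β γ)) : ℝ) : ℂ) ∧
      0 = gaussValue (parA' β γ α) (parB' β γ α) (parC' β) *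
        ((Real.Gamma (parC α) * Real.Gamma (parA α β γ - parB α β γ) /
          (Real.Gamma (parA α β γ) * Real.Gamma (parC α - parB α β γ)) : ℝ) : ℂ) + S *
        ((Real.Gamma (parC' α) * Real.Gamma (parA' α β γ - parB' α β γ) /
          (Real.Gamma (parA' α β γ) * Real.Gamma (parC' α - parB' α β γ)) : ℝ) : ℂ) ∧
      ∀ z ∈ posCut,
        (1 - z) ^ (-(parB α β γ : ℂ)) * denF β γ α (1 - z)⁻¹ =
          gaussValue (parA β γ α) (parB β γ α) (parC β) * denF α β γ z +
            Q * ((-z) ^ (α : ℂ) * numF α β γ z) ∧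
        (1 - z) ^ (-(parB α β γ : ℂ)) * (((1 - z)⁻¹) ^ (β : ℂ) * numF β γ α (1 - z)⁻¹) =
          gaussValue (parA' β γ α) (parB' β γ α) (parC' β) * denF α β γ z +
            S * ((-z) ^ (α : ℂ) * numF α β γ z) := by
  have hrot := h.rotate
  have h0 : (0 : ℂ) ∉ posCut := by simp [posCut]
  have h1 : (1 : ℂ) ∉ posCut := fun h => by
    have := posCut_subset h
    simp [cutPlane] at this
  have hf : HypSol α β γ posCut (denF α β γ) (denF' α β γ) :=
    fun z hz => hypSol_denF h z (posCut_subset hz)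
  have hg := hypSol_mul_numF h posCut_subset h0
    (fun z hz => hasDerivAt_neg_cpow_div hz (α : ℂ))
  have hy1 := hypSol_comp (α := α) (D := posCut)
    (D' := cutPlane) (hypSol_denF hrot) posCut_subset (fun z hz => (inv_one_sub_mem hz).2)
  have hy2 := hypSol_comp (α := α) (D := posCut) (D' := slitPlane ∩ cutPlane)
    (hypSol_mul_numF hrot Set.inter_subset_right (fun h => slitPlane_ne_zero h.1 rfl)
      (fun z hz => hasDerivAt_cpow_div hz.1 (β : ℂ))) posCut_subset
      (fun z hz => inv_one_sub_mem hz)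
  -- With `(-z) ^ α` in place of `z ^ α`, the Wronskian is `(-z) ^ α / z * α * (1 - z) ^ (γ - 1)`,
  -- which has no zeros.
  have hW : ∀ z ∈ posCut, denF α β γ z * (α / z * (-z) ^ (α : ℂ) * numF α β γ z +
      (-z) ^ (α : ℂ) * numF' α β γ z) - denF' α β γ z * ((-z) ^ (α : ℂ) * numF α β γ z) ≠ 0 := by
    intro z hz
    have hz0 : z ≠ 0 := fun h => h0 (h ▸ hz)
    have hw := wronskian_eq h (posCut_subset hz)
    have e : denF α β γ z * (α / z * (-z) ^ (α : ℂ) * numF α β γ z +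
      (-z) ^ (α : ℂ) * numF' α β γ z) - denF' α β γ z * ((-z) ^ (α : ℂ) * numF α β γ z) =
      (-z) ^ (α : ℂ) / z * (α * (1 - z) ^ ((γ : ℂ) - 1)) := by
      rw [← hw]
      field_simp
      ring
    rw [e]
    have hz1 : 1 - z ≠ 0 := slitPlane_ne_zero (posCut_subset hz)
    have : (α : ℂ) ≠ 0 := ofReal_ne_zero.mpr h.pos₁.ne'
    simp [cpow_eq_zero_iff, hz0, hz1, this]
  obtain ⟨P, Q, hPQ⟩ := hf.exists_linear_combination isOpen_posCut isPreconnected_posCut h0 h1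
    hg hy1 hW
  obtain ⟨R, S, hRS⟩ := hf.exists_linear_combination isOpen_posCut isPreconnected_posCut h0 h1
    hg hy2 hW
  have hbot : ∀ᶠ x : ℝ in 𝓝[<] 0, x < 0 := self_mem_nhdsWithin
  -- limits at `0`
  have l1 : Tendsto (fun x : ℝ => denF α β γ x) (𝓝[<] 0) (𝓝 1) := by
    rw [← denF_zero h]
    exact (continuousAt_denF h zero_mem_cutPlane).tendsto.comp tendsto_ofReal_zero
  have l2 : Tendsto (fun x : ℝ => (-(x : ℂ)) ^ (α : ℂ) * numF α β γ x) (𝓝[<] 0) (𝓝 0) := by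
    have e1 : Tendsto (fun x : ℝ => numF α β γ x) (𝓝[<] 0) (𝓝 1) := by
      rw [← numF_zero h]
      exact (continuousAt_numF h zero_mem_cutPlane).tendsto.comp tendsto_ofReal_zero
    have e2 : Tendsto (fun x : ℝ => (-(x : ℂ)) ^ (α : ℂ)) (𝓝[<] 0) (𝓝 0) := by
      have := (continuous_ofReal_cpow_const (y := (α : ℂ)) (by simpa using h.pos₁)).comp
        continuous_neg
      have := this.tendsto 0
      have hα : (α : ℂ) ≠ 0 := ofReal_ne_zero.mpr h.pos₁.ne'
      simp only [Function.comp_apply, neg_zero, ofReal_zero, zero_cpow hα] at this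
      refine (this.mono_left nhdsWithin_le_nhds).congr fun x => ?_
      simp
    simpa using e2.mul e1
  have l3 : Tendsto (fun x : ℝ => (1 - (x : ℂ)) ^ (-(parB α β γ : ℂ))) (𝓝[<] 0) (𝓝 1) := by
    have : ContinuousAt (fun z : ℂ => (1 - z) ^ (-(parB α β γ : ℂ))) 0 :=
      ContinuousAt.cpow (by fun_prop) continuousAt_const (by simp)
    have := this.tendsto.comp tendsto_ofReal_zero
    simpa [Function.comp_def] using this
  have l4 : Tendsto (fun x : ℝ => denF β γ α (1 - (x : ℂ))⁻¹) (𝓝[<] 0)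
      (𝓝 (gaussValue (parA β γ α) (parB β γ α) (parC β))) := by
    have := (tendsto_gaussF_one hrot.parA_pos hrot.parB_pos (c := parC β) (by
      have := hrot.pos₃
      simp only [parA, parB, parC]; linarith)).comp tendsto_inv_one_sub_zero
    refine this.congr fun x => ?_
    simp [denF]
  have l5 : Tendsto (fun x : ℝ => ((1 - (x : ℂ))⁻¹) ^ (β : ℂ) * numF β γ α (1 - (x : ℂ))⁻¹) (𝓝[<] 0)
      (𝓝 (gaussValue (parA' β γ α) (parB' β γ α) (parC' β))) := by
    have e1 := (tendsto_gaussF_one hrot.parA'_pos hrot.parB'_pos (c := parC' β) (by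
      have := hrot.pos₃
      simp only [parA', parB', parC', parA, parB, parC]; linarith)).comp tendsto_inv_one_sub_zero
    have e2 : Tendsto (fun x : ℝ => ((1 - (x : ℂ))⁻¹) ^ (β : ℂ)) (𝓝[<] 0) (𝓝 1) := by
      have : ContinuousAt (fun z : ℂ => ((1 - z)⁻¹) ^ (β : ℂ)) 0 :=
        ContinuousAt.cpow (ContinuousAt.inv₀ (by fun_prop) (by simp)) continuousAt_const (by simp)
      have := this.tendsto.comp tendsto_ofReal_zero
      simpa [Function.comp_def] using this
    have := e2.mul e1
    rw [one_mul] at this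
    refine this.congr fun x => ?_
    simp [numF]
  -- As `x → 0⁻` the second basis solution vanishes and `denF` tends to `1`, while `(1 - x)⁻¹ → 1⁻`.
  -- So the coefficient of `denF` is Gauss' value for the rotated parameters.
  have hP : P = gaussValue (parA β γ α) (parB β γ α) (parC β) := by
    have t1 := (l1.const_mul P).add (l2.const_mul Q)
    have t2 := l3.mul l4
    refine tendsto_nhds_unique (f := fun x : ℝ => P * denF α β γ x +
      Q * ((-(x : ℂ)) ^ (α : ℂ) * numF α β γ x)) (by simpa using t1) ?_
    rw [one_mul] at t2
    refine t2.congr' ?_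
    filter_upwards [hbot] with x hx using hPQ x (ofReal_mem_posCut hx)
  have hR : R = gaussValue (parA' β γ α) (parB' β γ α) (parC' β) := by
    have t1 := (l1.const_mul R).add (l2.const_mul S)
    have t2 := l3.mul l5
    refine tendsto_nhds_unique (f := fun x : ℝ => R * denF α β γ x +
      S * ((-(x : ℂ)) ^ (α : ℂ) * numF α β γ x)) (by simpa using t1) ?_
    rw [one_mul] at t2
    refine t2.congr' ?_
    filter_upwards [hbot] with x hx using hRS x (ofReal_mem_posCut hx)
  -- limits at `∞`
  have m1 := tendsto_gaussF_atBot (c := parC α) h.parB_pos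
    (by have := h.pos₂; simp only [parA, parB]; linarith) h.parA_lt
  have m2' := tendsto_gaussF_atBot (c := parC' α) h.parB'_pos
    (by have := h.pos₂; simp only [parA', parB', parA, parB]; linarith) h.parA'_lt
  have m2 : Tendsto (fun x : ℝ => (((1 - x) ^ parB α β γ : ℝ) : ℂ) *
      ((-(x : ℂ)) ^ (α : ℂ) * numF α β γ x)) atBot
      (𝓝 ((Real.Gamma (parC' α) * Real.Gamma (parA' α β γ - parB' α β γ) /
          (Real.Gamma (parA' α β γ) * Real.Gamma (parC' α - parB' α β γ)) : ℝ) : ℂ)) := by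
    -- Since `b' = b + α`, one has `(1 - x) ^ b * (-x) ^ α = (x / (x - 1)) ^ α * (1 - x) ^ b'`, and
    -- the first factor tends to `1`.
    have e1 : Tendsto (fun x : ℝ => (((x / (x - 1)) ^ α : ℝ) : ℂ)) atBot (𝓝 1) := by
      have e0 := (tendsto_div_sub_one_atBot.mono_right nhdsWithin_le_nhds).rpow_const
        (p := α) (Or.inl one_ne_zero)
      rw [Real.one_rpow] at e0
      have := (continuous_ofReal.tendsto 1).comp e0
      rw [ofReal_one] at this
      exact this
    have := e1.mul m2'
    rw [one_mul] at this
    refine this.congr' ?_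
    filter_upwards [eventually_lt_atBot 0] with x hx
    rw [← mul_assoc, ← mul_assoc]
    congr 1
    rw [← ofReal_neg, ← ofReal_cpow (by linarith), ← ofReal_mul, ← ofReal_mul]
    congr 1
    rw [show parB' α β γ = parB α β γ + α by simp only [parB', parB, parC]; ring,
      Real.rpow_add (by linarith), show x / (x - 1) = (-x) / (1 - x) by
        rw [← neg_div_neg_eq, neg_sub], Real.div_rpow (by linarith) (by linarith)]
    have : (1 - x) ^ α ≠ 0 := (Real.rpow_pos_of_pos (by linarith) _).ne'
    field_simp
  have m0 : Tendsto (fun x : ℝ => (1 - (x : ℂ))⁻¹) atBot (𝓝 0) := by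
    have := (continuous_ofReal.tendsto 0).comp tendsto_inv_one_sub_atBot
    rw [ofReal_zero] at this
    refine this.congr fun x => ?_
    simp
  have m3 : Tendsto (fun x : ℝ => denF β γ α (1 - (x : ℂ))⁻¹) atBot (𝓝 1) := by
    have := (continuousAt_denF hrot zero_mem_cutPlane).tendsto.comp m0
    rwa [denF_zero hrot] at this
  have m4 : Tendsto (fun x : ℝ => ((1 - (x : ℂ))⁻¹) ^ (β : ℂ) * numF β γ α (1 - (x : ℂ))⁻¹) atBot
      (𝓝 0) := by
    have e1 : Tendsto (fun x : ℝ => numF β γ α (1 - (x : ℂ))⁻¹) atBot (𝓝 1) := by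
      have := (continuousAt_numF hrot zero_mem_cutPlane).tendsto.comp m0
      rwa [numF_zero hrot] at this
    have e2 : Tendsto (fun x : ℝ => ((1 - (x : ℂ))⁻¹) ^ (β : ℂ)) atBot (𝓝 0) := by
      have := ((continuous_ofReal_cpow_const (y := (β : ℂ)) (by simpa using h.pos₂)).tendsto 0).comp
        tendsto_inv_one_sub_atBot
      have hβ : (β : ℂ) ≠ 0 := ofReal_ne_zero.mpr h.pos₂.ne'
      rw [ofReal_zero, zero_cpow hβ] at this
      refine this.congr fun x => ?_
      simp
    simpa using e2.mul e1
  -- After multiplication by `(1 - x) ^ b` the two solutions at `∞` tend to `1` and `0` as `x → -∞`.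
  -- Comparison with the combinations of the solutions at `0` yields the linear equations for `Q`
  -- and `S`.
  have hcancel : ∀ x : ℝ, x < 0 → (((1 - x) ^ parB α β γ : ℝ) : ℂ) *
      (1 - (x : ℂ)) ^ (-(parB α β γ : ℂ)) = 1 := by
    intro x hx
    rw [← ofReal_neg, one_sub_cpow_ofReal (by linarith), ← ofReal_mul,
      ← Real.rpow_add (by linarith), add_neg_cancel, Real.rpow_zero, ofReal_one]
  refine ⟨Q, S, ?_, ?_, fun z hz => ⟨hP ▸ hPQ z hz, hR ▸ hRS z hz⟩⟩
  · rw [← hP]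
    refine tendsto_nhds_unique m3 (((m1.const_mul P).add (m2.const_mul Q)).congr' ?_)
    filter_upwards [eventually_lt_atBot 0] with x hx
    have e := hPQ x (ofReal_mem_posCut hx)
    simp only [denF] at e ⊢
    linear_combination (-(((1 - x) ^ parB α β γ : ℝ) : ℂ)) * e +
      gaussF (parA β γ α) (parB β γ α) (parC β) (1 - (x : ℂ))⁻¹ * hcancel x hx
  · rw [← hR]
    refine tendsto_nhds_unique m4 (((m1.const_mul R).add (m2.const_mul S)).congr' ?_)
    filter_upwards [eventually_lt_atBot 0] with x hx
    have e := hRS x (ofReal_mem_posCut hx)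
    simp only [denF] at e ⊢
    linear_combination (-(((1 - x) ^ parB α β γ : ℝ) : ℂ)) * e +
      (((1 - (x : ℂ))⁻¹) ^ (β : ℂ) * numF β γ α (1 - (x : ℂ))⁻¹) * hcancel x hx

/-! ### The normalising constant -/

lemma sin_pi_mul_eq (x : ℝ) :
    Real.sin (Real.pi * x) = Real.pi / (Real.Gamma x * Real.Gamma (1 - x)) := by
  rw [Real.Gamma_mul_Gamma_one_sub, div_div_cancel₀ Real.pi_pos.ne']

/-- Rotation of the angles permutes `a`, `b`, `a'`, `b'` up to `x ↦ 1 - x`. Hence the constants `ν`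
at neighbouring vertices involve the same Gamma values. -/
lemma parA_rotate : parA β γ α = 1 - parA' α β γ := by simp only [parA, parA', parC]; ring
lemma parB_rotate : parB β γ α = parB α β γ := by simp only [parB]; ring
lemma parA'_rotate : parA' β γ α = 1 - parB' α β γ := by
  simp only [parA, parA', parB', parB, parC]; ring
lemma parB'_rotate : parB' β γ α = parA α β γ := by simp only [parA, parB', parB, parC]; ring

/-- Sum-to-product formulas factor the first quotient, and half-angle formulas make the second one a
quotient of squares of sines. -/
lemma nu_trig (α β γ : ℝ) (h : Real.sin (Real.pi * parB α β γ) ≠ 0)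
    (h' : Real.sin (Real.pi * parB' α β γ) ≠ 0) :
    (Real.cos (Real.pi * α + Real.pi * β) + Real.cos (Real.pi * γ)) /
        (Real.cos (Real.pi * α - Real.pi * β) + Real.cos (Real.pi * γ)) *
      ((Real.cos (Real.pi * α - Real.pi * β - Real.pi * γ) + 1) /
        (Real.cos (Real.pi * α + Real.pi * β + Real.pi * γ) + 1)) =
    Real.sin (Real.pi * parA' α β γ) * Real.sin (Real.pi * parB' α β γ) /
      (Real.sin (Real.pi * parA α β γ) * Real.sin (Real.pi * parB α β γ)) := by
  have e1 : Real.cos (Real.pi * α + Real.pi * β) + Real.cos (Real.pi * γ) =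
      2 * Real.sin (Real.pi * parB α β γ) * Real.sin (Real.pi * parA' α β γ) := by
    rw [Real.cos_add_cos, ← Real.cos_pi_div_two_sub, ← Real.cos_sub_pi_div_two]
    congr 2 <;> [congr 1; skip] <;> simp only [parB, parA', parA, parC] <;> ring_nf
  have e2 : Real.cos (Real.pi * α - Real.pi * β) + Real.cos (Real.pi * γ) =
      2 * Real.sin (Real.pi * parA α β γ) * Real.sin (Real.pi * parB' α β γ) := by
    rw [Real.cos_add_cos, ← Real.cos_pi_div_two_sub, ← Real.cos_sub_pi_div_two]
    congr 2 <;> [congr 1; skip] <;> simp only [parB, parB', parA, parC] <;> ring_nf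
  have e3 : Real.cos (Real.pi * α - Real.pi * β - Real.pi * γ) + 1 =
      2 * Real.sin (Real.pi * parB' α β γ) ^ 2 := by
    rw [← Real.cos_sub_pi_div_two, Real.cos_sq]
    simp only [parB', parB, parC]
    ring_nf
  have e4 : Real.cos (Real.pi * α + Real.pi * β + Real.pi * γ) + 1 =
      2 * Real.sin (Real.pi * parB α β γ) ^ 2 := by
    rw [← Real.cos_pi_div_two_sub, Real.cos_sq]
    simp only [parB]
    ring_nf
  rw [e1, e2, e3, e4]
  field_simp

lemma Gamma_one_sub_pos {x : ℝ} (h : x < 1) : 0 < Real.Gamma (1 - x) :=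
  Real.Gamma_pos_of_pos (by linarith)

lemma Hyperbolic.parA_lt_one (h : Hyperbolic α β γ) : parA α β γ < 1 := by
  obtain ⟨h1, h2, h3, h4⟩ := h; simp only [parA]; linarith
lemma Hyperbolic.parA'_lt_one (h : Hyperbolic α β γ) : parA' α β γ < 1 := by
  obtain ⟨h1, h2, h3, h4⟩ := h; simp only [parA', parA, parC]; linarith
lemma Hyperbolic.parB'_lt_one (h : Hyperbolic α β γ) : parB' α β γ < 1 := by
  obtain ⟨h1, h2, h3, h4⟩ := h; simp only [parB', parB, parC]; linarith

lemma sin_pi_mul_pos {x : ℝ} (h0 : 0 < x) (h1 : x < 1) : 0 < Real.sin (Real.pi * x) :=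
  Real.sin_pos_of_pos_of_lt_pi (by have := Real.pi_pos; positivity)
    (by have := Real.pi_pos; nlinarith)

/-- The reflection formula converts the sines under the root into Gamma values, so that `ν ^ 2` is a
product of Gamma values alone. -/
lemma nu_spec (h : Hyperbolic α β γ) :
    0 < nu α β γ ∧ nu α β γ ^ 2 = (Real.Gamma (1 - α) / Real.Gamma (1 + α)) ^ 2 *
      (Real.Gamma (parA' α β γ) * Real.Gamma (parB' α β γ) *
        Real.Gamma (1 - parA α β γ) * Real.Gamma (1 - parB α β γ)) /
      (Real.Gamma (parA α β γ) * Real.Gamma (parB α β γ) *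
        Real.Gamma (1 - parA' α β γ) * Real.Gamma (1 - parB' α β γ)) := by
  have hB1 : parB α β γ < 1 := by linarith [h.parB_lt]
  have s1 := sin_pi_mul_pos h.parB_pos hB1
  have s2 := sin_pi_mul_pos h.parB'_pos h.parB'_lt_one
  have s3 := sin_pi_mul_pos h.parA_pos h.parA_lt_one
  have s4 := sin_pi_mul_pos h.parA'_pos h.parA'_lt_one
  have g1 := Real.Gamma_pos_of_pos h.parA_pos
  have g2 := Real.Gamma_pos_of_pos h.parB_pos
  have g3 := Real.Gamma_pos_of_pos h.parA'_pos
  have g4 := Real.Gamma_pos_of_pos h.parB'_pos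
  have g5 := Gamma_one_sub_pos h.parA_lt_one
  have g6 := Gamma_one_sub_pos hB1
  have g7 := Gamma_one_sub_pos h.parA'_lt_one
  have g8 := Gamma_one_sub_pos h.parB'_lt_one
  have g9 : 0 < Real.Gamma (1 - α) := Gamma_one_sub_pos (by linarith [h.pos₂, h.pos₃, h.sum_lt])
  have g10 : 0 < Real.Gamma (1 + α) := Real.Gamma_pos_of_pos (by linarith [h.pos₁])
  have hc : parC α = 1 - α := rfl
  have hc' : parC' α = 1 + α := by simp only [parC', parC]; ring
  rw [nu, nu_trig α β γ s1.ne' s2.ne', hc, hc']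
  constructor
  · positivity
  · rw [mul_pow, mul_pow, Real.sq_sqrt (by positivity), sin_pi_mul_eq, sin_pi_mul_eq,
      sin_pi_mul_eq, sin_pi_mul_eq]
    have := Real.pi_pos.ne'
    field_simp

/-- The coefficient of the dominant term of `denF` at `∞`. -/
def infCoeff (α β γ : ℝ) : ℝ := Real.Gamma (parC α) * Real.Gamma (parA α β γ - parB α β γ) /
          (Real.Gamma (parA α β γ) * Real.Gamma (parC α - parB α β γ))

/-- The coefficient of the dominant term of `numF` at `∞`. -/
def infCoeff' (α β γ : ℝ) : ℝ := Real.Gamma (parC' α) * Real.Gamma (parA' α β γ - parB' α β γ) /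
          (Real.Gamma (parA' α β γ) * Real.Gamma (parC' α - parB' α β γ))

/-- The two equations say that the Möbius map relating neighbouring triangle functions is an
isometry of the discs. By the reflection formula the first becomes `sin πb' sin πa - sin πα sin πβ =
sin πb sin πa'`, an instance of the addition theorem. The second is an equality of positive numbers
whose squares are the same product of Gamma values. -/
lemma connection_constants (h : Hyperbolic α β γ) :
    0 < infCoeff α β γ ∧ 0 < infCoeff' α β γ ∧
    0 < gaussValue (parA β γ α) (parB β γ α) (parC β) ∧
    gaussValue (parA β γ α) (parB β γ α) (parC β) * infCoeff α β γ - 1 =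
      nu α β γ ^ 2 * infRadius α β γ ^ 2 *
        (gaussValue (parA β γ α) (parB β γ α) (parC β) * infCoeff α β γ) ∧
    gaussValue (parA' β γ α) (parB' β γ α) (parC' β) * nu β γ α =
      nu α β γ * (gaussValue (parA β γ α) (parB β γ α) (parC β) * infRadius α β γ) := by
  have hB1 : parB α β γ < 1 := by linarith [h.parB_lt]
  have g1 := Real.Gamma_pos_of_pos h.parA_pos
  have g2 := Real.Gamma_pos_of_pos h.parB_pos
  have g3 := Real.Gamma_pos_of_pos h.parA'_pos
  have g4 := Real.Gamma_pos_of_pos h.parB'_pos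
  have g5 := Gamma_one_sub_pos h.parA_lt_one
  have g6 := Gamma_one_sub_pos hB1
  have g7 := Gamma_one_sub_pos h.parA'_lt_one
  have g8 := Gamma_one_sub_pos h.parB'_lt_one
  obtain ⟨p1, p2, p3, p4⟩ := h
  have h : Hyperbolic α β γ := ⟨p1, p2, p3, p4⟩
  have g9 : 0 < Real.Gamma (1 - α) := Gamma_one_sub_pos (by linarith)
  have g10 : 0 < Real.Gamma (1 + α) := Real.Gamma_pos_of_pos (by linarith)
  have g11 : 0 < Real.Gamma (1 - β) := Gamma_one_sub_pos (by linarith)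
  have g12 : 0 < Real.Gamma (1 + β) := Real.Gamma_pos_of_pos (by linarith)
  have g13 := Real.Gamma_pos_of_pos p1
  have g14 := Real.Gamma_pos_of_pos p2
  have hp : infCoeff α β γ = Real.Gamma (1 - α) * Real.Gamma β /
      (Real.Gamma (parA α β γ) * Real.Gamma (1 - parB' α β γ)) := by
    rw [infCoeff, show parA α β γ - parB α β γ = β by simp only [parA, parB]; ring,
      show parC α - parB α β γ = 1 - parB' α β γ by simp only [parB']; ring]
    rfl
  have hr : infCoeff' α β γ = Real.Gamma (1 + α) * Real.Gamma β /
      (Real.Gamma (parA' α β γ) * Real.Gamma (1 - parB α β γ)) := by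
    rw [infCoeff', show parA' α β γ - parB' α β γ = β by
        simp only [parA', parB', parA, parB]; ring,
      show parC' α - parB' α β γ = 1 - parB α β γ by simp only [parB', parC']; ring,
      show parC' α = 1 + α by simp only [parC', parC]; ring]
  have hP : gaussValue (parA β γ α) (parB β γ α) (parC β) = Real.Gamma (1 - β) * Real.Gamma α /
      (Real.Gamma (parB' α β γ) * Real.Gamma (1 - parA α β γ)) := by
    rw [gaussValue, show parC β - parA β γ α - parB β γ α = α by
        simp only [parA, parB, parC]; ring,
      show parC β - parA β γ α = parB' α β γ by simp only [parB', parA, parB, parC]; ring,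
      show parC β - parB β γ α = 1 - parA α β γ by simp only [parA, parB, parC]; ring]
    rfl
  have hR : gaussValue (parA' β γ α) (parB' β γ α) (parC' β) = Real.Gamma (1 + β) * Real.Gamma α /
      (Real.Gamma (parA' α β γ) * Real.Gamma (1 - parB α β γ)) := by
    rw [gaussValue, show parC' β - parA' β γ α - parB' β γ α = α by
        simp only [parA', parB', parC', parA, parB, parC]; ring,
      show parC' β - parA' β γ α = parA' α β γ by
        simp only [parA', parC', parA, parC]; ring,
      show parC' β - parB' β γ α = 1 - parB α β γ by simp only [parB', parB, parC', parC]; ring,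
      show parC' β = 1 + β by simp only [parC', parC]; ring]
  have hb0 : infRadius α β γ = infCoeff' α β γ / infCoeff α β γ := rfl
  obtain ⟨n1, n2⟩ := nu_spec h
  obtain ⟨n1', n2'⟩ := nu_spec h.rotate
  rw [parA_rotate (α := α) (β := β) (γ := γ), parB_rotate (α := α) (β := β) (γ := γ),
    parA'_rotate (α := α) (β := β) (γ := γ), parB'_rotate (α := α) (β := β) (γ := γ),
    sub_sub_cancel, sub_sub_cancel] at n2'
  have hp0 : 0 < infCoeff α β γ := by rw [hp]; positivity
  have hr0 : 0 < infCoeff' α β γ := by rw [hr]; positivity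
  have hP0 : 0 < gaussValue (parA β γ α) (parB β γ α) (parC β) := by rw [hP]; positivity
  have hR0 : 0 < gaussValue (parA' β γ α) (parB' β γ α) (parC' β) := by rw [hR]; positivity
  refine ⟨hp0, hr0, hP0, ?_, ?_⟩
  · have s1 := sin_pi_mul_pos p1 (by linarith)
    have s2 := sin_pi_mul_pos p2 (by linarith)
    have e1 : gaussValue (parA β γ α) (parB β γ α) (parC β) * infCoeff α β γ =
        Real.sin (Real.pi * parB' α β γ) * Real.sin (Real.pi * parA α β γ) /
          (Real.sin (Real.pi * α) * Real.sin (Real.pi * β)) := by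
      rw [hP, hp, sin_pi_mul_eq, sin_pi_mul_eq, sin_pi_mul_eq, sin_pi_mul_eq]
      have := Real.pi_pos.ne'
      field_simp
    have e2 : nu α β γ ^ 2 * infRadius α β γ ^ 2 *
        (gaussValue (parA β γ α) (parB β γ α) (parC β) * infCoeff α β γ) =
        Real.sin (Real.pi * parB α β γ) * Real.sin (Real.pi * parA' α β γ) /
          (Real.sin (Real.pi * α) * Real.sin (Real.pi * β)) := by
      rw [n2, hb0, hP, hp, hr, sin_pi_mul_eq, sin_pi_mul_eq, sin_pi_mul_eq, sin_pi_mul_eq]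
      have := Real.pi_pos.ne'
      field_simp
    rw [e2, e1, eq_div_iff (by positivity), sub_mul, div_mul_cancel₀ _ (by positivity)]
    have t1 : Real.pi * parB' α β γ = Real.pi * parB α β γ + Real.pi * α := by
      simp only [parB', parB, parC]; ring
    have t2 : Real.pi * parA' α β γ = Real.pi * parA α β γ + Real.pi * α := by
      simp only [parA', parA, parC]; ring
    have t3 : Real.pi * β = Real.pi * parA α β γ - Real.pi * parB α β γ := by
      simp only [parA, parB]; ring
    rw [t1, t2, t3, Real.sin_add, Real.sin_add, Real.sin_sub]
    ring
  · have hb0pos : 0 < infRadius α β γ := by rw [hb0]; positivity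
    refine (pow_left_inj₀ (by positivity) (by positivity) two_ne_zero).mp ?_
    rw [mul_pow, mul_pow, mul_pow, n2, n2', hb0, hP, hR, hp, hr]
    field_simp

lemma infRadius_pos (h : Hyperbolic α β γ) : 0 < infRadius α β γ := by
  obtain ⟨h1, h2, -⟩ := connection_constants h
  exact div_pos h2 h1

lemma nu_pos (h : Hyperbolic α β γ) : 0 < nu α β γ := (nu_spec h).1

/-- The first equation of `connection_constants` makes `1 - (ν * infRadius) ^ 2` the inverse of a
positive number. This places `φ(∞)` inside the disc. -/
lemma nu_mul_infRadius_lt_one (h : Hyperbolic α β γ) : nu α β γ * infRadius α β γ < 1 := by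
  obtain ⟨h1, h2, h3, h4, -⟩ := connection_constants h
  have h5 : 0 < gaussValue (parA β γ α) (parB β γ α) (parC β) * infCoeff α β γ := mul_pos h3 h1
  have h6 : (nu α β γ * infRadius α β γ) ^ 2 < 1 := by
    rw [mul_pow]
    by_contra hcon
    nlinarith
  exact lt_of_pow_lt_pow_left₀ 2 zero_le_one (by simpa using h6)

/-- The vertex `φ(∞)`. -/
def vertB (α β γ : ℝ) : ℂ := infRadius α β γ * exp (I * (Real.pi * α : ℝ))

/-- The coordinate about `vertB`. -/
def stepS (α β γ : ℝ) : ℂ → ℂ :=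
  coordS (nu α β γ) (nu β γ α) (Real.pi - Real.pi * α) (vertB α β γ)

lemma shiftB_eq (z : ℂ) : shiftB z = (1 - z)⁻¹ := by
  rw [shiftB, neg_div, ← div_neg, neg_sub, one_div]

/-- The turn by `π - π α` undoes the argument of `vertB` up to the sign `-1`; in the rotated
variable the coordinate is a Möbius map with real coefficients. -/
lemma stepS_rotated (α β γ : ℝ) (x : ℂ) :
    stepS α β γ (exp (I * (Real.pi * α : ℝ)) * x) =
      ((nu α β γ / nu β γ α : ℝ) : ℂ) * ((infRadius α β γ - x) /
        (1 - (nu α β γ : ℂ) ^ 2 * infRadius α β γ * x)) := by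
  have e1 : conj (exp (I * (Real.pi * α : ℝ))) * exp (I * (Real.pi * α : ℝ)) = 1 := by
    rw [← exp_conj, ← exp_add]
    simp
  have e2 : exp (I * ((Real.pi - Real.pi * α : ℝ) : ℂ)) * exp (I * (Real.pi * α : ℝ)) = -1 := by
    rw [← exp_add, ← exp_pi_mul_I]
    congr 1
    push_cast
    ring
  rw [stepS, coordS, discMove, vertB]
  congr 1
  simp only [map_mul, conj_ofReal]
  rw [show (nu α β γ : ℂ) ^ 2 * (infRadius α β γ * conj (exp (I * (Real.pi * α : ℝ)))) *
    (exp (I * (Real.pi * α : ℝ)) * x) = (nu α β γ : ℂ) ^ 2 * infRadius α β γ * x by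
      linear_combination ((nu α β γ : ℂ) ^ 2 * infRadius α β γ * x) * e1]
  rw [← mul_div_assoc]
  congr 1
  linear_combination (x - infRadius α β γ) * e2

/-- In the upper half plane `log z = log (-z) + π i`. The resulting change of branch is the rotation
by `π α` which produces the angle at `0`. -/
lemma arg_neg_cpow {z : ℂ} (hz : 0 < z.im) (a : ℝ) :
    z ^ (a : ℂ) = exp (I * (Real.pi * a : ℝ)) * (-z) ^ (a : ℂ) := by
  have h0 : z ≠ 0 := fun h => by simp [h] at hz
  rw [cpow_def_of_ne_zero h0, cpow_def_of_ne_zero (neg_ne_zero.mpr h0), ← exp_add]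
  congr 1
  have : log z = log (-z) + Real.pi * I := by
    rw [log, log, norm_neg, arg_neg_eq_arg_sub_pi_of_im_pos hz]
    push_cast
    ring
  rw [this]
  push_cast
  ring

lemma upperHalf_subset_posCut : upperHalf ⊆ posCut := by
  intro z hz
  right
  simpa using (ne_of_gt hz : z.im ≠ 0)

/-- The Schwarz triangle functions of cyclically permuted angles are related by a change of
coordinates of the disc. -/
theorem phi_shiftB_and_ne (h : Hyperbolic α β γ) {z : ℂ} (hz : z ∈ upperHalf) :
    phi β γ α (shiftB z) = stepS α β γ (phi α β γ z) ∧ ∃ x : ℂ,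
      phi α β γ z = exp (I * (Real.pi * α : ℝ)) * x ∧
      1 - (nu α β γ : ℂ) ^ 2 * infRadius α β γ * x ≠ 0 := by
  obtain ⟨Q, S, hQ, hS, hall⟩ := exists_connection h
  obtain ⟨c1, c2, c3, c4, c5⟩ := connection_constants h
  obtain ⟨e1, e2⟩ := hall z (upperHalf_subset_posCut hz)
  have hb0 : infRadius α β γ = infCoeff' α β γ / infCoeff α β γ := rfl
  have hzp := upperHalf_subset_posCut hz
  have hcut := posCut_subset hzp
  have hden := denF_ne_zero h hcut
  have hden' := denF_ne_zero h.rotate (inv_one_sub_mem hzp).2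
  have hone : 1 - z ≠ 0 := slitPlane_ne_zero hcut
  rw [← infCoeff, ← infCoeff'] at hQ hS
  set P := gaussValue (parA β γ α) (parB β γ α) (parC β)
  set R := gaussValue (parA' β γ α) (parB' β γ α) (parC' β)
  set p := infCoeff α β γ
  set r := infCoeff' α β γ
  set b0 := infRadius α β γ
  have hp0 : (p : ℂ) ≠ 0 := ofReal_ne_zero.mpr c1.ne'
  have hr0 : (r : ℂ) ≠ 0 := ofReal_ne_zero.mpr c2.ne'
  have hP0 : (P : ℂ) ≠ 0 := ofReal_ne_zero.mpr c3.ne'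
  have hrb : (r : ℂ) = b0 * p := by
    rw [hb0]; push_cast; field_simp
  have hb0' : (b0 : ℂ) ≠ 0 := ofReal_ne_zero.mpr (infRadius_pos h).ne'
  -- Both solutions for `Q` and `S` are brought to the form demanded by the disc automorphism
  -- centred at `infRadius`.
  have hQ' : Q = -((nu α β γ : ℂ) ^ 2 * b0 * P) := by
    have c4' : (P : ℂ) * p - 1 = (nu α β γ : ℂ) ^ 2 * (b0 : ℂ) ^ 2 * (P * p) := by exact_mod_cast c4
    apply mul_right_cancel₀ hr0
    rw [hrb] at hQ ⊢
    linear_combination (-c4') - hQ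
  have hS' : S * b0 = -R := by
    apply mul_right_cancel₀ hp0
    rw [hrb] at hS
    linear_combination -hS
  have hnB : (nu β γ α : ℂ) ≠ 0 := ofReal_ne_zero.mpr (nu_pos h.rotate).ne'
  have hRP : (R : ℂ) = nu α β γ / nu β γ α * (P * b0) := by
    have c5' : (R : ℂ) * nu β γ α = nu α β γ * (P * b0) := by exact_mod_cast c5
    field_simp
    linear_combination c5'
  have hS'' : S = -(nu α β γ / nu β γ α * P) := by
    apply mul_right_cancel₀ hb0'
    rw [hS', hRP]
    ring
  have hk : (1 - z) ^ (-(parB α β γ : ℂ)) ≠ 0 := by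
    simp [cpow_eq_zero_iff, hone]
  have hphi : phi α β γ z = exp (I * (Real.pi * α : ℝ)) *
      ((-z) ^ (α : ℂ) * numF α β γ z / denF α β γ z) := by
    rw [phi_eq, arg_neg_cpow hz α]
    ring
  set g := (-z) ^ (α : ℂ) * numF α β γ z
  set f := denF α β γ z
  rw [hQ'] at e1
  -- The denominator of the Möbius map is the rotated `denF` up to a power of `1 - z`, hence
  -- nonzero. This does not presuppose that `φ` takes values in the disc.
  have hD : (P : ℂ) * f + -((nu α β γ : ℂ) ^ 2 * b0 * P) * g ≠ 0 := by
    rw [← e1]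
    exact mul_ne_zero hk hden'
  have hD' : 1 - (nu α β γ : ℂ) ^ 2 * b0 * (g / f) ≠ 0 := by
    intro h0
    apply hD
    have : f - (nu α β γ : ℂ) ^ 2 * b0 * g = 0 := by
      have := congrArg (· * f) h0
      simp only [zero_mul] at this
      rw [← this]
      field_simp
    linear_combination P * this
  refine ⟨?_, g / f, hphi, hD'⟩
  rw [hphi, stepS_rotated, shiftB_eq, phi_eq, ← mul_div_mul_left _ _ hk, e1, e2, hS'', hRP]
  push_cast
  rw [← mul_div_assoc, div_eq_div_iff hD hD', show infRadius α β γ = b0 from rfl]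
  field_simp
  ring

theorem phi_shiftB (h : Hyperbolic α β γ) {z : ℂ} (hz : z ∈ upperHalf) :
    phi β γ α (shiftB z) = stepS α β γ (phi α β γ z) := (phi_shiftB_and_ne h hz).1

/-! ### Real disc automorphisms -/

/-- The map `x ↦ (ν / ν') (d - x) / (1 - ν² d x)` of the disc of radius `ν⁻¹` to the disc of
radius `ν'⁻¹`. -/
def mob (ν ν' d : ℝ) (x : ℂ) : ℂ := ((ν / ν' : ℝ) : ℂ) * ((d - x) / (1 - (ν : ℂ) ^ 2 * d * x))

/-- The point `exp (i π θ)` of the unit circle. -/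
def rot (θ : ℝ) : ℂ := exp (I * (Real.pi * θ : ℝ))

lemma rot_mul_conj (θ : ℝ) : rot θ * conj (rot θ) = 1 := by
  rw [rot, ← exp_conj, ← exp_add]
  simp

lemma conj_rot_mul (θ : ℝ) : conj (rot θ) * rot θ = 1 := by rw [mul_comm, rot_mul_conj]

lemma norm_rot (θ : ℝ) : ‖rot θ‖ = 1 := by rw [rot, mul_comm, norm_exp_ofReal_mul_I]

lemma rot_re (θ : ℝ) : (rot θ).re = Real.cos (Real.pi * θ) := by
  rw [rot, mul_comm, exp_ofReal_mul_I_re]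

lemma rot_im (θ : ℝ) : (rot θ).im = Real.sin (Real.pi * θ) := by
  rw [rot, mul_comm, exp_ofReal_mul_I_im]

lemma rot_ne_zero (θ : ℝ) : rot θ ≠ 0 := exp_ne_zero _

lemma stepS_eq (α β γ : ℝ) (w : ℂ) :
    stepS α β γ w = mob (nu α β γ) (nu β γ α) (infRadius α β γ) (conj (rot α) * w) := by
  rw [mob, ← stepS_rotated, ← rot, ← mul_assoc, rot_mul_conj, one_mul]

section mob

variable {ν ν' d : ℝ}

lemma mob_zero : mob ν ν' d 0 = ((ν / ν' * d : ℝ) : ℂ) := by simp [mob]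

lemma mob_self : mob ν ν' d d = 0 := by simp [mob]

lemma mob_conj (x : ℂ) : mob ν ν' d (conj x) = conj (mob ν ν' d x) := by simp [mob]

lemma mob_den_ne_zero (hν : 0 < ν) (hd : 0 ≤ d) (h : ν * d < 1) {x : ℂ} (hx : ‖x‖ < ν⁻¹) :
    1 - (ν : ℂ) ^ 2 * d * x ≠ 0 := by
  intro h0
  have h1 : (ν : ℂ) ^ 2 * d * x = 1 := by linear_combination -h0
  have h2 := congrArg norm h1
  rw [norm_mul, norm_mul, norm_pow, norm_real, norm_real, norm_one, Real.norm_of_nonneg hν.le,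
    Real.norm_of_nonneg hd] at h2
  have h3 : ν * ‖x‖ < 1 := by rwa [← lt_inv_mul_iff₀ hν, mul_one]
  have h4 : 0 ≤ ν * d := by positivity
  have h5 : 0 ≤ ν * ‖x‖ := by positivity
  nlinarith

/-- Up to the scaling of the discs, `x ↦ (d - x) / (1 - ν² d x)` is an involution. -/
lemma mob_mob (hν : 0 < ν) (hν' : 0 < ν') (hd : 0 ≤ d) (h : ν * d < 1) {x : ℂ}
    (hx : 1 - (ν : ℂ) ^ 2 * d * x ≠ 0) : mob ν' ν (ν / ν' * d) (mob ν ν' d x) = x := by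
  have h1 : (ν : ℂ) ≠ 0 := ofReal_ne_zero.mpr hν.ne'
  have h2 : (ν' : ℂ) ≠ 0 := ofReal_ne_zero.mpr hν'.ne'
  have h3 : 1 - (ν : ℂ) ^ 2 * d ^ 2 ≠ 0 := by
    have : 1 - ν ^ 2 * d ^ 2 ≠ 0 := by
      have : 0 ≤ ν * d := by positivity
      nlinarith
    exact_mod_cast this
  have e1 : (ν / ν' * d : ℂ) - ν / ν' * ((d - x) / (1 - ν ^ 2 * d * x)) =
      ν / ν' * x * (1 - ν ^ 2 * d ^ 2) / (1 - ν ^ 2 * d * x) := by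
    field_simp
    ring
  have e2 : 1 - (ν' : ℂ) ^ 2 * (ν / ν' * d) * (ν / ν' * ((d - x) / (1 - ν ^ 2 * d * x))) =
      (1 - ν ^ 2 * d ^ 2) / (1 - ν ^ 2 * d * x) := by
    field_simp
    ring
  simp only [mob]
  push_cast
  rw [e1, e2]
  field_simp
  rw [show 1 - (ν : ℂ) ^ 2 * x * d = 1 - (ν : ℂ) ^ 2 * d * x by ring, mul_div_cancel_right₀ _ hx]

/-- The imaginary part changes sign. -/
lemma mob_im (hν : 0 < ν) (hν' : 0 < ν') (hd : 0 ≤ d) (h : ν * d < 1) {x : ℂ}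
    (hx : 1 - (ν : ℂ) ^ 2 * d * x ≠ 0) : ∃ q : ℝ, 0 < q ∧ (mob ν ν' d x).im = -(q * x.im) := by
  have h3 : 0 < 1 - ν ^ 2 * d ^ 2 := by
    have : 0 ≤ ν * d := by positivity
    nlinarith
  have h4 : 0 < normSq (1 - (ν : ℂ) ^ 2 * d * x) := normSq_pos.mpr hx
  refine ⟨ν / ν' * ((1 - ν ^ 2 * d ^ 2) / normSq (1 - (ν : ℂ) ^ 2 * d * x)), by positivity, ?_⟩
  rw [mob, im_ofReal_mul, div_im]
  have e : (ν : ℂ) ^ 2 * d * x = ((ν ^ 2 * d : ℝ) : ℂ) * x := by push_cast; ring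
  rw [e] at h4 ⊢
  simp only [sub_im, sub_re, ofReal_im, ofReal_re, one_re, one_im, im_ofReal_mul, re_ofReal_mul]
  field_simp
  ring

/-- This rests on `|1 - ν² d x|² - ν² |d - x|² = (1 - ν² d²) (1 - ν² |x|²)`. -/
lemma norm_mob_lt (hν : 0 < ν) (hν' : 0 < ν') (hd : 0 ≤ d) (h : ν * d < 1) {x : ℂ}
    (hx : ‖x‖ < ν⁻¹) : ‖mob ν ν' d x‖ < ν'⁻¹ := by
  have hne := mob_den_ne_zero hν hd h hx
  have hpos : 0 < ‖1 - (ν : ℂ) ^ 2 * d * x‖ := norm_pos_iff.mpr hne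
  have h3 : 0 < 1 - (ν * d) ^ 2 := by
    have : 0 ≤ ν * d := by positivity
    nlinarith
  have h4 : 0 < 1 - (ν * ‖x‖) ^ 2 := by
    have : ν * ‖x‖ < 1 := by rwa [← lt_inv_mul_iff₀ hν, mul_one]
    have : 0 ≤ ν * ‖x‖ := by positivity
    nlinarith
  have key : ‖1 - (ν : ℂ) ^ 2 * d * x‖ ^ 2 - (ν * ‖(d : ℂ) - x‖) ^ 2 =
      (1 - (ν * d) ^ 2) * (1 - (ν * ‖x‖) ^ 2) := by
    have e : (ν : ℂ) ^ 2 * d * x = ((ν ^ 2 * d : ℝ) : ℂ) * x := by push_cast; ring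
    rw [mul_pow, mul_pow ν ‖x‖, e, ← normSq_eq_norm_sq, ← normSq_eq_norm_sq, ← normSq_eq_norm_sq]
    simp only [normSq_apply, sub_im, sub_re, ofReal_im, ofReal_re, one_re, one_im, im_ofReal_mul,
      re_ofReal_mul]
    ring
  have h5 : ν * ‖(d : ℂ) - x‖ < ‖1 - (ν : ℂ) ^ 2 * d * x‖ := by
    refine lt_of_pow_lt_pow_left₀ 2 (norm_nonneg _) ?_
    have := mul_pos h3 h4
    linarith
  rw [mob, norm_mul, norm_div, norm_real, Real.norm_of_nonneg (by positivity)]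
  rw [show ν / ν' * (‖(d : ℂ) - x‖ / ‖1 - (ν : ℂ) ^ 2 * d * x‖) =
    (ν * ‖(d : ℂ) - x‖) / ‖1 - (ν : ℂ) ^ 2 * d * x‖ * ν'⁻¹ by field_simp]
  have := (div_lt_one hpos).mpr h5
  have := inv_pos.mpr hν'
  nlinarith

lemma differentiableAt_mob {x : ℂ} (hx : 1 - (ν : ℂ) ^ 2 * d * x ≠ 0) :
    DifferentiableAt ℂ (mob ν ν' d) x := by
  have h : DifferentiableAt ℂ (fun x : ℂ => (d - x) / (1 - (ν : ℂ) ^ 2 * d * x)) x :=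
    DifferentiableAt.div (by fun_prop) (by fun_prop) hx
  exact h.const_mul _

/-- On `[0, d)` the map is real and decreases from `(ν / ν') d` to `0`. -/
lemma mob_ofReal (hν : 0 < ν) (hν' : 0 < ν') (h : ν * d < 1) {x : ℝ} (h0 : 0 ≤ x)
    (hx : x < d) : ∃ y : ℝ, 0 < y ∧ y ≤ ν / ν' * d ∧ mob ν ν' d x = y := by
  have hd : 0 < d := h0.trans_lt hx
  have h1 : 0 < 1 - ν ^ 2 * d * x := by
    have : ν * x < 1 := (mul_lt_mul_of_pos_left hx hν).trans h
    have : 0 ≤ ν * x := by positivity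
    have : 0 ≤ ν * d := by positivity
    nlinarith
  refine ⟨ν / ν' * ((d - x) / (1 - ν ^ 2 * d * x)), ?_, ?_, ?_⟩
  · have := sub_pos.mpr hx
    positivity
  · refine mul_le_mul_of_nonneg_left ?_ (by positivity)
    rw [div_le_iff₀ h1]
    have : ν ^ 2 * d ^ 2 * x ≤ x := by
      have h2 : (ν * d) ^ 2 ≤ 1 := by
        have : 0 ≤ ν * d := by positivity
        nlinarith
      nlinarith
    nlinarith
  · rw [mob]; push_cast; rfl

end mob

/-- The vertex `φ(1)`. -/
def oneRadius (α β γ : ℝ) : ℝ := nu γ α β / nu α β γ * infRadius γ α β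

lemma oneRadius_pos (h : Hyperbolic α β γ) : 0 < oneRadius α β γ :=
  mul_pos (div_pos (nu_pos h.rotate.rotate) (nu_pos h)) (infRadius_pos h.rotate.rotate)

lemma nu_mul_oneRadius (h : Hyperbolic α β γ) :
    nu α β γ * oneRadius α β γ = nu γ α β * infRadius γ α β := by
  have := (nu_pos h).ne'
  rw [oneRadius]
  field_simp

lemma nu_mul_oneRadius_lt_one (h : Hyperbolic α β γ) : nu α β γ * oneRadius α β γ < 1 := by
  rw [nu_mul_oneRadius h]
  exact nu_mul_infRadius_lt_one h.rotate.rotate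

lemma oneRadius_lt (h : Hyperbolic α β γ) : oneRadius α β γ < (nu α β γ)⁻¹ := by
  rw [lt_inv_comm₀ (oneRadius_pos h) (nu_pos h), ← one_div, lt_div_iff₀ (oneRadius_pos h)]
  exact nu_mul_oneRadius_lt_one h

lemma infRadius_lt (h : Hyperbolic α β γ) : infRadius α β γ < (nu α β γ)⁻¹ := by
  rw [lt_inv_comm₀ (infRadius_pos h) (nu_pos h), ← one_div, lt_div_iff₀ (infRadius_pos h)]
  exact nu_mul_infRadius_lt_one h

/-- Both quantities measure the side joining `φ(0)` and `φ(∞)`, once from either end. -/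
lemma infRadius_eq (h : Hyperbolic α β γ) :
    nu β γ α / nu α β γ * oneRadius β γ α = infRadius α β γ := by
  have := (nu_pos h).ne'
  have := (nu_pos h.rotate).ne'
  rw [oneRadius]
  field_simp

lemma phi_den_ne_zero (h : Hyperbolic α β γ) {z : ℂ} (hz : z ∈ upperHalf) :
    1 - (nu α β γ : ℂ) ^ 2 * infRadius α β γ * (conj (rot α) * phi α β γ z) ≠ 0 := by
  obtain ⟨-, x, hx, hne⟩ := phi_shiftB_and_ne h hz
  rwa [hx, ← rot, ← mul_assoc (conj _), conj_rot_mul, one_mul]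

lemma phi_shiftB_eq_mob (h : Hyperbolic α β γ) {z : ℂ} (hz : z ∈ upperHalf) :
    phi β γ α (shiftB z) = mob (nu α β γ) (nu β γ α) (infRadius α β γ)
      (conj (rot α) * phi α β γ z) := by
  rw [phi_shiftB h hz, stepS_eq]

lemma phi_eq_mob_shiftB (h : Hyperbolic α β γ) {z : ℂ} (hz : z ∈ upperHalf) :
    phi α β γ z = rot α * mob (nu β γ α) (nu α β γ) (oneRadius β γ α) (phi β γ α (shiftB z)) := by
  have h1 : oneRadius β γ α = nu α β γ / nu β γ α * infRadius α β γ := rfl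
  rw [phi_shiftB_eq_mob h hz, h1, mob_mob (nu_pos h) (nu_pos h.rotate) (infRadius_pos h).le
    (nu_mul_infRadius_lt_one h) (phi_den_ne_zero h hz), ← mul_assoc, rot_mul_conj, one_mul]

lemma shiftB_mem (z : ℂ) (hz : z ∈ upperHalf) : shiftB z ∈ upperHalf := by
  have hz : 0 < z.im := hz
  change 0 < (shiftB z).im
  have h1 : 1 - z ≠ 0 := fun h => by
    have := congrArg im h
    simp at this
    exact hz.ne' this
  rw [shiftB_eq, inv_im]
  have := normSq_pos.mpr h1
  simp only [sub_im, one_im, zero_sub, neg_neg]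
  positivity

lemma shiftC_eq {z : ℂ} (h1 : z ≠ 1) : shiftC z = shiftB (shiftB z) := by
  have h2 : 1 - z ≠ 0 := sub_ne_zero.mpr h1.symm
  have h3 : 1 - (1 - z)⁻¹ = -z / (1 - z) := by field_simp; ring
  rw [shiftB_eq, shiftB_eq, h3, inv_div, shiftC, ← neg_sub, neg_div, div_neg]

lemma shiftB_shiftC {z : ℂ} (h0 : z ≠ 0) : shiftB (shiftC z) = z := by
  have h3 : 1 - (z - 1) / z = z⁻¹ := by field_simp; ring
  rw [shiftB_eq, shiftC, h3, inv_inv]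

lemma ne_ofReal_of_mem {z : ℂ} (hz : z ∈ upperHalf) (x : ℝ) : z ≠ x := by
  rintro rfl
  have : (0 : ℝ) < (x : ℂ).im := hz
  simp at this

lemma shiftC_mem (z : ℂ) (hz : z ∈ upperHalf) : shiftC z ∈ upperHalf := by
  rw [shiftC_eq (by simpa using ne_ofReal_of_mem hz 1)]
  exact shiftB_mem _ (shiftB_mem _ hz)

lemma phi_eq_mob_shiftC (h : Hyperbolic α β γ) {z : ℂ} (hz : z ∈ upperHalf) :
    phi α β γ z = mob (nu γ α β) (nu α β γ) (infRadius γ α β)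
      (conj (rot γ) * phi γ α β (shiftC z)) := by
  have := phi_shiftB_eq_mob h.rotate.rotate (shiftC_mem z hz)
  rwa [shiftB_shiftC (by simpa using ne_ofReal_of_mem hz 0)] at this

/-! ### The boundary of the upper half plane -/

lemma isOpen_upperHalf : IsOpen upperHalf := isOpen_lt continuous_const continuous_im

lemma tendsto_shiftB_cobounded : Tendsto shiftB (Bornology.cobounded ℂ) (𝓝 ((0 : ℝ) : ℂ)) := by
  rw [show shiftB = fun z => (1 - z)⁻¹ from funext shiftB_eq, ofReal_zero]
  refine tendsto_inv₀_cobounded.comp ?_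
  rw [← tendsto_norm_atTop_iff_cobounded]
  refine tendsto_atTop_mono (fun z => ?_)
    (tendsto_atTop_add_const_right _ (-1) (tendsto_norm_cobounded_atTop (E := ℂ)))
  have := norm_sub_norm_le z 1
  rw [norm_one, norm_sub_rev] at this
  linarith

/-- The boundary circle splits into the arcs `[0, 1)`, `[1, ∞)` and `{∞} ∪ (-∞, 0)`; the last two
are carried onto `[0, 1)` by `shiftC` and `shiftB`. An ultrafilter either contains a bounded set,
and then converges, or tends to `∞`. -/
lemma boundary_cases (U : Ultrafilter ℂ) (hU : upperHalf ∈ U) :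
    (∃ z ∈ upperHalf, (U : Filter ℂ) ≤ 𝓝 z) ∨
    (∃ x : ℝ, 0 ≤ x ∧ x < 1 ∧ (U : Filter ℂ) ≤ 𝓝 (x : ℂ)) ∨
    (∃ x : ℝ, 0 ≤ x ∧ x < 1 ∧ Tendsto shiftB U (𝓝 (x : ℂ))) ∨
    (∃ x : ℝ, 0 ≤ x ∧ x < 1 ∧ Tendsto shiftC U (𝓝 (x : ℂ))) := by
  by_cases hb : ∃ r : ℝ, Metric.closedBall (0 : ℂ) r ∈ U
  · obtain ⟨r, hr⟩ := hb
    obtain ⟨z, -, hz⟩ := (isCompact_closedBall (0 : ℂ) r).ultrafilter_le_nhds U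
      (le_principal_iff.mpr hr)
    have hzim : 0 ≤ z.im := by
      have hc : IsClosed {w : ℂ | 0 ≤ w.im} := isClosed_le continuous_const continuous_im
      have hU' : {w : ℂ | 0 ≤ w.im} ∈ (U : Filter ℂ) :=
        Filter.mem_of_superset hU fun w (hw : 0 < w.im) => hw.le
      have : z ∈ {w : ℂ | 0 ≤ w.im} := hc.mem_of_tendsto (f := id) hz hU'
      exact this
    rcases hzim.lt_or_eq with h | h
    · exact Or.inl ⟨z, h, hz⟩
    · obtain ⟨x, rfl⟩ : ∃ x : ℝ, z = x := ⟨z.re, by apply Complex.ext <;> simp [← h]⟩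
      rcases lt_or_ge x 0 with hx | hx
      · right; right; left
        have h1 : (1 - x : ℂ) ≠ 0 := by exact_mod_cast (by linarith : (1 - x : ℝ) ≠ 0)
        refine ⟨(1 - x)⁻¹, inv_nonneg.mpr (by linarith),
          inv_lt_one_of_one_lt₀ (by linarith), ?_⟩
        have hcont : ContinuousAt shiftB (x : ℂ) := by
          rw [show shiftB = fun z => (1 - z)⁻¹ from funext shiftB_eq]
          exact ContinuousAt.inv₀ (by fun_prop) h1
        have := hcont.tendsto.mono_left hz
        rw [shiftB_eq] at this
        simpa using this
      · rcases lt_or_ge x 1 with hx1 | hx1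
        · exact Or.inr (Or.inl ⟨x, hx, hx1, hz⟩)
        · right; right; right
          have h0 : 0 < x := by linarith
          refine ⟨(x - 1) / x, div_nonneg (by linarith) h0.le,
            (div_lt_one h0).mpr (by linarith), ?_⟩
          have hcont : ContinuousAt shiftC (x : ℂ) := by
            unfold shiftC
            exact ContinuousAt.div (by fun_prop) (by fun_prop) (ofReal_ne_zero.mpr h0.ne')
          have := hcont.tendsto.mono_left hz
          rw [shiftC] at this
          simpa using this
  · right; right; left
    push Not at hb
    refine ⟨0, le_rfl, one_pos, ?_⟩
    have hU' : (U : Filter ℂ) ≤ Bornology.cobounded ℂ := by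
      rw [(Metric.hasBasis_cobounded_compl_closedBall (0 : ℂ)).ge_iff]
      exact fun r _ => Ultrafilter.compl_mem_iff_notMem.mpr (hb r)
    exact tendsto_shiftB_cobounded.mono_left hU'

/-! ### The triangle function on the closed edge `[0, 1)` -/

lemma ofReal_mem_slitPlane' {x : ℝ} (hx : 0 < x) : (x : ℂ) ∈ slitPlane := by
  left; simpa using hx

/-- The derivative of a quotient of solutions is their Wronskian over the square of the denominator.
-/
lemma hasDerivAt_phi (h : Hyperbolic α β γ) {z : ℂ} (hz : z ∈ slitPlane) (hz' : z ∈ cutPlane) :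
    HasDerivAt (phi α β γ)
      (α * z ^ (α : ℂ) / z * (1 - z) ^ ((γ : ℂ) - 1) / denF α β γ z ^ 2) z := by
  have hz0 := slitPlane_ne_zero hz
  have hd := denF_ne_zero h hz'
  have e := ((hasDerivAt_cpow_div hz (α : ℂ)).mul (numF_ode h hz').1).div (hypSol_denF h z hz').1 hd
  rw [show phi α β γ = fun z => z ^ (α : ℂ) * numF α β γ z / denF α β γ z from funext (phi_eq α β γ)]
  refine e.congr_deriv ?_
  have hw := wronskian_eq h hz'
  rw [show α * z ^ (α : ℂ) / z * (1 - z) ^ ((γ : ℂ) - 1) / denF α β γ z ^ 2 =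
    z ^ (α : ℂ) / z * (α * (1 - z) ^ ((γ : ℂ) - 1)) / denF α β γ z ^ 2 by ring, ← hw]
  simp only [Pi.mul_apply]
  field_simp
  ring

lemma mem_slitPlane_of_mem_upperHalf {z : ℂ} (hz : z ∈ upperHalf) : z ∈ slitPlane :=
  Or.inr (ne_of_gt hz)

lemma mem_cutPlane_of_mem_upperHalf {z : ℂ} (hz : z ∈ upperHalf) : z ∈ cutPlane :=
  posCut_subset (upperHalf_subset_posCut hz)

lemma deriv_phi_ne_zero (h : Hyperbolic α β γ) {z : ℂ} (hz : z ∈ slitPlane) (hz' : z ∈ cutPlane) :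
    α * z ^ (α : ℂ) / z * (1 - z) ^ ((γ : ℂ) - 1) / denF α β γ z ^ 2 ≠ 0 := by
  have hz0 := slitPlane_ne_zero hz
  have hz1 : 1 - z ≠ 0 := slitPlane_ne_zero hz'
  have hd := denF_ne_zero h hz'
  have hα : (α : ℂ) ≠ 0 := ofReal_ne_zero.mpr h.pos₁.ne'
  simp [hz0, hz1, hd, hα, cpow_eq_zero_iff]

/-- The real values of `phi` on `[0, 1)`. -/
def edge (α β γ : ℝ) (x : ℝ) : ℝ := (phi α β γ x).re

lemma edge_zero (h : Hyperbolic α β γ) : edge α β γ 0 = 0 := by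
  have hα : (α : ℂ) ≠ 0 := ofReal_ne_zero.mpr h.pos₁.ne'
  simp [edge, phi_eq, hα]

lemma phi_ofReal (h : Hyperbolic α β γ) {x : ℝ} (h0 : 0 ≤ x) (h1 : x < 1) :
    phi α β γ x = edge α β γ x := by
  obtain ⟨y, -, hy⟩ := denF_ofReal h h1
  obtain ⟨y', -, hy'⟩ := numF_ofReal h h1
  have e : phi α β γ x = ((x ^ α * y' / y : ℝ) : ℂ) := by
    rw [phi_eq, hy, hy', ← ofReal_cpow h0]
    push_cast
    rfl
  rw [edge, e, ofReal_re]

lemma strictMonoOn_edge (h : Hyperbolic α β γ) : StrictMonoOn (edge α β γ) (Set.Ioo 0 1) := by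
  have hd : ∀ x ∈ Set.Ioo (0 : ℝ) 1, ∃ d : ℝ, 0 < d ∧ HasDerivAt (edge α β γ) d x := by
    intro x hx
    have e := hasDerivAt_phi h (ofReal_mem_slitPlane' hx.1) (ofReal_mem_cutPlane hx.2)
    obtain ⟨y, hy0, hy⟩ := denF_ofReal h hx.2
    refine ⟨α * x ^ α / x * (1 - x) ^ (γ - 1) / y ^ 2, ?_, ?_⟩
    · have := Real.rpow_pos_of_pos hx.1 α
      have := Real.rpow_pos_of_pos (sub_pos.mpr hx.2) (γ - 1)
      have := h.pos₁
      have := hx.1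
      positivity
    · refine e.real_of_complex.congr_deriv ?_
      have e2 : (1 - (x : ℂ)) ^ ((γ : ℂ) - 1) = (((1 - x) ^ (γ - 1) : ℝ) : ℂ) := by
        rw [← one_sub_cpow_ofReal hx.2]
        push_cast
        rfl
      rw [hy, ← ofReal_cpow hx.1.le, e2, ← ofReal_re (α * x ^ α / x * (1 - x) ^ (γ - 1) / y ^ 2)]
      congr 1
      push_cast
      rfl
  refine strictMonoOn_of_deriv_pos (convex_Ioo 0 1) (fun x hx => ?_) fun x hx => ?_
  · obtain ⟨d, -, hd⟩ := hd x hx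
    exact hd.continuousAt.continuousWithinAt
  · rw [interior_Ioo] at hx
    obtain ⟨d, hd0, hd⟩ := hd x hx
    rwa [hd.deriv]

lemma edge_pos (h : Hyperbolic α β γ) {x : ℝ} (h0 : 0 < x) (h1 : x < 1) : 0 < edge α β γ x := by
  obtain ⟨y, hy0, hy⟩ := denF_ofReal h h1
  obtain ⟨y', hy0', hy'⟩ := numF_ofReal h h1
  have e : phi α β γ x = ((x ^ α * y' / y : ℝ) : ℂ) := by
    rw [phi_eq, hy, hy', ← ofReal_cpow h0.le]
    push_cast
    rfl
  rw [edge, e, ofReal_re]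
  have := Real.rpow_pos_of_pos h0 α
  positivity

lemma continuousAt_phi (h : Hyperbolic α β γ) {x : ℝ} (h0 : 0 ≤ x) (h1 : x < 1) :
    ContinuousAt (phi α β γ) x := by
  have hc := ofReal_mem_cutPlane h1
  rw [show phi α β γ = fun z => z ^ (α : ℂ) * numF α β γ z / denF α β γ z from funext (phi_eq α β γ)]
  refine ContinuousAt.div (ContinuousAt.mul ?_ (continuousAt_numF h hc)) (continuousAt_denF h hc)
    (denF_ne_zero h hc)
  rcases h0.eq_or_lt with rfl | h0
  · have := continuousAt_cpow_zero_of_re_pos (z := (α : ℂ)) (by simpa using h.pos₁)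
    rw [ofReal_zero]
    exact ContinuousAt.comp (f := fun z : ℂ => (z, (α : ℂ))) (x := 0) this (by fun_prop)
  · exact continuousAt_cpow_const (ofReal_mem_slitPlane' h0)

lemma tendsto_phi_edge (h : Hyperbolic α β γ) {x : ℝ} (h0 : 0 ≤ x) (h1 : x < 1) :
    Tendsto (phi α β γ) (𝓝 x) (𝓝 (edge α β γ x : ℂ)) := by
  rw [← phi_ofReal h h0 h1]
  exact continuousAt_phi h h0 h1

/-! ### Boundary limits of the triangle function -/

lemma norm_conj_rot_mul (θ : ℝ) (x : ℂ) : ‖conj (rot θ) * x‖ = ‖x‖ := by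
  rw [norm_mul, norm_conj, norm_rot, one_mul]

/-- The limit of `phi` along a filter in terms of the limit of the neighbouring function. -/
lemma tendsto_phi_of_shiftC (h : Hyperbolic α β γ) {l : Filter ℂ} (hl : upperHalf ∈ l) {u : ℂ}
    (hu : ‖u‖ < (nu γ α β)⁻¹) (ht : Tendsto (fun z => phi γ α β (shiftC z)) l (𝓝 u)) :
    Tendsto (phi α β γ) l
      (𝓝 (mob (nu γ α β) (nu α β γ) (infRadius γ α β) (conj (rot γ) * u))) := by
  have hr := h.rotate.rotate
  have hc := (differentiableAt_mob (ν' := nu α β γ) (mob_den_ne_zero (nu_pos hr)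
    (infRadius_pos hr).le (nu_mul_infRadius_lt_one hr)
    (x := conj (rot γ) * u) (by rwa [norm_conj_rot_mul]))).continuousAt
  refine (hc.tendsto.comp (ht.const_mul _)).congr' ?_
  filter_upwards [hl] with z hz
  rw [phi_eq_mob_shiftC h hz]
  rfl

lemma tendsto_phi_of_shiftB (h : Hyperbolic α β γ) {l : Filter ℂ} (hl : upperHalf ∈ l) {u : ℂ}
    (hu : ‖u‖ < (nu β γ α)⁻¹) (ht : Tendsto (fun z => phi β γ α (shiftB z)) l (𝓝 u)) :
    Tendsto (phi α β γ) l
      (𝓝 (rot α * mob (nu β γ α) (nu α β γ) (oneRadius β γ α) u)) := by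
  have hr := h.rotate
  have hc := (differentiableAt_mob (ν' := nu α β γ) (mob_den_ne_zero (nu_pos hr)
    (oneRadius_pos hr).le (nu_mul_oneRadius_lt_one hr) hu)).continuousAt
  refine ((hc.tendsto.comp ht).const_mul _).congr' ?_
  filter_upwards [hl] with z hz
  rw [phi_eq_mob_shiftB h hz]
  rfl

lemma tendsto_phi_of_shiftC_zero (h : Hyperbolic α β γ) {l : Filter ℂ} (hl : upperHalf ∈ l)
    (ht : Tendsto shiftC l (𝓝 0)) : Tendsto (phi α β γ) l (𝓝 (oneRadius α β γ : ℂ)) := by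
  have hr := h.rotate.rotate
  have e := (tendsto_phi_edge hr le_rfl one_pos)
  rw [edge_zero hr, ofReal_zero] at e
  have := tendsto_phi_of_shiftC h hl (by simpa using nu_pos hr) (e.comp ht)
  rwa [mul_zero, mob_zero] at this

lemma tendsto_phi_of_shiftB_zero (h : Hyperbolic α β γ) {l : Filter ℂ} (hl : upperHalf ∈ l)
    (ht : Tendsto shiftB l (𝓝 0)) : Tendsto (phi α β γ) l (𝓝 (vertB α β γ)) := by
  have hr := h.rotate
  have e := (tendsto_phi_edge hr le_rfl one_pos)
  rw [edge_zero hr, ofReal_zero] at e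
  have := tendsto_phi_of_shiftB h hl (by simpa using nu_pos hr) (e.comp ht)
  rwa [mob_zero, infRadius_eq h, mul_comm] at this

lemma tendsto_phi_one (h : Hyperbolic α β γ) :
    Tendsto (phi α β γ) (𝓝[upperHalf] 1) (𝓝 (oneRadius α β γ : ℂ)) := by
  refine tendsto_phi_of_shiftC_zero h self_mem_nhdsWithin ?_
  have hcont : ContinuousAt shiftC 1 := by
    unfold shiftC
    exact ContinuousAt.div (by fun_prop) (by fun_prop) one_ne_zero
  have := hcont.tendsto
  simp only [shiftC, sub_self, zero_div] at this
  exact this.mono_left nhdsWithin_le_nhds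

lemma tendsto_phi_zero (h : Hyperbolic α β γ) :
    Tendsto (phi α β γ) (𝓝[upperHalf] 0) (𝓝 0) := by
  have := tendsto_phi_edge h le_rfl one_pos
  rw [edge_zero h, ofReal_zero] at this
  exact this.mono_left nhdsWithin_le_nhds

lemma tendsto_phi_cobounded (h : Hyperbolic α β γ) :
    Tendsto (phi α β γ) (Bornology.cobounded ℂ ⊓ 𝓟 upperHalf) (𝓝 (vertB α β γ)) := by
  refine tendsto_phi_of_shiftB_zero h (mem_inf_of_right (mem_principal_self _)) ?_
  have := tendsto_shiftB_cobounded
  rw [ofReal_zero] at this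
  exact this.mono_left inf_le_left

lemma edge_lt (h : Hyperbolic α β γ) {x : ℝ} (h0 : 0 ≤ x) (h1 : x < 1) :
    edge α β γ x < oneRadius α β γ := by
  rcases h0.eq_or_lt with rfl | h0
  · rw [edge_zero h]; exact oneRadius_pos h
  have hlim : Tendsto (edge α β γ) (𝓝[<] 1) (𝓝 (oneRadius α β γ)) := by
    rw [Metric.tendsto_nhdsWithin_nhds]
    intro ε hε
    obtain ⟨δ, hδ, hd⟩ := Metric.tendsto_nhdsWithin_nhds.mp (tendsto_phi_one h) (ε / 2) (by linarith)
    refine ⟨min δ 1, lt_min hδ one_pos, fun {y} hy hyd => ?_⟩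
    have hy : y < 1 := hy
    rw [Real.dist_eq, abs_sub_comm, abs_of_pos (by linarith), lt_min_iff] at hyd
    have hy0 : 0 < y := by linarith
    -- The limit at `1` is known only from within the upper half plane, so the boundary point `y` is
    -- approached vertically by `y + t i`.
    have hcl : Tendsto (fun t : ℝ => (y : ℂ) + t * I) (𝓝[>] 0) (𝓝 (y : ℂ)) := by
      have : Continuous (fun t : ℝ => (y : ℂ) + t * I) := by fun_prop
      have := this.tendsto 0
      simp only [ofReal_zero, zero_mul, add_zero] at this
      exact this.mono_left nhdsWithin_le_nhds
    have h3 := ((tendsto_phi_edge h hy0.le hy).comp hcl).dist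
      (tendsto_const_nhds (x := (oneRadius α β γ : ℂ)))
    have h4 : dist (edge α β γ y : ℂ) (oneRadius α β γ : ℂ) ≤ ε / 2 := by
      refine le_of_tendsto h3 ?_
      have hlt : ∀ᶠ t : ℝ in 𝓝[>] 0, dist ((y : ℂ) + t * I) 1 < δ := by
        have hlim := hcl.dist (tendsto_const_nhds (x := (1 : ℂ)))
        refine hlim.eventually_lt_const ?_
        rw [dist_comm, dist_eq, ← ofReal_one, ← ofReal_sub, norm_real, Real.norm_of_nonneg
          (by linarith)]
        exact hyd.1
      filter_upwards [hlt, self_mem_nhdsWithin] with t ht ht0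
      have ht0 : 0 < t := ht0
      exact (hd (show (y : ℂ) + t * I ∈ upperHalf by simpa [upperHalf] using ht0) ht).le
    rw [dist_eq, ← ofReal_sub, norm_real] at h4
    rw [Real.dist_eq]
    have : |edge α β γ y - oneRadius α β γ| ≤ ε / 2 := h4
    linarith
  obtain ⟨y, hy, hy1⟩ := exists_between h1
  refine (strictMonoOn_edge h ⟨h0, h1⟩ ⟨h0.trans hy, hy1⟩ hy).trans_le ?_
  refine ge_of_tendsto hlim ?_
  filter_upwards [Ioo_mem_nhdsLT hy1] with t ht
  exact (strictMonoOn_edge h ⟨h0.trans hy, hy1⟩ ⟨(h0.trans hy).trans ht.1, ht.2⟩ ht.1).le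

lemma edge_nonneg (h : Hyperbolic α β γ) {x : ℝ} (h0 : 0 ≤ x) (h1 : x < 1) : 0 ≤ edge α β γ x := by
  rcases h0.eq_or_lt with rfl | h0
  · rw [edge_zero h]
  · exact (edge_pos h h0 h1).le

/-- Where `phi` tends to along an ultrafilter which converges to a boundary point. -/
inductive BoundaryLimit (α β γ : ℝ) (U : Ultrafilter ℂ) (w : ℂ) : Prop
  | left (x : ℝ) (h0 : 0 ≤ x) (h1 : x < 1) (hU : (U : Filter ℂ) ≤ 𝓝 (x : ℂ))
      (hw : w = edge α β γ x)
  | back (y : ℝ) (h0 : 0 < y) (h1 : y ≤ infRadius α β γ) (hw : w = rot α * y)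
  -- The limit on the third arc is recorded in the coordinates about `φ(1)` and about `φ(∞)`: the
  -- first shows the sign relative to the real axis, the second the sign relative to the line
  -- through `vertB`.
  | right (x y : ℝ) (h0 : 0 ≤ x) (h1 : x < oneRadius γ α β)
      (hw : w = mob (nu γ α β) (nu α β γ) (infRadius γ α β) (conj (rot γ) * x))
      (h0' : 0 < y) (h1' : y ≤ infRadius β γ α)
      (hw' : w = rot α * mob (nu β γ α) (nu α β γ) (oneRadius β γ α) (rot β * y))

lemma boundaryLimit (h : Hyperbolic α β γ) (U : Ultrafilter ℂ) (hU : upperHalf ∈ U) :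
    (∃ z ∈ upperHalf, (U : Filter ℂ) ≤ 𝓝 z) ∨
    ∃ w, Tendsto (phi α β γ) U (𝓝 w) ∧ BoundaryLimit α β γ U w := by
  rcases boundary_cases U hU with hz | ⟨x, h0, h1, hx⟩ | ⟨x, h0, h1, hx⟩ | ⟨x, h0, h1, hx⟩
  · exact Or.inl hz
  · exact Or.inr ⟨_, (tendsto_phi_edge h h0 h1).mono_left hx, .left x h0 h1 hx rfl⟩
  · have hr := h.rotate
    have e := (tendsto_phi_edge hr h0 h1).comp hx
    have l0 := edge_nonneg hr h0 h1
    have l1 := edge_lt hr h0 h1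
    have hn : ‖(edge β γ α x : ℂ)‖ < (nu β γ α)⁻¹ := by
      rw [norm_real, Real.norm_of_nonneg l0]
      exact l1.trans (oneRadius_lt hr)
    have t := tendsto_phi_of_shiftB h hU hn e
    obtain ⟨y, y0, y1, hy⟩ := mob_ofReal (nu_pos hr) (nu_pos h) (nu_mul_oneRadius_lt_one hr) l0 l1
    rw [hy] at t
    rw [infRadius_eq h] at y1
    exact Or.inr ⟨_, t, .back y y0 y1 rfl⟩
  · have hr := h.rotate
    have hrr := hr.rotate
    have e := (tendsto_phi_edge hrr h0 h1).comp hx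
    have l0 := edge_nonneg hrr h0 h1
    have l1 := edge_lt hrr h0 h1
    have hn : ‖(edge γ α β x : ℂ)‖ < (nu γ α β)⁻¹ := by
      rw [norm_real, Real.norm_of_nonneg l0]
      exact l1.trans (oneRadius_lt hrr)
    have t := tendsto_phi_of_shiftC h hU hn e
    -- the limit of the function about the vertex `B`
    have hU' : upperHalf ∈ (U.map shiftB : Ultrafilter ℂ) :=
      Ultrafilter.mem_map.mpr (Filter.mem_of_superset hU fun z hz => shiftB_mem z hz)
    have e' : Tendsto (fun z => phi γ α β (shiftB z)) (U.map shiftB : Ultrafilter ℂ)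
        (𝓝 (edge γ α β x : ℂ)) := by
      rw [Ultrafilter.coe_map, tendsto_map'_iff]
      refine e.congr' ?_
      filter_upwards [hU] with z hz
      simp only [Function.comp_apply]
      rw [shiftC_eq (by simpa using ne_ofReal_of_mem hz 1)]
    have t' := tendsto_phi_of_shiftB hr hU' hn e'
    obtain ⟨y, y0, y1, hy⟩ := mob_ofReal (nu_pos hrr) (nu_pos hr) (nu_mul_oneRadius_lt_one hrr)
      l0 l1
    rw [hy, Ultrafilter.coe_map, tendsto_map'_iff] at t'
    rw [infRadius_eq hr] at y1
    have hn' : ‖rot β * (y : ℂ)‖ < (nu β γ α)⁻¹ := by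
      rw [norm_mul, norm_rot, one_mul, norm_real, Real.norm_of_nonneg y0.le]
      exact y1.trans_lt (infRadius_lt hr)
    have t'' := tendsto_phi_of_shiftB h hU hn' t'
    exact Or.inr ⟨_, t, .right _ y l0 l1 rfl y0 y1 (tendsto_nhds_unique t t'')⟩

/-! ### The image of the upper half plane -/

lemma isPreconnected_upperHalf : IsPreconnected upperHalf :=
  (convex_halfSpace_im_gt 0).isPreconnected

/-- A maximum principle on the upper half plane with boundary limits along ultrafilters. -/
lemma norm_le_of_boundaryLimit {g : ℂ → ℂ} (hg : DifferentiableOn ℂ g upperHalf) {M : ℝ}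
    (hb : ∀ U : Ultrafilter ℂ, upperHalf ∈ U → (∃ z ∈ upperHalf, (U : Filter ℂ) ≤ 𝓝 z) ∨
      ∃ w, Tendsto g U (𝓝 w) ∧ ‖w‖ ≤ M) {z₀ : ℂ} (hz₀ : z₀ ∈ upperHalf) : ‖g z₀‖ ≤ M := by
  by_contra! hM
  have hcont := hg.continuousOn
  -- No ultrafilter on this superlevel set can escape to the boundary, where the limits are at most
  -- `M`, so the set is compact and the maximum is attained. Then `‖g‖` is constant and the whole
  -- open half plane would be compact.
  set K : Set ℂ := {z | z ∈ upperHalf ∧ ‖g z₀‖ ≤ ‖g z‖} with hK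
  have hKU : K ⊆ upperHalf := fun z hz => hz.1
  have hcomp : IsCompact K := by
    rw [isCompact_iff_ultrafilter_le_nhds]
    intro U hU
    have hKm : K ∈ U := le_principal_iff.mp hU
    rcases hb U (Filter.mem_of_superset hKm hKU) with ⟨z, hz, hUz⟩ | ⟨w, hw, hwM⟩
    · refine ⟨z, ⟨hz, ?_⟩, hUz⟩
      have h1 := ((hcont.continuousAt (isOpen_upperHalf.mem_nhds hz)).norm.tendsto).mono_left hUz
      exact ge_of_tendsto h1 (Filter.mem_of_superset hKm fun y hy => hy.2)
    · exfalso
      have h1 := ge_of_tendsto hw.norm (Filter.mem_of_superset hKm fun y hy => hy.2)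
      linarith
  obtain ⟨z₁, hz₁, hmax⟩ := hcomp.exists_isMaxOn ⟨z₀, hz₀, le_rfl⟩ (hcont.mono hKU).norm
  have hmax' : IsMaxOn (norm ∘ g) upperHalf z₁ := by
    intro z hz
    by_cases h : z ∈ K
    · exact hmax h
    · have : ‖g z‖ < ‖g z₀‖ := by
        by_contra! h'
        exact h ⟨hz, h'⟩
      exact this.le.trans hz₁.2
  have hconst := Complex.norm_eqOn_of_isPreconnected_of_isMaxOn isPreconnected_upperHalf
    isOpen_upperHalf hg hz₁.1 hmax'
  have hall : K = upperHalf := by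
    refine Set.Subset.antisymm hKU fun z hz => ⟨hz, ?_⟩
    have := hconst hz
    simp only [Function.comp_apply, Function.const_apply] at this
    rw [this]
    exact hz₁.2
  have hclosed : IsClosed upperHalf := hall ▸ hcomp.isClosed
  have h0 : (0 : ℂ) ∈ closure upperHalf := by
    rw [upperHalf, closure_setOfPred_lt_im]
    simp
  rw [hclosed.closure_eq] at h0
  simp [upperHalf] at h0

lemma differentiableOn_phi (h : Hyperbolic α β γ) : DifferentiableOn ℂ (phi α β γ) upperHalf :=
  fun _ hz => (hasDerivAt_phi h (mem_slitPlane_of_mem_upperHalf hz)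
    (mem_cutPlane_of_mem_upperHalf hz)).differentiableAt.differentiableWithinAt

lemma hasStrictDerivAt_phi (h : Hyperbolic α β γ) {z : ℂ} (hz : z ∈ slitPlane)
    (hz' : z ∈ cutPlane) :
    ∃ d : ℂ, d ≠ 0 ∧ HasStrictDerivAt (phi α β γ) d z := by
  have hd : DifferentiableOn ℂ (phi α β γ) (slitPlane ∩ cutPlane) := fun w hw =>
    (hasDerivAt_phi h hw.1 hw.2).differentiableAt.differentiableWithinAt
  have ha := hd.analyticAt ((isOpen_slitPlane.inter isOpen_cutPlane).mem_nhds ⟨hz, hz'⟩)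
  refine ⟨_, deriv_phi_ne_zero h hz hz', ?_⟩
  rw [← (hasDerivAt_phi h hz hz').deriv]
  exact ha.hasStrictDerivAt

lemma map_phi_nhds (h : Hyperbolic α β γ) {z : ℂ} (hz : z ∈ upperHalf) :
    map (phi α β γ) (𝓝 z) = 𝓝 (phi α β γ z) := by
  obtain ⟨d, hd, hs⟩ := hasStrictDerivAt_phi h (mem_slitPlane_of_mem_upperHalf hz)
    (mem_cutPlane_of_mem_upperHalf hz)
  exact hs.map_nhds_eq hd

/-- If `phi` maps into a set, it maps into its interior. -/
lemma phi_mem_interior (h : Hyperbolic α β γ) {s : Set ℂ}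
    (hs : ∀ z ∈ upperHalf, phi α β γ z ∈ s) {z : ℂ} (hz : z ∈ upperHalf) :
    phi α β γ z ∈ interior s := by
  rw [mem_interior_iff_mem_nhds, ← map_phi_nhds h hz]
  exact Filter.mem_map.mpr (Filter.mem_of_superset (isOpen_upperHalf.mem_nhds hz) hs)

lemma im_conj_rot_mul_ofReal (θ x : ℝ) : (conj (rot θ) * (x : ℂ)).im = -(x * Real.sin (Real.pi * θ))
    := by
  rw [mul_comm, im_ofReal_mul, conj_im, rot_im]
  ring

lemma im_rot_mul_ofReal (θ x : ℝ) : (rot θ * (x : ℂ)).im = x * Real.sin (Real.pi * θ) := by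
  rw [mul_comm, im_ofReal_mul, rot_im]

lemma Hyperbolic.sin_pos (h : Hyperbolic α β γ) : 0 < Real.sin (Real.pi * α) :=
  sin_pi_mul_pos h.pos₁ (by linarith [h.pos₂, h.pos₃, h.sum_lt])

lemma norm_rot_mul_ofReal (θ x : ℝ) : ‖rot θ * (x : ℂ)‖ = |x| := by
  rw [norm_mul, norm_rot, one_mul, norm_real, Real.norm_eq_abs]

lemma conj_rot_mul_rot_mul (θ : ℝ) (x : ℂ) : conj (rot θ) * (rot θ * x) = x := by
  rw [← mul_assoc, conj_rot_mul, one_mul]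

lemma BoundaryLimit.norm_lt (h : Hyperbolic α β γ) {U : Ultrafilter ℂ} {w : ℂ}
    (hb : BoundaryLimit α β γ U w) : ‖w‖ < (nu α β γ)⁻¹ := by
  cases hb with
  | left x h0 h1 hU hw =>
    rw [hw, norm_real, Real.norm_of_nonneg (edge_nonneg h h0 h1)]
    exact (edge_lt h h0 h1).trans (oneRadius_lt h)
  | back y h0 h1 hw =>
    rw [hw, norm_rot_mul_ofReal, abs_of_pos h0]
    exact h1.trans_lt (infRadius_lt h)
  | right x y h0 h1 hw h0' h1' hw' =>
    have hr := h.rotate.rotate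
    rw [hw]
    apply norm_mob_lt (nu_pos hr) (nu_pos h) (infRadius_pos hr).le (nu_mul_infRadius_lt_one hr)
    rw [norm_conj_rot_mul, norm_real, Real.norm_of_nonneg h0]
    exact h1.trans (oneRadius_lt hr)

lemma BoundaryLimit.im_nonneg (h : Hyperbolic α β γ) {U : Ultrafilter ℂ} {w : ℂ}
    (hb : BoundaryLimit α β γ U w) : 0 ≤ w.im := by
  cases hb with
  | left x h0 h1 hU hw => simp [hw]
  | back y h0 h1 hw =>
    rw [hw, im_rot_mul_ofReal]
    have := h.sin_pos
    positivity
  | right x y h0 h1 hw h0' h1' hw' =>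
    have hr := h.rotate.rotate
    have hn : ‖conj (rot γ) * (x : ℂ)‖ < (nu γ α β)⁻¹ := by
      rw [norm_conj_rot_mul, norm_real, Real.norm_of_nonneg h0]
      exact h1.trans (oneRadius_lt hr)
    obtain ⟨q, hq, he⟩ := mob_im (nu_pos hr) (nu_pos h) (infRadius_pos hr).le
      (nu_mul_infRadius_lt_one hr) (mob_den_ne_zero (nu_pos hr) (infRadius_pos hr).le
      (nu_mul_infRadius_lt_one hr) hn)
    rw [hw, he, im_conj_rot_mul_ofReal]
    have := hr.sin_pos
    have : 0 ≤ q * (x * Real.sin (Real.pi * γ)) := by positivity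
    linarith

lemma BoundaryLimit.im_nonpos (h : Hyperbolic α β γ) {U : Ultrafilter ℂ} {w : ℂ}
    (hb : BoundaryLimit α β γ U w) : (conj (rot α) * w).im ≤ 0 := by
  cases hb with
  | left x h0 h1 hU hw =>
    rw [hw, im_conj_rot_mul_ofReal]
    have := h.sin_pos
    have := edge_nonneg h h0 h1
    have : 0 ≤ edge α β γ x * Real.sin (Real.pi * α) := by positivity
    linarith
  | back y h0 h1 hw => rw [hw, conj_rot_mul_rot_mul, ofReal_im]
  | right x y h0 h1 hw h0' h1' hw' =>
    have hr := h.rotate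
    have hn : ‖rot β * (y : ℂ)‖ < (nu β γ α)⁻¹ := by
      rw [norm_rot_mul_ofReal, abs_of_pos h0']
      exact h1'.trans_lt (infRadius_lt hr)
    obtain ⟨q, hq, he⟩ := mob_im (nu_pos hr) (nu_pos h) (oneRadius_pos hr).le
      (nu_mul_oneRadius_lt_one hr) (mob_den_ne_zero (nu_pos hr) (oneRadius_pos hr).le
      (nu_mul_oneRadius_lt_one hr) hn)
    rw [hw', conj_rot_mul_rot_mul, he, im_rot_mul_ofReal]
    have := hr.sin_pos
    have : 0 ≤ q * (y * Real.sin (Real.pi * β)) := by positivity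
    linarith

/-- The maximum principle gives the weak inequality; openness of `φ` makes it strict. -/
lemma norm_phi_lt (h : Hyperbolic α β γ) {z : ℂ} (hz : z ∈ upperHalf) :
    ‖phi α β γ z‖ < (nu α β γ)⁻¹ := by
  have h1 : ∀ z ∈ upperHalf, phi α β γ z ∈ Metric.closedBall (0 : ℂ) (nu α β γ)⁻¹ := by
    intro z hz
    rw [mem_closedBall_zero_iff]
    refine norm_le_of_boundaryLimit (differentiableOn_phi h) (fun U hU => ?_) hz
    rcases boundaryLimit h U hU with h1 | ⟨w, hw, hb⟩
    · exact Or.inl h1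
    · exact Or.inr ⟨w, hw, (hb.norm_lt h).le⟩
  have := phi_mem_interior h h1 hz
  rwa [interior_closedBall _ (inv_pos.mpr (nu_pos h)).ne', mem_ball_zero_iff] at this

/-- The maximum principle is applied to `exp (i φ)`, whose modulus is `exp (-Im φ)`. -/
lemma phi_im_pos (h : Hyperbolic α β γ) {z : ℂ} (hz : z ∈ upperHalf) :
    0 < (phi α β γ z).im := by
  have h1 : ∀ z ∈ upperHalf, phi α β γ z ∈ {w : ℂ | 0 ≤ w.im} := by
    intro z hz
    have h2 : ‖exp (I * phi α β γ z)‖ ≤ 1 := by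
      refine norm_le_of_boundaryLimit (g := fun z => exp (I * phi α β γ z))
        ((differentiableOn_phi h).const_mul I).cexp (fun U hU => ?_) hz
      rcases boundaryLimit h U hU with h1 | ⟨w, hw, hb⟩
      · exact Or.inl h1
      · refine Or.inr ⟨_, (continuous_exp.tendsto _).comp (hw.const_mul I), ?_⟩
        rw [norm_exp, Real.exp_le_one_iff]
        simpa using hb.im_nonneg h
    rw [norm_exp, Real.exp_le_one_iff] at h2
    simpa using h2
  have := phi_mem_interior h h1 hz
  rwa [interior_setOfPred_le_im] at this

lemma phi_im_neg (h : Hyperbolic α β γ) {z : ℂ} (hz : z ∈ upperHalf) :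
    (conj (rot α) * phi α β γ z).im < 0 := by
  have h1 : ∀ z ∈ upperHalf, phi α β γ z ∈ {w : ℂ | (conj (rot α) * w).im ≤ 0} := by
    intro z hz
    have h2 : ‖exp (-I * (conj (rot α) * phi α β γ z))‖ ≤ 1 := by
      refine norm_le_of_boundaryLimit (g := fun z => exp (-I * (conj (rot α) * phi α β γ z)))
        (((differentiableOn_phi h).const_mul _).const_mul _).cexp (fun U hU => ?_) hz
      rcases boundaryLimit h U hU with h1 | ⟨w, hw, hb⟩
      · exact Or.inl h1
      · refine Or.inr ⟨_, (continuous_exp.tendsto _).comp ((hw.const_mul _).const_mul _), ?_⟩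
        rw [norm_exp, Real.exp_le_one_iff]
        have := hb.im_nonpos h
        simpa [-mul_im, mul_re (-I)] using this
    rw [norm_exp, Real.exp_le_one_iff] at h2
    simpa [-mul_im, mul_re (-I)] using h2
  have h3 := phi_mem_interior h h1 hz
  have h4 : {w : ℂ | (conj (rot α) * w).im ≤ 0} = (fun w => conj (rot α) * w) ⁻¹' {w | w.im ≤ 0} :=
    rfl
  have hopen : IsOpenMap (fun w : ℂ => conj (rot α) * w) :=
    (Homeomorph.mulLeft₀ (conj (rot α)) (by simpa using rot_ne_zero α)).isOpenMap
  rw [h4, ← hopen.preimage_interior_eq_interior_preimage (by fun_prop), interior_setOfPred_im_le] at h3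
  exact h3

/-- The open triangle, as an intersection of half planes. -/
def tri (α β γ : ℝ) : Set ℂ :=
  {w | ‖w‖ < (nu α β γ)⁻¹ ∧ 0 < w.im ∧ (conj (rot α) * w).im < 0 ∧
    (conj (rot β) * stepS α β γ w).im < 0}

lemma phi_mem_tri (h : Hyperbolic α β γ) {z : ℂ} (hz : z ∈ upperHalf) : phi α β γ z ∈ tri α β γ := by
  refine ⟨norm_phi_lt h hz, phi_im_pos h hz, phi_im_neg h hz, ?_⟩
  rw [← phi_shiftB h hz]
  exact phi_im_neg h.rotate (shiftB_mem z hz)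

/-- On each boundary arc one of the three imaginary parts defining the triangle is zero. -/
lemma BoundaryLimit.notMem_tri (h : Hyperbolic α β γ) {U : Ultrafilter ℂ} {w : ℂ}
    (hb : BoundaryLimit α β γ U w) : w ∉ tri α β γ := by
  rintro ⟨-, h2, h3, h4⟩
  cases hb with
  | left x h0 h1 hU hw => simp [hw] at h2
  | back y h0 h1 hw => simp [hw, conj_rot_mul_rot_mul, -mul_im] at h3
  | right x y h0 h1 hw h0' h1' hw' =>
    have hr := h.rotate
    have hn : ‖rot β * (y : ℂ)‖ < (nu β γ α)⁻¹ := by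
      rw [norm_rot_mul_ofReal, abs_of_pos h0']
      exact h1'.trans_lt (infRadius_lt hr)
    have := mob_mob (nu_pos hr) (nu_pos h) (oneRadius_pos hr).le (nu_mul_oneRadius_lt_one hr)
      (mob_den_ne_zero (nu_pos hr) (oneRadius_pos hr).le (nu_mul_oneRadius_lt_one hr) hn)
    rw [infRadius_eq h] at this
    rw [hw', stepS_eq, conj_rot_mul_rot_mul, this, conj_rot_mul_rot_mul, ofReal_im] at h4
    exact h4.false

/-! ### The triangle is connected -/

/-- Multiplying by the squared modulus of the denominator leaves the sign unchanged and makes the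
condition polynomial. -/
lemma mul_mob_im_neg_iff {ν ν' d : ℝ} (hν : 0 < ν) (hν' : 0 < ν') {c x : ℂ}
    (hx : 1 - (ν : ℂ) ^ 2 * d * x ≠ 0) :
    (c * mob ν ν' d x).im < 0 ↔ (c * (d - x) * (1 - (ν : ℂ) ^ 2 * d * conj x)).im < 0 := by
  have h1 : conj (1 - (ν : ℂ) ^ 2 * d * x) = 1 - (ν : ℂ) ^ 2 * d * conj x := by simp
  have hN : 0 < normSq (1 - (ν : ℂ) ^ 2 * d * x) := normSq_pos.mpr hx
  have h2 : c * mob ν ν' d x = ((ν / ν' / normSq (1 - (ν : ℂ) ^ 2 * d * x) : ℝ) : ℂ) *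
      (c * (d - x) * (1 - (ν : ℂ) ^ 2 * d * conj x)) := by
    rw [mob, ← h1, div_eq_mul_inv (_ - x), inv_def]
    push_cast
    ring
  rw [h2, im_ofReal_mul]
  have h3 : 0 < ν / ν' / normSq (1 - (ν : ℂ) ^ 2 * d * x) := by positivity
  refine ⟨fun hh => ?_, mul_neg_of_pos_of_neg h3⟩
  by_contra! hc
  exact hh.not_ge (mul_nonneg h3.le hc)

/-- The difference of the left side and `s * (A + B + C)` is `(1 - s) * (A - C s) ≤ 0`. -/
lemma quadratic_neg {A B C s : ℝ} (hA : A ≤ C) (hC : C ≤ 0) (h1 : A + B + C < 0) (hs : 0 < s)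
    (hs1 : s ≤ 1) : A + B * s + C * s ^ 2 < 0 := by
  have h2 : (1 - s) * (A - C * s) ≤ 0 :=
    mul_nonpos_of_nonneg_of_nonpos (by linarith) (by nlinarith)
  nlinarith

/-- The triangle is star-shaped towards its vertex `0`. Only the opposite side needs an argument:
along a ray its inequality is quadratic in `s`, and the leading coefficient is `ν² |w|² ≤ 1` times
the negative constant term. -/
lemma mul_mem_tri (h : Hyperbolic α β γ) {w : ℂ} (hw : w ∈ tri α β γ) {s : ℝ} (hs : 0 < s)
    (hs1 : s ≤ 1) : (s : ℂ) * w ∈ tri α β γ := by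
  obtain ⟨h1, h2, h3, h4⟩ := hw
  have hn : ‖(s : ℂ) * w‖ < (nu α β γ)⁻¹ := by
    rw [norm_mul, norm_real, Real.norm_of_nonneg hs.le]
    exact (mul_le_of_le_one_left (norm_nonneg _) hs1).trans_lt h1
  refine ⟨hn, ?_, ?_, ?_⟩
  · rw [im_ofReal_mul]; positivity
  · rw [mul_left_comm, im_ofReal_mul]
    exact mul_neg_of_pos_of_neg hs h3
  · have hden : ∀ y : ℂ, ‖y‖ < (nu α β γ)⁻¹ →
        1 - (nu α β γ : ℂ) ^ 2 * infRadius α β γ * (conj (rot α) * y) ≠ 0 := fun y hy =>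
      mob_den_ne_zero (nu_pos h) (infRadius_pos h).le (nu_mul_infRadius_lt_one h)
        (by rwa [norm_conj_rot_mul])
    rw [stepS_eq, mul_mob_im_neg_iff (nu_pos h) (nu_pos h.rotate) (hden _ h1)] at h4
    rw [stepS_eq, mul_mob_im_neg_iff (nu_pos h) (nu_pos h.rotate) (hden _ hn)]
    set x := conj (rot α) * w with hx
    have hxn : nu α β γ ^ 2 * normSq x ≤ 1 := by
      have e : nu α β γ * ‖x‖ ≤ 1 := by
        rw [hx, norm_conj_rot_mul, ← le_inv_mul_iff₀ (nu_pos h), mul_one]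
        exact h1.le
      rw [normSq_eq_norm_sq, ← mul_pow]
      exact pow_le_one₀ (mul_nonneg (nu_pos h).le (norm_nonneg _)) e
    set d := infRadius α β γ
    set c := conj (rot β) with hc
    have hci : c.im < 0 := by
      rw [hc, conj_im, rot_im]
      linarith [h.rotate.sin_pos]
    have hd : 0 < d := infRadius_pos h
    have key : ∀ t : ℝ, (c * (d - t * x) * (1 - (nu α β γ : ℂ) ^ 2 * d * conj (t * x))).im =
        d * c.im + (-(c * x).im - nu α β γ ^ 2 * d ^ 2 * (c * conj x).im) * t +
          nu α β γ ^ 2 * normSq x * (d * c.im) * t ^ 2 := by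
      intro t
      have : c * (d - t * x) * (1 - (nu α β γ : ℂ) ^ 2 * d * conj (t * x)) =
          d * c + t * (-(c * x)) - ((nu α β γ ^ 2 * d ^ 2 * t : ℝ) : ℂ) * (c * conj x) +
          ((nu α β γ ^ 2 * normSq x * d * t ^ 2 : ℝ) : ℂ) * c := by
        push_cast
        rw [← mul_conj, map_mul, conj_ofReal]
        ring
      rw [this]
      simp only [add_im, sub_im, im_ofReal_mul, neg_im]
      ring
    have k1 := key 1
    rw [ofReal_one, one_mul] at k1
    rw [mul_left_comm, ← hx, key s]
    rw [k1] at h4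
    have hneg : d * c.im < 0 := mul_neg_of_pos_of_neg hd hci
    refine quadratic_neg ?_ ?_ (by linarith) hs hs1
    · nlinarith
    · exact mul_nonpos_of_nonneg_of_nonpos (mul_nonneg (sq_nonneg _) (normSq_nonneg _)) hneg.le

/-- Near the vertex `0` the opposite side imposes no condition, by continuity. -/
lemma exists_ball_subset_tri (h : Hyperbolic α β γ) : ∃ ε > 0, ∀ w : ℂ, ‖w‖ < ε → 0 < w.im →
    (conj (rot α) * w).im < 0 → w ∈ tri α β γ := by
  have hd0 := mob_den_ne_zero (nu_pos h) (infRadius_pos h).le (nu_mul_infRadius_lt_one h)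
    (x := 0) (by simpa using nu_pos h)
  have hcont : ContinuousAt (fun w => (conj (rot β) * stepS α β γ w).im) 0 := by
    have h1 : ContinuousAt (stepS α β γ) 0 := by
      rw [show stepS α β γ = fun w => mob (nu α β γ) (nu β γ α) (infRadius α β γ)
        (conj (rot α) * w) from funext (stepS_eq α β γ)]
      have h2 : ContinuousAt (mob (nu α β γ) (nu β γ α) (infRadius α β γ))
          (conj (rot α) * 0) := by
        rw [mul_zero]
        exact (differentiableAt_mob hd0).continuousAt
      exact ContinuousAt.comp (f := fun w => conj (rot α) * w) h2 (by fun_prop)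
    exact continuous_im.continuousAt.comp (continuousAt_const.mul h1)
  have h0 : (conj (rot β) * stepS α β γ 0).im < 0 := by
    rw [stepS_eq, mul_zero, mob_zero, im_conj_rot_mul_ofReal, neg_lt_zero]
    exact mul_pos (mul_pos (div_pos (nu_pos h) (nu_pos h.rotate)) (infRadius_pos h))
      h.rotate.sin_pos
  obtain ⟨ε, hε, hb⟩ := Metric.eventually_nhds_iff_ball.mp (hcont.eventually_lt_const h0)
  refine ⟨min ε (nu α β γ)⁻¹, lt_min hε (inv_pos.mpr (nu_pos h)), fun w hw h1 h2 => ?_⟩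
  rw [lt_min_iff] at hw
  exact ⟨hw.2, h1, h2, hb w (by simpa using hw.1)⟩

/-- Every point can be moved radially into a small circular sector at `0`, which is convex. -/
lemma isPreconnected_tri (h : Hyperbolic α β γ) : IsPreconnected (tri α β γ) := by
  obtain ⟨ε, hε, hb⟩ := exists_ball_subset_tri h
  set D : Set ℂ := {w | ‖w‖ < ε ∧ 0 < w.im ∧ (conj (rot α) * w).im < 0} with hD
  have hDt : D ⊆ tri α β γ := fun w hw => hb w hw.1 hw.2.1 hw.2.2
  have hDc : Convex ℝ D := by
    have h1 : Convex ℝ {w : ℂ | (conj (rot α) * w).im < 0} :=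
      (convex_halfSpace_im_lt 0).linear_preimage (LinearMap.mulLeft ℝ (conj (rot α)))
    have h2 := (convex_ball (0 : ℂ) ε).inter ((convex_halfSpace_im_gt 0).inter h1)
    have h3 : D = Metric.ball (0 : ℂ) ε ∩ ({c : ℂ | 0 < c.im} ∩
        {w : ℂ | (conj (rot α) * w).im < 0}) := by
      ext w
      simp [hD, -mul_im]
    rw [h3]
    exact h2
  have hsmall : ∀ w ∈ tri α β γ, ∃ s : ℝ, 0 < s ∧ s ≤ 1 ∧ (s : ℂ) * w ∈ D := by
    intro w hw
    refine ⟨min 1 (ε / (‖w‖ + 1)), lt_min one_pos (by positivity), min_le_left _ _, ?_⟩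
    have hs : 0 < min 1 (ε / (‖w‖ + 1)) := lt_min one_pos (by positivity)
    have hm := mul_mem_tri h hw hs (min_le_left _ _)
    refine ⟨?_, hm.2.1, hm.2.2.1⟩
    rw [norm_mul, norm_real, Real.norm_of_nonneg hs.le]
    calc _ ≤ ε / (‖w‖ + 1) * ‖w‖ := by gcongr; exact min_le_right _ _
      _ < ε := by
        rw [div_mul_eq_mul_div, div_lt_iff₀ (by positivity)]
        nlinarith
  have hj : ∀ w ∈ tri α β γ, ∀ s : ℝ, 0 < s → s ≤ 1 → JoinedIn (tri α β γ) (s * w) w := by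
    intro w hw s hs hs1
    refine JoinedIn.of_segment_subset ?_
    rintro y hy
    rw [segment_eq_image] at hy
    obtain ⟨t, ⟨ht0, ht1⟩, rfl⟩ := hy
    have : (1 - t) • ((s : ℂ) * w) + t • w = (((1 - t) * s + t : ℝ) : ℂ) * w := by
      simp only [real_smul]
      push_cast
      ring
    simp only [this]
    exact mul_mem_tri h hw (by nlinarith) (by nlinarith)
  rcases (tri α β γ).eq_empty_or_nonempty with he | ⟨w₀, hw₀⟩
  · rw [he]; exact isPreconnected_empty
  · refine IsPathConnected.isConnected ?_ |>.isPreconnected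
    refine isPathConnected_iff.mpr ⟨⟨w₀, hw₀⟩, fun x hx y hy => ?_⟩
    obtain ⟨s, hs, hs1, hsD⟩ := hsmall x hx
    obtain ⟨t, ht, ht1, htD⟩ := hsmall y hy
    exact ((hj x hx s hs hs1).symm.trans
      (JoinedIn.of_segment_subset ((hDc.segment_subset hsD htD).trans hDt))).trans (hj y hy t ht ht1)

/-! ### The mapping theorem -/

lemma isOpen_image_phi (h : Hyperbolic α β γ) : IsOpen (phi α β γ '' upperHalf) := by
  rw [isOpen_iff_mem_nhds]
  rintro _ ⟨z, hz, rfl⟩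
  rw [← map_phi_nhds h hz]
  exact image_mem_map (isOpen_upperHalf.mem_nhds hz)

/-- The image is open. It is relatively closed in the triangle because values along an ultrafilter
escaping to the boundary converge outside the triangle. -/
lemma tri_subset_image_phi (h : Hyperbolic α β γ) : tri α β γ ⊆ phi α β γ '' upperHalf := by
  refine (isPreconnected_tri h).subset_of_closure_inter_subset (isOpen_image_phi h) ?_ ?_
  · have hI : I ∈ upperHalf := by simp [upperHalf]
    exact ⟨_, phi_mem_tri h hI, _, hI, rfl⟩
  · rintro w ⟨hw, hwt⟩
    rw [mem_closure_iff_clusterPt, ← map_principal] at hw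
    obtain ⟨U, hU, hUw⟩ := mapClusterPt_iff_ultrafilter.mp hw
    have hU' : upperHalf ∈ U := le_principal_iff.mp hU
    rcases boundaryLimit h U hU' with ⟨z, hz, hUz⟩ | ⟨w', hw', hb⟩
    · have := ((differentiableOn_phi h).continuousOn.continuousAt
        (isOpen_upperHalf.mem_nhds hz)).tendsto.mono_left hUz
      exact ⟨z, hz, tendsto_nhds_unique this hUw⟩
    · rw [tendsto_nhds_unique hUw hw'] at hwt
      exact absurd hwt (hb.notMem_tri h)

lemma edge_injOn (h : Hyperbolic α β γ) {x y : ℝ} (hx0 : 0 ≤ x) (hx1 : x < 1) (hy0 : 0 ≤ y)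
    (hy1 : y < 1) (he : edge α β γ x = edge α β γ y) : x = y := by
  rcases hx0.eq_or_lt with rfl | hx0 <;> rcases hy0.eq_or_lt with rfl | hy0
  · rfl
  · have := edge_pos h hy0 hy1
    rw [← he, edge_zero h] at this
    exact absurd this (lt_irrefl _)
  · have := edge_pos h hx0 hx1
    rw [he, edge_zero h] at this
    exact absurd this (lt_irrefl _)
  · exact (strictMonoOn_edge h).injOn ⟨hx0, hx1⟩ ⟨hy0, hy1⟩ he

/-- A point of the edge from `0` is only approached from the corresponding boundary point. -/
lemma le_nhds_of_tendsto_edge (h : Hyperbolic α β γ) {l : Filter ℂ} (hl : upperHalf ∈ l) {x₀ : ℝ}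
    (h0 : 0 ≤ x₀) (h1 : x₀ < 1) (ht : Tendsto (phi α β γ) l (𝓝 (edge α β γ x₀ : ℂ))) :
    l ≤ 𝓝 (x₀ : ℂ) := by
  rw [le_iff_ultrafilter]
  intro U hUl
  have hU : upperHalf ∈ U := hUl hl
  replace ht := ht.mono_left hUl
  rcases boundaryLimit h U hU with ⟨z, hz, hUz⟩ | ⟨w, hw, hb⟩
  · have := ((differentiableOn_phi h).continuousOn.continuousAt
      (isOpen_upperHalf.mem_nhds hz)).tendsto.mono_left hUz
    have h3 := phi_im_pos h hz
    rw [tendsto_nhds_unique this ht, ofReal_im] at h3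
    exact absurd h3 (lt_irrefl _)
  · have hwe := tendsto_nhds_unique hw ht
    cases hb with
    | left x hx0 hx1 hU hw' =>
      rw [hw'] at hwe
      rwa [← edge_injOn h hx0 hx1 h0 h1 (ofReal_injective hwe)]
    | back y hy0 hy1 hw' =>
      have h2 := im_rot_mul_ofReal α y
      rw [← hw', hwe, ofReal_im] at h2
      exact absurd h2.symm (mul_pos hy0 h.sin_pos).ne'
    | right x y hx0 hx1 hw' =>
      have hr := h.rotate.rotate
      have hn : ‖conj (rot γ) * (x : ℂ)‖ < (nu γ α β)⁻¹ := by
        rw [norm_conj_rot_mul, norm_real, Real.norm_of_nonneg hx0]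
        exact hx1.trans (oneRadius_lt hr)
      obtain ⟨q, hq, he⟩ := mob_im (nu_pos hr) (nu_pos h) (infRadius_pos hr).le
        (nu_mul_infRadius_lt_one hr) (mob_den_ne_zero (nu_pos hr) (infRadius_pos hr).le
        (nu_mul_infRadius_lt_one hr) hn)
      rw [← hw', hwe, ofReal_im, im_conj_rot_mul_ofReal] at he
      rcases hx0.eq_or_lt with rfl | hx0
      · rw [ofReal_zero, mul_zero, mob_zero] at hw'
        have := ofReal_injective (hwe.symm.trans hw')
        exact absurd this (edge_lt h h0 h1).ne
      · have := mul_pos hq (mul_pos hx0 hr.sin_pos)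
        linarith

lemma eventually_injective_phi (h : Hyperbolic α β γ) {z : ℂ} (hz : z ∈ slitPlane)
    (hz' : z ∈ cutPlane) :
    ∃ g : ℂ → ℂ, ∀ᶠ x in 𝓝 z, g (phi α β γ x) = x := by
  obtain ⟨d, hd, hs⟩ := hasStrictDerivAt_phi h hz hz'
  exact ⟨_, hs.eventually_left_inverse hd⟩

/-- The values with two preimages form an open set, relatively closed in the triangle; two preimages
cannot merge in the limit since `φ` is locally injective. If there were one such value, every point
would have a twin. As `z → 1 / 2` the twin also tends to `1 / 2`, against local injectivity at this
point, across which `φ` is holomorphic. -/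
lemma injOn_phi (h : Hyperbolic α β γ) : Set.InjOn (phi α β γ) upperHalf := by
  set P : Set (ℂ × ℂ) := {p | p.1 ∈ upperHalf ∧ p.2 ∈ upperHalf ∧ p.1 ≠ p.2 ∧
    phi α β γ p.1 = phi α β γ p.2} with hP
  have hcont : ∀ z ∈ upperHalf, ContinuousAt (phi α β γ) z := fun z hz =>
    (differentiableOn_phi h).continuousOn.continuousAt (isOpen_upperHalf.mem_nhds hz)
  have hopen : IsOpen ((fun p : ℂ × ℂ => phi α β γ p.1) '' P) := by
    rw [isOpen_iff_mem_nhds]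
    rintro _ ⟨⟨z, z'⟩, ⟨hz, hz', hne, he⟩, rfl⟩
    dsimp only at hz hz' hne he ⊢
    obtain ⟨V, V', hV, hV', hzV, hzV', hd⟩ := t2_separation hne
    have h1 : phi α β γ '' (V ∩ upperHalf) ∈ 𝓝 (phi α β γ z) := by
      rw [← map_phi_nhds h hz]
      exact image_mem_map ((hV.inter isOpen_upperHalf).mem_nhds ⟨hzV, hz⟩)
    have h2 : phi α β γ '' (V' ∩ upperHalf) ∈ 𝓝 (phi α β γ z) := by
      rw [he, ← map_phi_nhds h hz']
      exact image_mem_map ((hV'.inter isOpen_upperHalf).mem_nhds ⟨hzV', hz'⟩)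
    filter_upwards [h1, h2]
    rintro w ⟨a, ⟨haV, haH⟩, rfl⟩ ⟨b, ⟨hbV, hbH⟩, hb⟩
    exact ⟨(a, b), ⟨haH, hbH, fun hab => Set.disjoint_left.mp hd haV ((show a = b from hab) ▸ hbV),
      hb.symm⟩, rfl⟩
  by_contra hinj
  have hne : P.Nonempty := by
    simp only [Set.InjOn] at hinj
    push Not at hinj
    obtain ⟨z, hz, z', hz', he, hzz⟩ := hinj
    exact ⟨(z, z'), hz, hz', hzz, he⟩
  have hsub : tri α β γ ⊆ (fun p : ℂ × ℂ => phi α β γ p.1) '' P := by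
    refine (isPreconnected_tri h).subset_of_closure_inter_subset hopen ?_ ?_
    · obtain ⟨p, hp⟩ := hne
      exact ⟨_, phi_mem_tri h hp.1, p, hp, rfl⟩
    · rintro w ⟨hw, hwt⟩
      rw [mem_closure_iff_clusterPt, ← map_principal] at hw
      obtain ⟨U, hU, hUw⟩ := mapClusterPt_iff_ultrafilter.mp hw
      have hUP : P ∈ U := le_principal_iff.mp hU
      -- Each of the two preimages stays in the interior: a limit at the boundary would put `w`
      -- outside the triangle.
      have aux : ∀ f : ℂ × ℂ → ℂ, (∀ p ∈ P, f p ∈ upperHalf ∧ phi α β γ (f p) = phi α β γ p.1) →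
          ∃ z ∈ upperHalf, Tendsto f U (𝓝 z) ∧ phi α β γ z = w := by
        intro f hf
        have hfU : upperHalf ∈ U.map f :=
          Ultrafilter.mem_map.mpr (Filter.mem_of_superset hUP fun p hp => (hf p hp).1)
        have hft : Tendsto (phi α β γ) (U.map f : Ultrafilter ℂ) (𝓝 w) := by
          rw [Ultrafilter.coe_map, tendsto_map'_iff]
          refine hUw.congr' ?_
          filter_upwards [hUP] with p hp
          exact (hf p hp).2.symm
        rcases boundaryLimit h (U.map f) hfU with ⟨z, hz, hUz⟩ | ⟨w', hw', hb⟩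
        · exact ⟨z, hz, hUz, tendsto_nhds_unique ((hcont z hz).tendsto.mono_left hUz) hft⟩
        · rw [tendsto_nhds_unique hft hw'] at hwt
          exact absurd hwt (hb.notMem_tri h)
      obtain ⟨z, hz, hUz, hzw⟩ := aux Prod.fst fun p hp => ⟨hp.1, rfl⟩
      obtain ⟨z', hz', hUz', hzw'⟩ := aux Prod.snd fun p hp => ⟨hp.2.1, hp.2.2.2.symm⟩
      by_cases hzz : z = z'
      · subst hzz
        obtain ⟨g, hg⟩ := eventually_injective_phi h (mem_slitPlane_of_mem_upperHalf hz)
          (mem_cutPlane_of_mem_upperHalf hz)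
        have h3 : ∀ᶠ p in (U : Filter (ℂ × ℂ)), False := by
          filter_upwards [hUz.eventually hg, hUz'.eventually hg, hUP] with p h1 h2 hp
          exact hp.2.2.1 (by rw [← h1, ← h2, hp.2.2.2])
        exact absurd h3.exists (by simp)
      · exact ⟨(z, z'), ⟨hz, hz', hzz, hzw.trans hzw'.symm⟩, hzw⟩
  have hch : ∀ z ∈ upperHalf, ∃ z' ∈ upperHalf, z' ≠ z ∧ phi α β γ z' = phi α β γ z := by
    intro z hz
    obtain ⟨⟨a, b⟩, ⟨ha, hb, hab, he⟩, hp⟩ := hsub (phi_mem_tri h hz)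
    dsimp only at ha hb hab he hp
    by_cases haz : a = z
    · exact ⟨b, hb, fun hbz => hab (haz.trans hbz.symm), he.symm.trans hp⟩
    · exact ⟨a, ha, haz, hp⟩
  choose! t htH htne hte using hch
  have hhalf : (1 / 2 : ℝ) < 1 := by norm_num
  have hself : ∀ᶠ z in 𝓝[upperHalf] ((1 / 2 : ℝ) : ℂ), z ∈ upperHalf := self_mem_nhdsWithin
  have ht : Tendsto (phi α β γ) (map t (𝓝[upperHalf] ((1 / 2 : ℝ) : ℂ)))
      (𝓝 (edge α β γ (1 / 2) : ℂ)) := by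
    rw [tendsto_map'_iff]
    refine ((tendsto_phi_edge h (by norm_num) hhalf).mono_left nhdsWithin_le_nhds).congr' ?_
    filter_upwards [hself] with z hz
    exact (hte z hz).symm
  have ht' : Tendsto t (𝓝[upperHalf] ((1 / 2 : ℝ) : ℂ)) (𝓝 ((1 / 2 : ℝ) : ℂ)) := by
    refine le_nhds_of_tendsto_edge h ?_ (by norm_num) hhalf ht
    exact Filter.mem_map.mpr (hself.mono htH)
  obtain ⟨g, hg⟩ := eventually_injective_phi h (ofReal_mem_slitPlane' (x := 1 / 2) (by norm_num))
    (ofReal_mem_cutPlane hhalf)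
  have hbot : (𝓝[upperHalf] ((1 / 2 : ℝ) : ℂ)).NeBot := by
    rw [← mem_closure_iff_nhdsWithin_neBot, upperHalf, closure_setOfPred_lt_im]
    simp
  have h3 : ∀ᶠ z in 𝓝[upperHalf] ((1 / 2 : ℝ) : ℂ), False := by
    filter_upwards [ht'.eventually hg, nhdsWithin_le_nhds hg, hself] with z h1 h2 hz
    exact htne z hz (by rw [← h1, hte z hz, h2])
  exact absurd h3.exists (by simp)

lemma bijOn_phi (h : Hyperbolic α β γ) : Set.BijOn (phi α β γ) upperHalf (tri α β γ) :=
  ⟨fun _ hz => phi_mem_tri h hz, injOn_phi h, tri_subset_image_phi h⟩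

/-- Points of the upper half plane with small image are close to `0`. -/
lemma exists_norm_lt_of_norm_phi_lt (h : Hyperbolic α β γ) {ε : ℝ} (hε : 0 < ε) :
    ∃ r > 0, ∀ z ∈ upperHalf, ‖phi α β γ z‖ < r → ‖z‖ < ε := by
  have h1 : comap (phi α β γ) (𝓝 0) ⊓ 𝓟 upperHalf ≤ 𝓝 ((0 : ℝ) : ℂ) := by
    refine le_nhds_of_tendsto_edge h (mem_inf_of_right (mem_principal_self _)) le_rfl one_pos ?_
    rw [edge_zero h, ofReal_zero]
    exact tendsto_comap.mono_left inf_le_left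
  have h2 : Metric.ball (0 : ℂ) ε ∈ comap (phi α β γ) (𝓝 0) ⊓ 𝓟 upperHalf :=
    h1 (by simpa using Metric.ball_mem_nhds (0 : ℂ) hε)
  rw [mem_inf_principal, mem_comap] at h2
  obtain ⟨s, hs, hss⟩ := h2
  obtain ⟨r, hr, hrs⟩ := Metric.mem_nhds_iff.mp hs
  refine ⟨r, hr, fun z hz hzr => ?_⟩
  have := hss (show phi α β γ z ∈ s from hrs (by simpa using hzr)) hz
  simpa using this

/-! ### The coordinates about the three vertices -/

/-- The inverse of `stepS`. -/
def stepInv (α β γ : ℝ) (v : ℂ) : ℂ := rot α * mob (nu β γ α) (nu α β γ) (oneRadius β γ α) v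

lemma vertB_eq (α β γ : ℝ) : vertB α β γ = rot α * (infRadius α β γ : ℂ) := by
  rw [vertB, rot, mul_comm]

lemma norm_vertB_lt (h : Hyperbolic α β γ) : ‖vertB α β γ‖ < (nu α β γ)⁻¹ := by
  rw [vertB_eq, norm_rot_mul_ofReal, abs_of_pos (infRadius_pos h)]
  exact infRadius_lt h

lemma norm_oneRadius_lt (h : Hyperbolic α β γ) : ‖(oneRadius α β γ : ℂ)‖ < (nu α β γ)⁻¹ := by
  rw [norm_real, Real.norm_of_nonneg (oneRadius_pos h).le]
  exact oneRadius_lt h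

lemma norm_stepS_lt (h : Hyperbolic α β γ) {w : ℂ} (hw : ‖w‖ < (nu α β γ)⁻¹) :
    ‖stepS α β γ w‖ < (nu β γ α)⁻¹ := by
  rw [stepS_eq]
  exact norm_mob_lt (nu_pos h) (nu_pos h.rotate) (infRadius_pos h).le (nu_mul_infRadius_lt_one h)
    (by rwa [norm_conj_rot_mul])

lemma norm_stepInv_lt (h : Hyperbolic α β γ) {w : ℂ} (hw : ‖w‖ < (nu β γ α)⁻¹) :
    ‖stepInv α β γ w‖ < (nu α β γ)⁻¹ := by
  rw [stepInv, norm_mul, norm_rot, one_mul]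
  exact norm_mob_lt (nu_pos h.rotate) (nu_pos h) (oneRadius_pos h.rotate).le
    (nu_mul_oneRadius_lt_one h.rotate) hw

lemma stepInv_stepS (h : Hyperbolic α β γ) {w : ℂ} (hw : ‖w‖ < (nu α β γ)⁻¹) :
    stepInv α β γ (stepS α β γ w) = w := by
  have hn := mob_den_ne_zero (nu_pos h) (infRadius_pos h).le (nu_mul_infRadius_lt_one h)
    (x := conj (rot α) * w) (by rwa [norm_conj_rot_mul])
  have h1 : oneRadius β γ α = nu α β γ / nu β γ α * infRadius α β γ := rfl
  rw [stepInv, stepS_eq, h1, mob_mob (nu_pos h) (nu_pos h.rotate) (infRadius_pos h).le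
    (nu_mul_infRadius_lt_one h) hn, ← mul_assoc, rot_mul_conj, one_mul]

lemma stepS_stepInv (h : Hyperbolic α β γ) {v : ℂ} (hv : ‖v‖ < (nu β γ α)⁻¹) :
    stepS α β γ (stepInv α β γ v) = v := by
  have hn := mob_den_ne_zero (nu_pos h.rotate) (oneRadius_pos h.rotate).le
    (nu_mul_oneRadius_lt_one h.rotate) hv
  rw [stepInv, stepS_eq, conj_rot_mul_rot_mul, ← infRadius_eq h, mob_mob (nu_pos h.rotate)
    (nu_pos h) (oneRadius_pos h.rotate).le (nu_mul_oneRadius_lt_one h.rotate) hn]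

lemma differentiableOn_stepS (h : Hyperbolic α β γ) :
    DifferentiableOn ℂ (stepS α β γ) (Metric.ball 0 (nu α β γ)⁻¹) := by
  intro w hw
  rw [mem_ball_zero_iff] at hw
  have hn := mob_den_ne_zero (nu_pos h) (infRadius_pos h).le (nu_mul_infRadius_lt_one h)
    (x := conj (rot α) * w) (by rwa [norm_conj_rot_mul])
  rw [show stepS α β γ = fun w => mob (nu α β γ) (nu β γ α) (infRadius α β γ)
        (conj (rot α) * w) from funext (stepS_eq α β γ)]
  have h2 : DifferentiableAt ℂ (fun w => conj (rot α) * w) w := by fun_prop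
  exact ((differentiableAt_mob hn).comp w h2).differentiableWithinAt

lemma stepS_zero (α β γ : ℝ) : stepS α β γ 0 = (oneRadius β γ α : ℂ) := by
  rw [stepS_eq, mul_zero, mob_zero, oneRadius]

lemma stepS_vertB (α β γ : ℝ) : stepS α β γ (vertB α β γ) = 0 := by
  rw [stepS_eq, vertB_eq, conj_rot_mul_rot_mul, mob_self]

lemma stepInv_zero (h : Hyperbolic α β γ) : stepInv α β γ 0 = vertB α β γ := by
  rw [stepInv, mob_zero, infRadius_eq h, vertB_eq]

/-- Three steps around the triangle lead back to the start. -/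
lemma stepS_stepS_stepS (h : Hyperbolic α β γ) {w : ℂ} (hw : ‖w‖ < (nu α β γ)⁻¹) :
    stepS γ α β (stepS β γ α (stepS α β γ w)) = w := by
  have hI : I ∈ upperHalf := by simp [upperHalf]
  have m1 : Set.MapsTo (stepS α β γ) (Metric.ball 0 (nu α β γ)⁻¹) (Metric.ball 0 (nu β γ α)⁻¹) :=
    fun x hx => by
      rw [mem_ball_zero_iff] at hx ⊢
      exact norm_stepS_lt h hx
  have m2 : Set.MapsTo (stepS β γ α) (Metric.ball 0 (nu β γ α)⁻¹) (Metric.ball 0 (nu γ α β)⁻¹) :=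
    fun x hx => by
      rw [mem_ball_zero_iff] at hx ⊢
      exact norm_stepS_lt h.rotate hx
  have hd : DifferentiableOn ℂ (fun w => stepS γ α β (stepS β γ α (stepS α β γ w)))
      (Metric.ball 0 (nu α β γ)⁻¹) :=
    (differentiableOn_stepS h.rotate.rotate).comp
      ((differentiableOn_stepS h.rotate).comp (differentiableOn_stepS h) m1) (m2.comp m1)
  have ha := hd.analyticOnNhd Metric.isOpen_ball
  have hpI : phi α β γ I ∈ Metric.ball 0 (nu α β γ)⁻¹ := by
    rw [mem_ball_zero_iff]; exact norm_phi_lt h hI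
  -- On the open set of values of `φ` the three steps correspond to `shiftB`, which has order three;
  -- the identity theorem extends this to the disc.
  have he : (fun w => stepS γ α β (stepS β γ α (stepS α β γ w))) =ᶠ[𝓝 (phi α β γ I)] id := by
    filter_upwards [(isOpen_image_phi h).mem_nhds ⟨I, hI, rfl⟩]
    rintro _ ⟨z, hz, rfl⟩
    have hz1 := shiftB_mem z hz
    have hz2 := shiftB_mem _ hz1
    rw [← phi_shiftB h hz, ← phi_shiftB h.rotate hz1, ← phi_shiftB h.rotate.rotate hz2,
      ← shiftC_eq (z := z) (by simpa using ne_ofReal_of_mem hz 1),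
      shiftB_shiftC (by simpa using ne_ofReal_of_mem hz 0), id]
  exact ha.eqOn_of_preconnected_of_eventuallyEq analyticOnNhd_id
    (convex_ball 0 _).isPreconnected hpI he (by simpa using hw)

/-- The coordinate about `φ(1)` is thereby reached in one backward step as well as in two forward
steps. -/
lemma stepInv_eq_stepS_stepS (h : Hyperbolic α β γ) {w : ℂ} (hw : ‖w‖ < (nu α β γ)⁻¹) :
    stepInv γ α β w = stepS β γ α (stepS α β γ w) := by
  conv_lhs => rw [← stepS_stepS_stepS h hw]
  exact stepInv_stepS h.rotate.rotate (norm_stepS_lt h.rotate (norm_stepS_lt h hw))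

lemma stepS_oneRadius (h : Hyperbolic α β γ) :
    stepS α β γ (oneRadius α β γ : ℂ) = vertB β γ α := by
  have h1 := stepInv_eq_stepS_stepS h.rotate.rotate (w := 0) (by simpa using nu_pos h.rotate.rotate)
  rwa [stepS_zero, stepInv_zero h.rotate, eq_comm] at h1

lemma stepS_im_pos_iff (h : Hyperbolic α β γ) {w : ℂ} (hw : ‖w‖ < (nu α β γ)⁻¹) :
    0 < (stepS α β γ w).im ↔ (conj (rot α) * w).im < 0 := by
  obtain ⟨q, hq, he⟩ := mob_im (nu_pos h) (nu_pos h.rotate) (infRadius_pos h).le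
    (nu_mul_infRadius_lt_one h) (mob_den_ne_zero (nu_pos h) (infRadius_pos h).le
      (nu_mul_infRadius_lt_one h) (x := conj (rot α) * w) (by rwa [norm_conj_rot_mul]))
  rw [stepS_eq, he, neg_pos]
  exact ⟨fun hh => by
    by_contra! hc
    exact hh.not_ge (mul_nonneg hq.le hc), mul_neg_of_pos_of_neg hq⟩

/-- The triangle is cut out by three half planes, one in each of the coordinates. -/
lemma mem_tri_iff (h : Hyperbolic α β γ) {w : ℂ} : w ∈ tri α β γ ↔ ‖w‖ < (nu α β γ)⁻¹ ∧ 0 < w.im ∧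
    0 < (stepS α β γ w).im ∧ 0 < (stepS β γ α (stepS α β γ w)).im := by
  refine and_congr_right fun hw => and_congr_right fun _ => and_congr ?_ ?_
  · exact (stepS_im_pos_iff h hw).symm
  · exact (stepS_im_pos_iff h.rotate (norm_stepS_lt h hw)).symm

lemma stepS_mem_tri_iff (h : Hyperbolic α β γ) {w : ℂ} (hw : ‖w‖ < (nu α β γ)⁻¹) :
    stepS α β γ w ∈ tri β γ α ↔ w ∈ tri α β γ := by
  rw [mem_tri_iff h, mem_tri_iff h.rotate, stepS_stepS_stepS h hw]
  have := norm_stepS_lt h hw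
  tauto

/-! ### The hyperbolic triangle -/

lemma openSector_comm (u v : ℂ) : openSector u v = openSector v u := by
  ext w
  constructor <;> rintro ⟨s, t, hs, ht, rfl⟩ <;> exact ⟨t, s, ht, hs, add_comm _ _⟩

lemma mul_mem_openSector_iff {k : ℂ} (hk : k ≠ 0) {u v w : ℂ} :
    k * w ∈ openSector (k * u) (k * v) ↔ w ∈ openSector u v := by
  refine exists_congr fun s => exists_congr fun t => and_congr_right fun _ =>
    and_congr_right fun _ => ?_
  rw [← mul_right_inj' hk (b := w), mul_add, mul_left_comm k, mul_left_comm k]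

lemma mem_openSector_rot_iff {θ p q : ℝ} (hθ : 0 < Real.sin (Real.pi * θ)) (hp : 0 < p)
    (hq : 0 < q) {w : ℂ} :
    w ∈ openSector (p : ℂ) (rot θ * q) ↔ 0 < w.im ∧ (conj (rot θ) * w).im < 0 := by
  have hcs := Real.sin_sq_add_cos_sq (Real.pi * θ)
  constructor
  · rintro ⟨s, t, hs, ht, rfl⟩
    constructor
    · rw [add_im, im_ofReal_mul, im_ofReal_mul, im_rot_mul_ofReal, ofReal_im]
      positivity
    · rw [mul_add, mul_left_comm _ (s : ℂ), mul_left_comm _ (t : ℂ), conj_rot_mul_rot_mul, add_im, im_ofReal_mul,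
        im_ofReal_mul, im_conj_rot_mul_ofReal, ofReal_im]
      have : 0 < s * (p * Real.sin (Real.pi * θ)) := by positivity
      linarith
  · rintro ⟨h1, h2⟩
    rw [mul_im, conj_re, conj_im, rot_re, rot_im] at h2
    -- These are the coefficients of `w` in the real basis `p`, `rot θ * q`, by Cramer's rule.
    refine ⟨(w.re * Real.sin (Real.pi * θ) - w.im * Real.cos (Real.pi * θ)) /
      (p * Real.sin (Real.pi * θ)), w.im / (q * Real.sin (Real.pi * θ)), ?_, by positivity, ?_⟩
    · apply div_pos _ (by positivity)
      linarith
    · apply Complex.ext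
      · rw [add_re, re_ofReal_mul, re_ofReal_mul, ofReal_re, mul_comm (rot θ), re_ofReal_mul, rot_re]
        field_simp
        ring
      · rw [add_im, im_ofReal_mul, im_ofReal_mul, im_rot_mul_ofReal, ofReal_im]
        field_simp
        ring

lemma angle_rot {θ p q : ℝ} (h0 : 0 ≤ θ) (h1 : θ ≤ 1) (hp : 0 < p) (hq : 0 < q) {k : ℂ}
    (hk : k ≠ 0) {u v : ℂ} (hu : k * u = p) (hv : k * v = rot θ * q) :
    InnerProductGeometry.angle u v = Real.pi * θ := by
  have hp' : (p : ℂ) ≠ 0 := ofReal_ne_zero.mpr hp.ne'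
  have hq' : (q : ℂ) ≠ 0 := ofReal_ne_zero.mpr hq.ne'
  have hu0 : u ≠ 0 := by
    rintro rfl
    rw [mul_zero] at hu
    exact hp' hu.symm
  have hv0 : v ≠ 0 := by
    rintro rfl
    rw [mul_zero] at hv
    exact mul_ne_zero (rot_ne_zero θ) hq' hv.symm
  have e : v / u = ((q / p : ℝ) : ℂ) * (cos ((Real.pi * θ : ℝ) : ℂ) +
      sin ((Real.pi * θ : ℝ) : ℂ) * I) := by
    rw [← mul_div_mul_left v u hk, hu, hv, rot, mul_comm I, exp_mul_I]
    push_cast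
    ring
  rw [InnerProductGeometry.angle_comm, Complex.angle_eq_abs_arg hv0 hu0, e,
    arg_mul_cos_add_sin_mul_I (div_pos hq hp)]
  · rw [abs_of_nonneg (mul_nonneg Real.pi_pos.le h0)]
  · constructor
    · have := Real.pi_pos
      nlinarith
    · have := Real.pi_pos
      nlinarith

lemma discMove_zero (ν : ℝ) (w : ℂ) : discMove ν 0 w = w := by simp [discMove]

/-- The factor between a coordinate and `discMove`. -/
lemma coordS_eq {ν ν' : ℝ} (hν : 0 < ν) (hν' : 0 < ν') (t : ℝ) (d : ℂ) :
    ∃ k : ℂ, k ≠ 0 ∧ ∀ w, coordS ν ν' t d w = k * discMove ν d w :=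
  ⟨((ν / ν' : ℝ) : ℂ) * exp (I * t),
    mul_ne_zero (ofReal_ne_zero.mpr (div_pos hν hν').ne') (exp_ne_zero _), fun w => by
      rw [coordS, mul_assoc]⟩

lemma stepInv_eq_coordS (α β γ : ℝ) :
    stepInv γ α β = coordS (nu α β γ) (nu γ α β) (Real.pi + Real.pi * γ) (oneRadius α β γ : ℂ) := by
  funext w
  have : exp (I * ((Real.pi + Real.pi * γ : ℝ) : ℂ)) = -rot γ := by
    rw [ofReal_add, mul_add, exp_add, mul_comm I, exp_pi_mul_I, rot, neg_one_mul]
  rw [stepInv, coordS, this, mob, discMove, conj_ofReal]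
  ring

lemma exists_stepS_eq (h : Hyperbolic α β γ) :
    ∃ k : ℂ, k ≠ 0 ∧ ∀ w, stepS α β γ w = k * discMove (nu α β γ) (vertB α β γ) w :=
  coordS_eq (nu_pos h) (nu_pos h.rotate) _ _

lemma exists_stepInv_eq (h : Hyperbolic α β γ) :
    ∃ k : ℂ, k ≠ 0 ∧ ∀ w, stepInv γ α β w = k * discMove (nu α β γ) (oneRadius α β γ : ℂ) w := by
  rw [stepInv_eq_coordS]
  exact coordS_eq (nu_pos h) (nu_pos h.rotate.rotate) _ _

lemma stepInv_vertB (h : Hyperbolic α β γ) :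
    stepInv γ α β (vertB α β γ) = (oneRadius γ α β : ℂ) := by
  rw [stepInv_eq_stepS_stepS h (norm_vertB_lt h), stepS_vertB, stepS_zero]

/-- In the coordinate about a vertex each sector is an intersection of two half planes, bounded by
the sides through that vertex. Every side occurs at both of its ends, so six conditions reduce to
three. -/
lemma hypTriangle_eq (h : Hyperbolic α β γ) :
    hypTriangle (nu α β γ) 0 (vertB α β γ) (oneRadius α β γ : ℂ) = tri α β γ := by
  have hB := h.rotate
  have hC := hB.rotate
  obtain ⟨k, hk, hkS⟩ := exists_stepS_eq h
  obtain ⟨l, hl, hlS⟩ := exists_stepInv_eq h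
  ext w
  simp only [hypTriangle, tri, Set.mem_ofPred_eq, discMove_zero]
  refine and_congr_right fun hw => ?_
  have hBw := norm_stepS_lt h hw
  have hCw := norm_stepS_lt hB hBw
  rw [← mul_mem_openSector_iff hk (w := discMove _ _ w),
    ← mul_mem_openSector_iff hl (w := discMove _ (oneRadius α β γ : ℂ) w)]
  rw [← hkS, ← hkS, ← hkS, ← hlS, ← hlS, ← hlS]
  rw [stepS_zero, stepS_oneRadius h, stepInv_zero hC, stepInv_vertB h,
    openSector_comm (vertB β γ α), openSector_comm (vertB γ α β), openSector_comm (vertB α β γ),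
    vertB_eq, vertB_eq, vertB_eq,
    mem_openSector_rot_iff h.sin_pos (oneRadius_pos h) (infRadius_pos h),
    mem_openSector_rot_iff hB.sin_pos (oneRadius_pos hB) (infRadius_pos hB),
    mem_openSector_rot_iff hC.sin_pos (oneRadius_pos hC) (infRadius_pos hC),
    stepInv_eq_stepS_stepS h hw, ← stepS_im_pos_iff h hw, ← stepS_im_pos_iff hB hBw,
    ← stepS_im_pos_iff hC hCw, stepS_stepS_stepS h hw]
  tauto

lemma hypAngle_zero (h : Hyperbolic α β γ) :
    hypAngle (nu α β γ) 0 (vertB α β γ) (oneRadius α β γ : ℂ) = Real.pi * α := by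
  rw [hypAngle, InnerProductGeometry.angle_comm, discMove_zero, discMove_zero]
  exact angle_rot h.pos₁.le (by linarith [h.pos₂, h.pos₃, h.sum_lt]) (oneRadius_pos h)
    (infRadius_pos h) one_ne_zero (one_mul _) (by rw [one_mul, vertB_eq])

lemma hypAngle_vertB (h : Hyperbolic α β γ) :
    hypAngle (nu α β γ) (vertB α β γ) (oneRadius α β γ : ℂ) 0 = Real.pi * β := by
  obtain ⟨k, hk, hkS⟩ := exists_stepS_eq h
  rw [hypAngle, InnerProductGeometry.angle_comm]
  exact angle_rot h.pos₂.le (by linarith [h.pos₁, h.pos₃, h.sum_lt]) (oneRadius_pos h.rotate)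
    (infRadius_pos h.rotate) hk (by rw [← hkS, stepS_zero])
    (by rw [← hkS, stepS_oneRadius h, vertB_eq])

lemma hypAngle_oneRadius (h : Hyperbolic α β γ) :
    hypAngle (nu α β γ) (oneRadius α β γ : ℂ) 0 (vertB α β γ) = Real.pi * γ := by
  obtain ⟨k, hk, hkS⟩ := exists_stepInv_eq h
  rw [hypAngle, InnerProductGeometry.angle_comm]
  exact angle_rot h.pos₃.le (by linarith [h.pos₁, h.pos₂, h.sum_lt])
    (oneRadius_pos h.rotate.rotate) (infRadius_pos h.rotate.rotate) hk
    (by rw [← hkS, stepInv_vertB h])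
    (by rw [← hkS, stepInv_zero h.rotate.rotate, vertB_eq])

/-! ### Analytic germs with rational Taylor coefficients -/

/-- The function `f` is analytic at `0`, and its derivatives at `0` up to order `n` are
rational. -/
def RatJet : ℕ → (ℂ → ℂ) → Prop
  | 0, f => AnalyticAt ℂ f 0 ∧ ∃ q : ℚ, f 0 = q
  | n + 1, f => (AnalyticAt ℂ f 0 ∧ ∃ q : ℚ, f 0 = q) ∧ RatJet n (deriv f)

namespace RatJet

variable {f g : ℂ → ℂ} {n : ℕ}

lemma pred : ∀ {n : ℕ} {f : ℂ → ℂ}, RatJet (n + 1) f → RatJet n f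
  | 0, _, h => h.1
  | _ + 1, _, h => ⟨h.1, pred h.2⟩

lemma congr : ∀ {n : ℕ} {f g : ℂ → ℂ}, RatJet n f → f =ᶠ[𝓝 0] g → RatJet n g
  | 0, _, _, h, e => ⟨h.1.congr e, by rw [← e.eq_of_nhds]; exact h.2⟩
  | _ + 1, _, _, h, e => ⟨⟨h.1.1.congr e, by rw [← e.eq_of_nhds]; exact h.1.2⟩, congr h.2 e.deriv⟩

lemma const (q : ℚ) : ∀ n : ℕ, RatJet n fun _ => (q : ℂ)
  | 0 => ⟨analyticAt_const, q, rfl⟩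
  | n + 1 => ⟨⟨analyticAt_const, q, rfl⟩, (const 0 n).congr (by simp [deriv_const'])⟩

lemma id' : ∀ n : ℕ, RatJet n fun z => z
  | 0 => ⟨analyticAt_id, 0, by simp⟩
  | n + 1 => ⟨⟨analyticAt_id, 0, by simp⟩, (const 1 n).congr (by simp [deriv_id''])⟩

lemma add : ∀ {n : ℕ} {f g : ℂ → ℂ}, RatJet n f → RatJet n g → RatJet n fun z => f z + g z
  | 0, _, _, ⟨hf, q, hq⟩, ⟨hg, r, hr⟩ => ⟨hf.add hg, q + r, by simp [hq, hr]⟩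
  | _ + 1, _, _, ⟨⟨hf, q, hq⟩, hf'⟩, ⟨⟨hg, r, hr⟩, hg'⟩ => by
    refine ⟨⟨hf.add hg, q + r, by simp [hq, hr]⟩, (hf'.add hg').congr ?_⟩
    filter_upwards [hf.eventually_analyticAt, hg.eventually_analyticAt] with z h1 h2
    exact (h1.differentiableAt.hasDerivAt.add h2.differentiableAt.hasDerivAt).deriv.symm

lemma mul : ∀ {n : ℕ} {f g : ℂ → ℂ}, RatJet n f → RatJet n g → RatJet n fun z => f z * g z
  | 0, _, _, ⟨hf, q, hq⟩, ⟨hg, r, hr⟩ => ⟨hf.mul hg, q * r, by simp [hq, hr]⟩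
  | _ + 1, f, g, ⟨⟨hf, q, hq⟩, hf'⟩, ⟨⟨hg, r, hr⟩, hg'⟩ => by
    have h1 : RatJet _ f := pred ⟨⟨hf, q, hq⟩, hf'⟩
    have h2 : RatJet _ g := pred ⟨⟨hg, r, hr⟩, hg'⟩
    refine ⟨⟨hf.mul hg, q * r, by simp [hq, hr]⟩,
      ((hf'.mul h2).add (h1.mul hg')).congr ?_⟩
    filter_upwards [hf.eventually_analyticAt, hg.eventually_analyticAt] with z h1 h2
    exact (h1.differentiableAt.hasDerivAt.mul h2.differentiableAt.hasDerivAt).deriv.symm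

lemma pow (hf : RatJet n f) : ∀ k : ℕ, RatJet n fun z => f z ^ k
  | 0 => by simpa using const 1 n
  | k + 1 => by simpa only [pow_succ] using (pow hf k).mul hf

lemma inv : ∀ {n : ℕ} {f : ℂ → ℂ}, RatJet n f → f 0 ≠ 0 → RatJet n fun z => (f z)⁻¹
  | 0, _, ⟨hf, q, hq⟩, h0 => ⟨hf.inv h0, q⁻¹, by simp [hq]⟩
  | n + 1, f, ⟨⟨hf, q, hq⟩, hf'⟩, h0 => by
    have h1 : RatJet n fun z => (f z)⁻¹ := (pred ⟨⟨hf, q, hq⟩, hf'⟩).inv h0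
    refine ⟨⟨hf.inv h0, q⁻¹, by simp [hq]⟩,
      ((const (-1) n).mul (hf'.mul (h1.mul h1))).congr ?_⟩
    filter_upwards [hf.eventually_analyticAt, hf.continuousAt.eventually_ne h0] with z h2 h3
    rw [(h2.differentiableAt.hasDerivAt.fun_inv h3).deriv]
    push_cast
    field_simp

/-- Composition with a function which solves an autonomous differential equation with rational
Taylor coefficients. -/
lemma comp {k q : ℂ → ℂ} (hk : AnalyticAt ℂ k 0) (hk0 : k 0 = 0)
    (hk' : ∀ᶠ z in 𝓝 0, deriv k z = q (k z)) (hq : ∀ n, RatJet n q) :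
    ∀ {n : ℕ} {f : ℂ → ℂ}, RatJet n f → RatJet n fun z => f (k z)
  | 0, f, ⟨hf, r, hr⟩ => ⟨(hk0.symm ▸ hf : AnalyticAt ℂ f (k 0)).comp hk, r, by simp [hk0, hr]⟩
  | n + 1, f, ⟨⟨hf, r, hr⟩, hf'⟩ => by
    -- Since `(f ∘ k)' = (f' * q) ∘ k`, the induction needs rational derivatives of `f` and `q`
    -- only, never those of `k`.
    refine ⟨⟨(hk0.symm ▸ hf : AnalyticAt ℂ f (k 0)).comp hk, r, by simp [hk0, hr]⟩,
      (comp hk hk0 hk' hq (hf'.mul (hq n))).congr ?_⟩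
    have h1 : ∀ᶠ z in 𝓝 0, AnalyticAt ℂ f (k z) := by
      have := hf.eventually_analyticAt
      rw [← hk0] at this
      exact hk.continuousAt.eventually this
    filter_upwards [h1, hk.eventually_analyticAt, hk'] with z h1 h2 h3
    rw [← h3]
    exact (HasDerivAt.comp z h1.differentiableAt.hasDerivAt h2.differentiableAt.hasDerivAt).deriv.symm

lemma exists_iteratedDeriv : ∀ {n : ℕ} {f : ℂ → ℂ}, RatJet n f → ∃ q : ℚ, iteratedDeriv n f 0 = q
  | 0, _, h => by simpa using h.2
  | n + 1, _, h => by
    rw [iteratedDeriv_succ']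
    exact exists_iteratedDeriv h.2

lemma deriv (hf : ∀ n, RatJet n f) (n : ℕ) : RatJet n (deriv f) := (hf (n + 1)).2

end RatJet

/-- The Taylor series with rational coefficients. -/
lemma exists_rational_taylor {f : ℂ → ℂ} (hf : ∀ n, RatJet n f) :
    ∃ c : ℕ → ℚ, (c 0 : ℂ) = f 0 ∧ (c 1 : ℂ) = deriv f 0 ∧ ∃ r > 0, ∀ u : ℂ, ‖u‖ < r →
      HasSum (fun i => (c i : ℂ) * u ^ i) (f u) := by
  choose q hq using fun n => (hf n).exists_iteratedDeriv
  refine ⟨fun n => (n.factorial : ℚ)⁻¹ * q n, ?_, ?_, ?_⟩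
  · simp [← hq]
  · simp [← hq]
  · obtain ⟨r, hr, ha⟩ := Metric.eventually_nhds_iff_ball.mp (hf 0).1.eventually_analyticAt
    refine ⟨r, hr, fun u hu => ?_⟩
    have hd : DifferentiableOn ℂ f (Metric.ball 0 r) := fun z hz =>
      (ha z hz).differentiableAt.differentiableWithinAt
    have := Complex.hasSum_taylorSeries_on_ball hd (z := u) (by simpa using hu)
    refine this.congr_fun ?_
    intro n
    rw [hq]
    push_cast
    simp [mul_comm, mul_left_comm]

/-! ### Expansions in the uniformizing coordinate -/

/-- Differentiation multiplies by `a b / c` and raises all parameters by one, so rational parameters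
stay rational. -/
lemma ratJet_gaussF {n : ℕ} : ∀ {a b c : ℝ}, 0 < a → a < c → (∃ q : ℚ, a = q) → (∃ q : ℚ, b = q) →
    (∃ q : ℚ, c = q) → RatJet n (gaussF a b c) := by
  have han : ∀ {a b c : ℝ}, 0 < a → a < c → AnalyticAt ℂ (gaussF a b c) 0 ∧
      ∃ q : ℚ, gaussF a b c 0 = q := by
    intro a b c ha hc
    refine ⟨?_, 1, by rw [gaussF_zero ha hc]; simp⟩
    have hd : DifferentiableOn ℂ (gaussF a b c) cutPlane := fun z hz =>
      (hasDerivAt_gaussF ha hc hz).differentiableAt.differentiableWithinAt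
    exact hd.analyticAt (isOpen_cutPlane.mem_nhds zero_mem_cutPlane)
  induction n with
  | zero => exact fun ha hc _ _ _ => han ha hc
  | succ n ih =>
    rintro a b c ha hc ⟨qa, rfl⟩ ⟨qb, rfl⟩ ⟨qc, rfl⟩
    refine ⟨han ha hc, ((RatJet.const (qa * qb / qc) n).mul (ih (a := qa + 1) (b := qb + 1)
      (c := qc + 1) (by linarith) (by linarith) ⟨qa + 1, by push_cast; rfl⟩
      ⟨qb + 1, by push_cast; rfl⟩ ⟨qc + 1, by push_cast; rfl⟩)).congr ?_⟩
    filter_upwards [isOpen_cutPlane.mem_nhds zero_mem_cutPlane] with z hz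
    rw [(hasDerivAt_gaussF ha hc hz).deriv]
    push_cast
    rfl

/-- The quotient of the two hypergeometric functions. -/
def quotF (α β γ : ℝ) (z : ℂ) : ℂ := numF α β γ z * (denF α β γ z)⁻¹

lemma ratJet_quotF (h : Hyperbolic α β γ) (hα : ∃ q : ℚ, α = q) (hβ : ∃ q : ℚ, β = q)
    (hγ : ∃ q : ℚ, γ = q) (n : ℕ) : RatJet n (quotF α β γ) := by
  obtain ⟨x, hx⟩ := hα
  obtain ⟨y, hy⟩ := hβ
  obtain ⟨z, hz⟩ := hγ
  have h1 : RatJet n (numF α β γ) := ratJet_gaussF h.parA'_pos h.parA'_lt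
    ⟨(1 - x + y - z) / 2 - (1 - x) + 1, by simp [parA', parA, parC, hx, hy, hz]⟩
    ⟨(1 - x - y - z) / 2 - (1 - x) + 1, by simp [parB', parB, parC, hx, hy, hz]⟩
    ⟨2 - (1 - x), by simp [parC', parC, hx]⟩
  have h2 : RatJet n (denF α β γ) := ratJet_gaussF h.parA_pos h.parA_lt
    ⟨(1 - x + y - z) / 2, by simp [parA, hx, hy, hz]⟩
    ⟨(1 - x - y - z) / 2, by simp [parB, hx, hy, hz]⟩
    ⟨1 - x, by simp [parC, hx]⟩
  exact h1.mul (h2.inv (denF_ne_zero h zero_mem_cutPlane))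

lemma quotF_zero (h : Hyperbolic α β γ) : quotF α β γ 0 = 1 := by
  simp [quotF, numF_zero h, denF_zero h]

/-- For `α = 1 / m` the power `φ ^ m` has no branch point at `0`. -/
lemma phi_pow {m : ℕ} (hm : 0 < m) (hα : α = 1 / m) (z : ℂ) :
    phi α β γ z ^ m = z * quotF α β γ z ^ m := by
  have e : (α : ℂ) = (m : ℂ)⁻¹ := by rw [hα]; push_cast; rw [one_div]
  rw [phi_eq, mul_div_assoc, mul_pow, e, cpow_nat_inv_pow _ hm.ne', quotF, div_eq_mul_inv]

/-- Expansion of a function with rational Taylor coefficients in powers of `phi ^ m`. -/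
lemma exists_expansion (h : Hyperbolic α β γ) {m : ℕ} (hm : 0 < m) (hα : α = 1 / m)
    (hβ : ∃ q : ℚ, β = q) (hγ : ∃ q : ℚ, γ = q) {g : ℂ → ℂ} (hg : ∀ n, RatJet n g) :
    ∃ c : ℕ → ℚ, (c 0 : ℂ) = g 0 ∧ (c 1 : ℂ) = deriv g 0 ∧ ∃ r > 0,
      (∀ u : ℂ, ‖u‖ < r → Summable fun i : ℕ => (c i : ℂ) * u ^ (m * i)) ∧
      ∀ z ∈ upperHalf, ‖phi α β γ z‖ < r →
        HasSum (fun i : ℕ => (c i : ℂ) * phi α β γ z ^ (m * i)) (g z) := by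
  have hG := ratJet_quotF h ⟨1 / m, by rw [hα]; push_cast; rfl⟩ hβ hγ
  set p : ℂ → ℂ := fun z => z * quotF α β γ z ^ m with hp
  have hpj : ∀ n, RatJet n p := fun n => (RatJet.id' n).mul ((hG n).pow m)
  have hpa : AnalyticAt ℂ p 0 := (hpj 0).1
  have hp0 : p 0 = 0 := by simp [hp]
  have hp1 : deriv p 0 = 1 := by
    have h1 := (hasDerivAt_id (0 : ℂ)).mul ((hG 0).1.differentiableAt.hasDerivAt.pow m)
    have h2 := h1.deriv
    simp only [id, zero_mul, add_zero, one_mul, Pi.pow_apply, quotF_zero h, one_pow] at h2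
    exact h2
  have hne : deriv p 0 ≠ 0 := by rw [hp1]; exact one_ne_zero
  -- Since `p 0 = 0` and `p' 0 = 1`, the function `φ ^ m` is a local coordinate at `0`, and `k`
  -- recovers `z` from it.
  set k := hpa.hasStrictDerivAt.localInverse _ _ _ hne with hk
  have hka : AnalyticAt ℂ k 0 := by
    have := hpa.analyticAt_localInverse hne
    rwa [hp0] at this
  have hleft : ∀ᶠ z in 𝓝 0, k (p z) = z := hpa.hasStrictDerivAt.eventually_left_inverse hne
  have hright : ∀ᶠ u in 𝓝 0, p (k u) = u := by
    have := hpa.hasStrictDerivAt.eventually_right_inverse hne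
    rwa [hp0] at this
  have hk0 : k 0 = 0 := by
    have := hleft.self_of_nhds
    rwa [hp0] at this
  have hkt : Tendsto k (𝓝 0) (𝓝 0) := by
    have := hka.continuousAt.tendsto
    rwa [hk0] at this
  have hk' : ∀ᶠ u in 𝓝 0, deriv k u = (deriv p (k u))⁻¹ := by
    filter_upwards [hkt.eventually hpa.eventually_analyticAt, hka.eventually_analyticAt,
      hright.eventually_nhds] with u h1 h2 h3
    have h4 := HasDerivAt.comp u h1.differentiableAt.hasDerivAt h2.differentiableAt.hasDerivAt
    have h5 : HasDerivAt (p ∘ k) 1 u := (hasDerivAt_id u).congr_of_eventuallyEq h3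
    exact eq_inv_of_mul_eq_one_right (h4.unique h5)
  -- The inverse solves `k' = (1 / p') ∘ k`, whose right side has rational Taylor coefficients, so
  -- `RatJet.comp` applies.
  have hfj : ∀ n, RatJet n fun u => g (k u) := fun n =>
    RatJet.comp (q := fun z => (deriv p z)⁻¹) hka hk0 hk'
      (fun n => (RatJet.deriv hpj n).inv hne) (hg n)
  obtain ⟨c, hc0, hc1, r₁, hr₁, hc⟩ := exists_rational_taylor hfj
  obtain ⟨ε, hε, hεl⟩ := Metric.eventually_nhds_iff_ball.mp hleft
  -- The relation `k (p z) = z` holds for small `z` only; smallness of `φ z` has to imply it.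
  obtain ⟨r₂, hr₂, hr₂'⟩ := exists_norm_lt_of_norm_phi_lt h hε
  -- The bound by `1` is there to give `‖u ^ m‖ ≤ ‖u‖`.
  have hsmall : ∀ u : ℂ, ‖u‖ < min (min r₁ r₂) 1 → ‖u ^ m‖ < r₁ := by
    intro u hu
    rw [lt_min_iff, lt_min_iff] at hu
    rw [norm_pow]
    exact (pow_le_of_le_one (norm_nonneg _) hu.2.le hm.ne').trans_lt hu.1.1
  refine ⟨c, by rw [hc0, hk0], ?_, min (min r₁ r₂) 1, lt_min (lt_min hr₁ hr₂) one_pos, ?_, ?_⟩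
  · have h1 : HasDerivAt g (deriv g 0) (k 0) := by
      rw [hk0]
      exact (hg 0).1.differentiableAt.hasDerivAt
    have h2 := HasDerivAt.comp (0 : ℂ) h1 hka.differentiableAt.hasDerivAt
    have h3 := hk'.self_of_nhds
    rw [hk0, hp1, inv_one] at h3
    rw [hc1, ← mul_one (deriv g 0), ← h3]
    exact h2.deriv
  · intro u hu
    simpa only [pow_mul] using (hc _ (hsmall u hu)).summable
  · intro z hz hzr
    have h1 := hc _ (hsmall _ hzr)
    rw [lt_min_iff, lt_min_iff] at hzr
    have h2 : k (phi α β γ z ^ m) = z := by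
      rw [phi_pow hm hα]
      exact hεl z (by simpa using hr₂' z hz hzr.1.2)
    rw [h2] at h1
    simpa only [pow_mul] using h1

/-! ### Reflections in the sides -/

/-- The reflection in the line through `0` and `rot θ`. -/
def mirr (θ : ℝ) (x : ℂ) : ℂ := rot θ * rot θ * conj x

lemma mirr_mirr (θ : ℝ) (x : ℂ) : mirr θ (mirr θ x) = x := by
  have := rot_mul_conj θ
  simp only [mirr, map_mul, conj_conj]
  linear_combination (rot θ * conj (rot θ) + 1) * x * this

lemma norm_mirr (θ : ℝ) (x : ℂ) : ‖mirr θ x‖ = ‖x‖ := by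
  rw [mirr, norm_mul, norm_mul, norm_rot, norm_conj, one_mul, one_mul]

/-- The mirror contains `0` and `vertB`, and `stepS` places this side on the real axis. -/
lemma stepS_mirr (α β γ : ℝ) (x : ℂ) : stepS α β γ (mirr α x) = conj (stepS α β γ x) := by
  rw [stepS_eq, stepS_eq, ← mob_conj, mirr, mul_assoc, conj_rot_mul_rot_mul, map_mul, conj_conj]

lemma mirr_notMem_tri (h : Hyperbolic α β γ) {x : ℂ} (hx : x ∈ tri α β γ) :
    mirr α x ∉ tri α β γ := by
  intro hm
  have h1 := ((mem_tri_iff h).mp hx).2.2.1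
  have h2 := ((mem_tri_iff h).mp hm).2.2.1
  rw [stepS_mirr, conj_im] at h2
  linarith

/-- The mirror image of the triangle in a side stays away from the opposite vertex. -/
lemma exists_le_norm_stepS_stepS_mirr (h : Hyperbolic α β γ) :
    ∃ r > 0, ∀ x ∈ tri α β γ, r ≤ ‖stepS β γ α (stepS α β γ (mirr α x))‖ := by
  have hB := h.rotate
  have hν := nu_pos hB
  have hν' := nu_pos hB.rotate
  have hd := infRadius_pos hB
  have hs := hB.sin_pos
  refine ⟨nu β γ α / nu γ α β * ((infRadius β γ α * Real.sin (Real.pi * β)) / 2), by positivity,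
    fun x hx => ?_⟩
  obtain ⟨hn, -, him, -⟩ := (mem_tri_iff h).mp hx
  rw [stepS_mirr, stepS_eq, mob, norm_mul, norm_real,
    Real.norm_of_nonneg (div_pos hν hν').le, norm_div]
  set y := conj (stepS α β γ x) with hy
  have hyn : ‖y‖ < (nu β γ α)⁻¹ := by
    rw [hy, norm_conj]
    exact norm_stepS_lt h hn
  have hyi : y.im < 0 := by
    rw [hy, conj_im]
    linarith
  have hne := mob_den_ne_zero hν hd.le (nu_mul_infRadius_lt_one hB) (x := conj (rot β) * y)
    (by rwa [norm_conj_rot_mul])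
  -- About `φ(∞)` the reflected point lies below the real axis, while the opposite vertex `φ(1)`
  -- lies above it at height `infRadius * sin (π β)`.
  have h1 : infRadius β γ α * Real.sin (Real.pi * β) ≤
      ‖(infRadius β γ α : ℂ) - conj (rot β) * y‖ := by
    have e : ‖(infRadius β γ α : ℂ) - conj (rot β) * y‖ =
        ‖rot β * (infRadius β γ α : ℂ) - y‖ := by
      rw [← norm_conj_rot_mul β (rot β * (infRadius β γ α : ℂ) - y), mul_sub,
        conj_rot_mul_rot_mul]
    rw [e]
    refine le_trans ?_ (Complex.im_le_norm _)
    rw [sub_im, im_rot_mul_ofReal]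
    linarith
  have h2 : ‖1 - (nu β γ α : ℂ) ^ 2 * infRadius β γ α * (conj (rot β) * y)‖ ≤ 2 := by
    refine (norm_sub_le _ _).trans ?_
    rw [norm_one, norm_mul, norm_mul, norm_pow, norm_real, norm_real, norm_conj_rot_mul,
      Real.norm_of_nonneg hν.le, Real.norm_of_nonneg hd.le]
    have h3 : nu β γ α * ‖y‖ ≤ 1 := by
      rw [← le_inv_mul_iff₀ hν, mul_one]
      exact hyn.le
    have h4 := nu_mul_infRadius_lt_one hB
    have h5 : 0 ≤ nu β γ α * infRadius β γ α := by positivity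
    nlinarith
  have h3 : 0 < ‖1 - (nu β γ α : ℂ) ^ 2 * infRadius β γ α * (conj (rot β) * y)‖ :=
    norm_pos_iff.mpr hne
  gcongr

lemma discMove_neg_discMove {ν : ℝ} (hν : 0 < ν) {d x : ℂ} (hd : ‖d‖ < ν⁻¹) (hx : ‖x‖ < ν⁻¹) :
    discMove ν (-d) (discMove ν d x) = x := by
  have key : ∀ y : ℂ, ‖y‖ < ν⁻¹ → 1 - (ν : ℂ) ^ 2 * conj d * y ≠ 0 := by
    intro y hy h0
    have h1 : (ν : ℂ) ^ 2 * conj d * y = 1 := by linear_combination -h0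
    have h2 := congrArg norm h1
    rw [norm_mul, norm_mul, norm_pow, norm_real, norm_conj, norm_one,
      Real.norm_of_nonneg hν.le] at h2
    have h3 : ν * ‖d‖ < 1 := by rwa [← lt_inv_mul_iff₀ hν, mul_one]
    have h4 : ν * ‖y‖ < 1 := by rwa [← lt_inv_mul_iff₀ hν, mul_one]
    have h5 : 0 ≤ ν * ‖d‖ := by positivity
    have h6 : 0 ≤ ν * ‖y‖ := by positivity
    nlinarith
  have h1 := key x hx
  have h2 := key d hd
  have h3 : 1 - (ν : ℂ) ^ 2 * conj (-d) * ((x - d) / (1 - (ν : ℂ) ^ 2 * conj d * x)) =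
      (1 - (ν : ℂ) ^ 2 * conj d * d) / (1 - (ν : ℂ) ^ 2 * conj d * x) := by
    rw [map_neg]
    field_simp
    ring
  rw [discMove, discMove, h3, div_eq_iff (div_ne_zero h2 h1), sub_neg_eq_add, div_add' _ _ _ h1,
    ← mul_div_assoc]
  congr 1
  ring

/-- A hyperbolic reflection is a reflection in a line in the coordinate `T` about a point of the
mirror. -/
lemma hypReflect_eq {ν ν' : ℝ} (hν : 0 < ν) {P Q : ℂ} (hP : ‖P‖ < ν⁻¹) {T Ti : ℂ → ℂ} {k : ℂ}
    (hk : k ≠ 0) (hT : ∀ w, T w = k * discMove ν P w) {θ q : ℝ} (hq : 0 < q)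
    (hQ : T Q = rot θ * q) (hTi : ∀ v, ‖v‖ < ν'⁻¹ → ‖Ti v‖ < ν⁻¹ ∧ T (Ti v) = v) {w : ℂ}
    (hw : ‖T w‖ < ν'⁻¹) : hypReflect ν P Q w = Ti (mirr θ (T w)) := by
  have hq' : (q : ℂ) ≠ 0 := ofReal_ne_zero.mpr hq.ne'
  obtain ⟨h1, h2⟩ := hTi (mirr θ (T w)) (by rwa [norm_mirr])
  have h3 : discMove ν P Q * conj (discMove ν P w / discMove ν P Q) =
      discMove ν P (Ti (mirr θ (T w))) := by
    rw [← mul_right_inj' hk, ← hT (Ti _), h2, ← mul_assoc, ← hT,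
      ← mul_div_mul_left _ (discMove ν P Q) hk, ← hT, ← hT, hQ, mirr, map_div₀, map_mul,
      conj_ofReal]
    have h4 : conj (rot θ) ≠ 0 := by simpa using rot_ne_zero θ
    field_simp
    linear_combination rot θ * conj (T w) * (-rot_mul_conj θ)
  rw [hypReflect, h3, discMove_neg_discMove hν hP h1]

/-- How a coordinate `S` about a vertex with angle `π θ` changes under the reflection `ρ` of the
triangle `D` in a side: either the mirror contains the vertex, or the image of `D` stays away from
it. -/
def Mirrored (D : Set ℂ) (ρ S : ℂ → ℂ) (θ : ℝ) : Prop :=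
  (∀ w ∈ D, S (ρ w) = mirr θ (S w)) ∨ (∀ w ∈ D, S (ρ w) = conj (S w)) ∨
    ∃ r > 0, ∀ w ∈ D, r ≤ ‖S (ρ w)‖

/-- Each mirror contains two vertices. In the coordinate about one of them it is the real axis,
about the other the line of slope angle `π θ`; the third vertex is opposite and the reflected
triangle keeps a distance from it. -/
lemma reflection_spec (h : Hyperbolic α β γ) {ρ : ℂ → ℂ}
    (hρ : ρ = hypReflect (nu α β γ) 0 (vertB α β γ) ∨
      ρ = hypReflect (nu α β γ) (vertB α β γ) (oneRadius α β γ : ℂ) ∨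
      ρ = hypReflect (nu α β γ) (oneRadius α β γ : ℂ) 0) :
    (∀ w ∈ tri α β γ, ρ w ∉ tri α β γ ∧ ρ (ρ w) = w) ∧
    Mirrored (tri α β γ) ρ (fun w => w) α ∧ Mirrored (tri α β γ) ρ (stepS α β γ) β ∧
    Mirrored (tri α β γ) ρ (stepInv γ α β) γ := by
  have hB := h.rotate
  have hC := hB.rotate
  have hlt : ∀ w ∈ tri α β γ, ‖w‖ < (nu α β γ)⁻¹ := fun w hw => hw.1
  rcases hρ with rfl | rfl | rfl
  · have e : ∀ w, ‖w‖ < (nu α β γ)⁻¹ →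
        hypReflect (nu α β γ) 0 (vertB α β γ) w = mirr α w := fun w hw =>
      hypReflect_eq (T := fun w => w) (Ti := fun w => w) (nu_pos h) (by simpa using nu_pos h)
        one_ne_zero (fun w => by rw [discMove_zero, one_mul]) (infRadius_pos h) (vertB_eq α β γ)
        (fun v hv => ⟨hv, rfl⟩) hw
    have en : ∀ w, ‖w‖ < (nu α β γ)⁻¹ → ‖mirr α w‖ < (nu α β γ)⁻¹ := fun w hw => by
      rwa [norm_mirr]
    refine ⟨fun w hw => ?_, Or.inl fun w hw => e w (hlt w hw), Or.inr (Or.inl fun w hw => ?_), ?_⟩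
    · rw [e w (hlt w hw), e _ (en w (hlt w hw)), mirr_mirr]
      exact ⟨mirr_notMem_tri h hw, rfl⟩
    · rw [e w (hlt w hw), stepS_mirr]
    · obtain ⟨r, hr, hr'⟩ := exists_le_norm_stepS_stepS_mirr h
      refine Or.inr (Or.inr ⟨r, hr, fun w hw => ?_⟩)
      rw [e w (hlt w hw), stepInv_eq_stepS_stepS h (en w (hlt w hw))]
      exact hr' w hw
  · obtain ⟨k, hk, hkS⟩ := exists_stepS_eq h
    have e : ∀ w, ‖w‖ < (nu α β γ)⁻¹ →
        hypReflect (nu α β γ) (vertB α β γ) (oneRadius α β γ : ℂ) w =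
          stepInv α β γ (mirr β (stepS α β γ w)) := fun w hw =>
      hypReflect_eq (nu_pos h) (norm_vertB_lt h) hk hkS (infRadius_pos hB)
        (by rw [stepS_oneRadius h, vertB_eq])
        (fun v hv => ⟨norm_stepInv_lt h hv, stepS_stepInv h hv⟩) (norm_stepS_lt h hw)
    have em : ∀ w, ‖w‖ < (nu α β γ)⁻¹ → ‖mirr β (stepS α β γ w)‖ < (nu β γ α)⁻¹ := fun w hw => by
      rw [norm_mirr]
      exact norm_stepS_lt h hw
    have en : ∀ w, ‖w‖ < (nu α β γ)⁻¹ →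
        ‖stepInv α β γ (mirr β (stepS α β γ w))‖ < (nu α β γ)⁻¹ := fun w hw =>
      norm_stepInv_lt h (em w hw)
    have eS : ∀ w, ‖w‖ < (nu α β γ)⁻¹ → stepS α β γ (stepInv α β γ (mirr β (stepS α β γ w))) =
        mirr β (stepS α β γ w) := fun w hw => stepS_stepInv h (em w hw)
    have eB : ∀ w ∈ tri α β γ, stepS α β γ w ∈ tri β γ α := fun w hw =>
      (stepS_mem_tri_iff h (hlt w hw)).mpr hw
    refine ⟨fun w hw => ?_, ?_, Or.inl fun w hw => ?_, Or.inr (Or.inl fun w hw => ?_)⟩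
    · rw [e w (hlt w hw), e _ (en w (hlt w hw)), eS w (hlt w hw), mirr_mirr,
        stepInv_stepS h (hlt w hw)]
      refine ⟨fun hm => ?_, rfl⟩
      rw [← stepS_mem_tri_iff h (en w (hlt w hw)), eS w (hlt w hw)] at hm
      exact mirr_notMem_tri hB (eB w hw) hm
    · obtain ⟨r, hr, hr'⟩ := exists_le_norm_stepS_stepS_mirr hB
      refine Or.inr (Or.inr ⟨r, hr, fun w hw => ?_⟩)
      have := hr' _ (eB w hw)
      rwa [← eS w (hlt w hw), stepS_stepS_stepS h (en w (hlt w hw)), ← e w (hlt w hw)] at this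
    · rw [e w (hlt w hw), eS w (hlt w hw)]
    · rw [e w (hlt w hw), stepInv_eq_stepS_stepS h (en w (hlt w hw)), eS w (hlt w hw), stepS_mirr,
        stepInv_eq_stepS_stepS h (hlt w hw)]
  · obtain ⟨k, hk, hkS⟩ := exists_stepInv_eq h
    have hinv : ∀ w, ‖w‖ < (nu α β γ)⁻¹ → ‖stepInv γ α β w‖ < (nu γ α β)⁻¹ := fun w hw =>
      norm_stepInv_lt hC hw
    have e : ∀ w, ‖w‖ < (nu α β γ)⁻¹ →
        hypReflect (nu α β γ) (oneRadius α β γ : ℂ) 0 w =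
          stepS γ α β (mirr γ (stepInv γ α β w)) := fun w hw =>
      hypReflect_eq (nu_pos h) (norm_oneRadius_lt h) hk hkS (infRadius_pos hC)
        (by rw [stepInv_zero hC, vertB_eq])
        (fun v hv => ⟨norm_stepS_lt hC hv, stepInv_stepS hC hv⟩) (hinv w hw)
    have em : ∀ w, ‖w‖ < (nu α β γ)⁻¹ → ‖mirr γ (stepInv γ α β w)‖ < (nu γ α β)⁻¹ := fun w hw => by
      rw [norm_mirr]
      exact hinv w hw
    have en : ∀ w, ‖w‖ < (nu α β γ)⁻¹ →
        ‖stepS γ α β (mirr γ (stepInv γ α β w))‖ < (nu α β γ)⁻¹ := fun w hw =>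
      norm_stepS_lt hC (em w hw)
    have eS : ∀ w, ‖w‖ < (nu α β γ)⁻¹ → stepInv γ α β (stepS γ α β (mirr γ (stepInv γ α β w))) =
        mirr γ (stepInv γ α β w) := fun w hw => stepInv_stepS hC (em w hw)
    have eC : ∀ w, ‖w‖ < (nu α β γ)⁻¹ → (stepInv γ α β w ∈ tri γ α β ↔ w ∈ tri α β γ) :=
      fun w hw => by rw [← stepS_mem_tri_iff hC (hinv w hw), stepS_stepInv hC hw]
    refine ⟨fun w hw => ?_, Or.inr (Or.inl fun w hw => ?_), ?_, Or.inl fun w hw => ?_⟩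
    · rw [e w (hlt w hw), e _ (en w (hlt w hw)), eS w (hlt w hw), mirr_mirr,
        stepS_stepInv hC (hlt w hw)]
      refine ⟨fun hm => ?_, rfl⟩
      rw [← eC _ (en w (hlt w hw)), eS w (hlt w hw)] at hm
      exact mirr_notMem_tri hC ((eC w (hlt w hw)).mpr hw) hm
    · rw [e w (hlt w hw), stepS_mirr, stepS_stepInv hC (hlt w hw)]
    · obtain ⟨r, hr, hr'⟩ := exists_le_norm_stepS_stepS_mirr hC
      refine Or.inr (Or.inr ⟨r, hr, fun w hw => ?_⟩)
      rw [e w (hlt w hw)]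
      exact hr' _ ((eC w (hlt w hw)).mpr hw)
    · rw [e w (hlt w hw), eS w (hlt w hw)]

/-! ### Expansions on the fundamental domain -/

/-- An expansion on the triangle extends to its mirror images. -/
lemma rationalAtVertex_of_expansion (h : Hyperbolic α β γ) {c : ℕ → ℚ} {k : ℕ} {S : ℂ → ℂ} {θ : ℝ}
    (hθ : (rot θ * rot θ) ^ k = 1) {f : ℂ → ℂ → ℂ} (hconj : ∀ u z, f (conj u) (conj z) = conj (f u z))
    (hrot : ∀ ε u z, ε ^ k = 1 → f (ε * u) z = f u z)
    (hρ : ∀ ρ : ℂ → ℂ, (ρ = hypReflect (nu α β γ) 0 (vertB α β γ) ∨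
      ρ = hypReflect (nu α β γ) (vertB α β γ) (oneRadius α β γ : ℂ) ∨
      ρ = hypReflect (nu α β γ) (oneRadius α β γ : ℂ) 0) → Mirrored (tri α β γ) ρ S θ)
    (hS : ∃ r > 0, (∀ u : ℂ, ‖u‖ < r → Summable fun i : ℕ => (c i : ℂ) * u ^ (k * i)) ∧
      ∀ z ∈ upperHalf, ‖S (phi α β γ z)‖ < r →
        HasSum (fun i : ℕ => (c i : ℂ) * S (phi α β γ z) ^ (k * i)) (f (S (phi α β γ z)) z)) :
    RationalAtVertex (nu α β γ) (phi α β γ) (vertB α β γ) (oneRadius α β γ : ℂ) c k S f := by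
  intro ρ hρ'
  obtain ⟨hinv, -⟩ := reflection_spec h hρ'
  replace hρ := hρ ρ hρ'
  rw [hypTriangle_eq h]
  intro Δ F ψ S'
  obtain ⟨r, hr, hsum, hS⟩ := hS
  have hψ : ∀ z ∈ upperHalf, ψ (phi α β γ z) = z := fun z hz => by
    simp only [ψ, psi]
    rw [if_pos (phi_mem_tri h hz)]
    exact (injOn_phi h).leftInvOn_invFunOn hz
  have hψ' : ∀ z ∈ upperHalf, ψ (ρ (phi α β γ z)) = conj z := fun z hz => by
    obtain ⟨h1, h2⟩ := hinv _ (phi_mem_tri h hz)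
    simp only [ψ, psi]
    rw [if_neg h1, h2]
    exact congrArg conj ((injOn_phi h).leftInvOn_invFunOn hz)
  have hF : ∀ w ∈ F, ∃ z ∈ upperHalf, w = phi α β γ z ∨ w = ρ (phi α β γ z) := by
    rintro w (hw | ⟨v, hv, rfl⟩)
    · obtain ⟨z, hz, rfl⟩ := tri_subset_image_phi h hw
      exact ⟨z, hz, Or.inl rfl⟩
    · obtain ⟨z, hz, rfl⟩ := tri_subset_image_phi h hv
      exact ⟨z, hz, Or.inr rfl⟩
  have hsumc : ∀ z ∈ upperHalf, ‖S (phi α β γ z)‖ < r →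
      HasSum (fun i : ℕ => (c i : ℂ) * conj (S (phi α β γ z)) ^ (k * i))
        (f (conj (S (phi α β γ z))) (conj z)) := by
    intro z hz hzr
    have h1 := hasSum_conj'.mpr (hS z hz hzr)
    rw [hconj]
    refine h1.congr_fun fun i => ?_
    simp
  have hpow : ∀ ε u : ℂ, ε ^ k = 1 → ∀ i : ℕ, (ε * u) ^ (k * i) = u ^ (k * i) := by
    intro ε u hε i
    rw [mul_pow, pow_mul ε, hε, one_pow, one_mul]
  -- Both reflections in sides through the vertex are conjugation times a `k`-th root of unity,
  -- which does not change `u ^ (k * i)`.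
  have hcase : (∃ ε : ℂ, ε ^ k = 1 ∧ ‖ε‖ = 1 ∧ ∀ w ∈ Δ, S (ρ w) = ε * conj (S w)) ∨
      ∃ r > 0, ∀ w ∈ Δ, r ≤ ‖S (ρ w)‖ := by
    rcases hρ with h1 | h1 | h1
    · exact Or.inl ⟨_, hθ, by rw [norm_mul, norm_rot, one_mul], h1⟩
    · exact Or.inl ⟨1, one_pow _, norm_one, by simpa using h1⟩
    · exact Or.inr h1
  -- When the mirror is the opposite side, a smaller radius excludes reflected points altogether.
  have hfar : ∃ r' > 0, r' ≤ r ∧ ∀ z ∈ upperHalf, ‖S (ρ (phi α β γ z))‖ < r' →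
      ∃ ε : ℂ, ε ^ k = 1 ∧ ‖ε‖ = 1 ∧ S (ρ (phi α β γ z)) = ε * conj (S (phi α β γ z)) := by
    rcases hcase with ⟨ε, h1, h2, h3⟩ | ⟨r', hr', h1⟩
    · exact ⟨r, hr, le_rfl, fun z hz _ => ⟨ε, h1, h2, h3 _ (phi_mem_tri h hz)⟩⟩
    · refine ⟨min r r', lt_min hr hr', min_le_left _ _, fun z hz hzr => ?_⟩
      exact absurd (h1 _ (phi_mem_tri h hz)) (not_le.mpr (hzr.trans_le (min_le_right _ _)))
  obtain ⟨r', hr', hrr', hfar⟩ := hfar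
  refine ⟨⟨r', hr', fun u hu => hsum u (hu.trans_le hrr'), fun w hw hwr => ?_⟩,
    ⟨r', hr', fun u hu => hsum u (hu.trans_le hrr'), fun w hw hwr => ?_⟩⟩
  · obtain ⟨z, hz, rfl | rfl⟩ := hF w hw
    · dsimp only
      rw [hψ z hz]
      exact hS z hz (hwr.trans_le hrr')
    · obtain ⟨ε, h1, h2, h3⟩ := hfar z hz hwr
      have h4 : ‖S (phi α β γ z)‖ < r := by
        rw [h3, norm_mul, h2, one_mul, norm_conj] at hwr
        exact hwr.trans_le hrr'
      dsimp only
      rw [hψ' z hz, h3, hrot _ _ _ h1]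
      simp only [hpow _ _ h1]
      exact hsumc z hz h4
  · obtain ⟨z, hz, rfl | rfl⟩ := hF w hw
    · have hwr' : ‖S (ρ (phi α β γ z))‖ < r' := by simpa only [S', norm_conj] using hwr
      obtain ⟨ε, h1, h2, h3⟩ := hfar z hz hwr'
      have h4 : ‖S (phi α β γ z)‖ < r := by
        rw [h3, norm_mul, h2, one_mul, norm_conj] at hwr'
        exact hwr'.trans_le hrr'
      have h5 : conj ε ^ k = 1 := by rw [← map_pow, h1, map_one]
      dsimp only [S']
      rw [hψ z hz, h3, map_mul, conj_conj, hrot _ _ _ h5]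
      simp only [hpow _ _ h5]
      exact hS z hz h4
    · obtain ⟨-, h2⟩ := hinv _ (phi_mem_tri h hz)
      have h4 : ‖S (phi α β γ z)‖ < r := by
        simp only [S', norm_conj, h2] at hwr
        exact hwr.trans_le hrr'
      dsimp only [S']
      rw [hψ' z hz, h2]
      exact hsumc z hz h4

lemma rot_mul_rot_pow {k : ℕ} (hk : 0 < k) : (rot (1 / k) * rot (1 / k)) ^ k = 1 := by
  have hk' : (k : ℂ) ≠ 0 := Nat.cast_ne_zero.mpr hk.ne'
  rw [rot, ← exp_add, ← exp_nat_mul, ← exp_two_pi_mul_I]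
  congr 1
  push_cast
  field_simp
  ring

lemma vertB_im_pos (h : Hyperbolic α β γ) : 0 < (vertB α β γ).im := by
  rw [vertB_eq, im_rot_mul_ofReal]
  exact mul_pos (infRadius_pos h) h.sin_pos

/-! ### The expansions about the vertices -/

lemma expansion_zero (h : Hyperbolic α β γ) {m : ℕ} (hm : 0 < m) (hα : α = 1 / m)
    (hβ : ∃ q : ℚ, β = q) (hγ : ∃ q : ℚ, γ = q) :
    ∃ c : ℕ → ℚ, c 0 = 0 ∧ c 1 = 1 ∧ RationalAtVertex (nu α β γ) (phi α β γ) (vertB α β γ)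
      (oneRadius α β γ : ℂ) c m (fun w => w) (fun _ z => z) := by
  obtain ⟨c, h0, h1, hc⟩ := exists_expansion h hm hα hβ hγ RatJet.id'
  refine ⟨c, by exact_mod_cast h0, by simp only [deriv_id''] at h1; exact_mod_cast h1, ?_⟩
  exact rationalAtVertex_of_expansion h (by rw [hα]; exact rot_mul_rot_pow hm) (fun _ _ => rfl)
    (fun _ _ _ _ => rfl) (fun ρ hρ => (reflection_spec h hρ).2.1) hc

lemma rationalAtVertex_stepS (h : Hyperbolic α β γ) {n : ℕ} (hn : 0 < n) (hβ : β = 1 / n)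
    (hα : ∃ q : ℚ, α = q) (hγ : ∃ q : ℚ, γ = q) {g : ℂ → ℂ} (hg : ∀ k, RatJet k g)
    {f : ℂ → ℂ → ℂ} (hconj : ∀ u z, f (conj u) (conj z) = conj (f u z))
    (hrot : ∀ ε u z, ε ^ n = 1 → f (ε * u) z = f u z)
    (hf : ∀ z ∈ upperHalf, f (phi β γ α (shiftB z)) z = g (shiftB z)) :
    ∃ c : ℕ → ℚ, (c 0 : ℂ) = g 0 ∧ (c 1 : ℂ) = deriv g 0 ∧ RationalAtVertex (nu α β γ)
      (phi α β γ) (vertB α β γ) (oneRadius α β γ : ℂ) c n (stepS α β γ) f := by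
  obtain ⟨c, h0, h1, r, hr, hs, hc⟩ := exists_expansion h.rotate hn hβ hγ hα hg
  refine ⟨c, h0, h1, rationalAtVertex_of_expansion h (by rw [hβ]; exact rot_mul_rot_pow hn) hconj
    hrot (fun ρ hρ => (reflection_spec h hρ).2.2.1) ⟨r, hr, hs, fun z hz hzr => ?_⟩⟩
  rw [← phi_shiftB h hz] at hzr ⊢
  rw [hf z hz]
  exact hc _ (shiftB_mem z hz) hzr

lemma rationalAtVertex_stepInv (h : Hyperbolic α β γ) {p : ℕ} (hp : 0 < p) (hγ : γ = 1 / p)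
    (hα : ∃ q : ℚ, α = q) (hβ : ∃ q : ℚ, β = q) {g : ℂ → ℂ} (hg : ∀ k, RatJet k g)
    {f : ℂ → ℂ → ℂ} (hconj : ∀ u z, f (conj u) (conj z) = conj (f u z))
    (hrot : ∀ ε u z, ε ^ p = 1 → f (ε * u) z = f u z)
    (hf : ∀ z ∈ upperHalf, f (phi γ α β (shiftC z)) z = g (shiftC z)) :
    ∃ c : ℕ → ℚ, (c 0 : ℂ) = g 0 ∧ (c 1 : ℂ) = deriv g 0 ∧ RationalAtVertex (nu α β γ)
      (phi α β γ) (vertB α β γ) (oneRadius α β γ : ℂ) c p (stepInv γ α β) f := by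
  obtain ⟨c, h0, h1, r, hr, hs, hc⟩ := exists_expansion h.rotate.rotate hp hγ hα hβ hg
  refine ⟨c, h0, h1, rationalAtVertex_of_expansion h (by rw [hγ]; exact rot_mul_rot_pow hp) hconj
    hrot (fun ρ hρ => (reflection_spec h hρ).2.2.2) ⟨r, hr, hs, fun z hz hzr => ?_⟩⟩
  have e : stepInv γ α β (phi α β γ z) = phi γ α β (shiftC z) := by
    rw [stepInv_eq_stepS_stepS h (norm_phi_lt h hz), ← phi_shiftB h hz,
      ← phi_shiftB h.rotate (shiftB_mem z hz),
      ← shiftC_eq (z := z) (by simpa using ne_ofReal_of_mem hz 1)]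
  rw [e] at hzr ⊢
  rw [hf z hz]
  exact hc _ (shiftC_mem z hz) hzr

lemma conj_shiftB (z : ℂ) : shiftB (conj z) = conj (shiftB z) := by simp [shiftB]

lemma conj_shiftC (z : ℂ) : shiftC (conj z) = conj (shiftC z) := by simp [shiftC]

lemma expansion_shiftB (h : Hyperbolic α β γ) {n : ℕ} (hn : 0 < n) (hβ : β = 1 / n)
    (hα : ∃ q : ℚ, α = q) (hγ : ∃ q : ℚ, γ = q) :
    ∃ c : ℕ → ℚ, c 0 = 0 ∧ c 1 = 1 ∧ RationalAtVertex (nu α β γ) (phi α β γ) (vertB α β γ)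
      (oneRadius α β γ : ℂ) c n (stepS α β γ) (fun _ z => shiftB z) := by
  obtain ⟨c, h0, h1, hc⟩ := rationalAtVertex_stepS h hn hβ hα hγ RatJet.id'
    (f := fun _ z => shiftB z) (fun _ z => conj_shiftB z) (fun _ _ _ _ => rfl) (fun _ _ => rfl)
  exact ⟨c, by exact_mod_cast h0, by simp only [deriv_id''] at h1; exact_mod_cast h1, hc⟩

/-- With `s = shiftB z` one has `z = (s - 1) / s` and `u ^ n = s * G(s) ^ n`. The pole cancels and
`u ^ n * z = (s - 1) * G(s) ^ n`. -/
lemma expansion_pole (h : Hyperbolic α β γ) {n : ℕ} (hn : 0 < n) (hβ : β = 1 / n)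
    (hα : ∃ q : ℚ, α = q) (hγ : ∃ q : ℚ, γ = q) :
    ∃ e : ℕ → ℚ, e 0 = -1 ∧ RationalAtVertex (nu α β γ) (phi α β γ) (vertB α β γ)
      (oneRadius α β γ : ℂ) e n (stepS α β γ) (fun u z => u ^ n * z) := by
  have hq : ∃ q : ℚ, β = q := ⟨1 / n, by rw [hβ]; push_cast; rfl⟩
  have hg : ∀ k, RatJet k fun z => (z + ((-1 : ℚ) : ℂ)) * quotF β γ α z ^ n := fun k =>
    ((RatJet.id' k).add (RatJet.const (-1) k)).mul ((ratJet_quotF h.rotate hq hγ hα k).pow n)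
  have hf : ∀ z ∈ upperHalf, phi β γ α (shiftB z) ^ n * z =
      (shiftB z + ((-1 : ℚ) : ℂ)) * quotF β γ α (shiftB z) ^ n := by
    intro z hz
    have h1 : 1 - z ≠ 0 := sub_ne_zero.mpr fun h1 => ne_ofReal_of_mem hz 1 (by simpa using h1.symm)
    rw [phi_pow hn hβ, shiftB_eq]
    push_cast
    field_simp
    ring
  obtain ⟨c, h0, -, hc⟩ := rationalAtVertex_stepS h hn hβ hα hγ hg
    (f := fun u z => u ^ n * z) (fun u z => by simp)
    (fun ε u z hε => by rw [mul_pow, hε, one_mul]) hf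
  refine ⟨c, ?_, hc⟩
  rw [quotF_zero h.rotate, one_pow, mul_one, zero_add] at h0
  exact_mod_cast h0

lemma expansion_shiftC (h : Hyperbolic α β γ) {p : ℕ} (hp : 0 < p) (hγ : γ = 1 / p)
    (hα : ∃ q : ℚ, α = q) (hβ : ∃ q : ℚ, β = q) :
    ∃ c : ℕ → ℚ, c 0 = 0 ∧ c 1 = 1 ∧ RationalAtVertex (nu α β γ) (phi α β γ) (vertB α β γ)
      (oneRadius α β γ : ℂ) c p (stepInv γ α β) (fun _ z => shiftC z) := by
  obtain ⟨c, h0, h1, hc⟩ := rationalAtVertex_stepInv h hp hγ hα hβ RatJet.id'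
    (f := fun _ z => shiftC z) (fun _ z => conj_shiftC z) (fun _ _ _ _ => rfl) (fun _ _ => rfl)
  exact ⟨c, by exact_mod_cast h0, by simp only [deriv_id''] at h1; exact_mod_cast h1, hc⟩

/-- Here `z = 1 / (1 - shiftC z)`, a geometric series in `shiftC z`, which accounts for both leading
coefficients. -/
lemma expansion_one (h : Hyperbolic α β γ) {p : ℕ} (hp : 0 < p) (hγ : γ = 1 / p)
    (hα : ∃ q : ℚ, α = q) (hβ : ∃ q : ℚ, β = q) :
    ∃ e : ℕ → ℚ, e 0 = 1 ∧ e 1 = 1 ∧ RationalAtVertex (nu α β γ) (phi α β γ) (vertB α β γ)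
      (oneRadius α β γ : ℂ) e p (stepInv γ α β) (fun _ z => z) := by
  have hg : ∀ k, RatJet k fun z => (((1 : ℚ) : ℂ) + ((-1 : ℚ) : ℂ) * z)⁻¹ := fun k =>
    ((RatJet.const 1 k).add ((RatJet.const (-1) k).mul (RatJet.id' k))).inv (by simp)
  have hg' : (fun z : ℂ => (((1 : ℚ) : ℂ) + ((-1 : ℚ) : ℂ) * z)⁻¹) = fun z => (1 - z)⁻¹ := by
    funext z
    push_cast
    ring
  rw [hg'] at hg
  obtain ⟨c, h0, h1, hc⟩ := rationalAtVertex_stepInv h hp hγ hα hβ hg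
    (f := fun _ z => z) (fun _ z => rfl) (fun _ _ _ _ => rfl) (fun z hz => by
      rw [← shiftB_eq, shiftB_shiftC (by simpa using ne_ofReal_of_mem hz 0)])
  have h2 : HasDerivAt (fun z : ℂ => (1 - z)⁻¹) 1 0 := by
    have := ((hasDerivAt_id (0 : ℂ)).const_sub 1).fun_inv (by simp)
    simpa using this
  rw [sub_zero, inv_one] at h0
  rw [h2.deriv] at h1
  exact ⟨c, by exact_mod_cast h0, by exact_mod_cast h1, hc⟩

end SchwarzTriangle

end

theorem mainTheorem1 (m n p : ℕ) (hm : 0 < m) (hn : 0 < n) (hp : 0 < p)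
    (hyp : (1 : ℝ) / m + 1 / n + 1 / p < 1)
    (α β γ : ℝ) (hα : α = 1 / m) (hβ : β = 1 / n) (hγ : γ = 1 / p)
    (φ : ℂ → ℂ) (hφ : φ = SchwarzTriangle.phi α β γ)
    (ν νB νC : ℝ) (hν : ν = SchwarzTriangle.nu α β γ)
    (hνB : νB = SchwarzTriangle.nu β γ α) (hνC : νC = SchwarzTriangle.nu γ α β) :
    ∃ B C : ℂ,
      -- the vertices are the images of `0`, `∞`, `1`
      Tendsto φ (𝓝[SchwarzTriangle.upperHalf] 0) (𝓝 0) ∧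
      Tendsto φ (Bornology.cobounded ℂ ⊓ 𝓟 SchwarzTriangle.upperHalf) (𝓝 B) ∧
      Tendsto φ (𝓝[SchwarzTriangle.upperHalf] 1) (𝓝 C) ∧
      0 < ν ∧ 0 < νB ∧ 0 < νC ∧ ‖B‖ < ν⁻¹ ∧ ‖C‖ < ν⁻¹ ∧ 0 < B.im ∧ 0 < C.re ∧ C.im = 0 ∧
      SchwarzTriangle.hypAngle ν 0 B C = Real.pi * α ∧
      SchwarzTriangle.hypAngle ν B C 0 = Real.pi * β ∧
      SchwarzTriangle.hypAngle ν C 0 B = Real.pi * γ ∧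
      -- `φ` maps the upper half plane conformally onto the hyperbolic triangle
      DifferentiableOn ℂ φ SchwarzTriangle.upperHalf ∧
      Set.BijOn φ SchwarzTriangle.upperHalf (SchwarzTriangle.hypTriangle ν 0 B C) ∧
      -- the vertex `A = 0`: `ψ = u ^ m + c₂ u ^ (2 m) + ⋯`
      (∃ c : ℕ → ℚ, c 0 = 0 ∧ c 1 = 1 ∧
        SchwarzTriangle.RationalAtVertex ν φ B C c m (fun w => w) (fun _ z => z)) ∧
      -- the vertex `B`: `T ∘ ψ = u ^ n + c₂ u ^ (2 n) + ⋯`, and `ψ` has a pole of order `n` with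
      -- a rational Laurent series
      (∃ t : ℝ,
        let S := SchwarzTriangle.coordS ν νB t B
        0 < (S 0).re ∧ (S 0).im = 0 ∧ 0 < (S C).im ∧
        (∃ c : ℕ → ℚ, c 0 = 0 ∧ c 1 = 1 ∧
          SchwarzTriangle.RationalAtVertex ν φ B C c n S
            (fun _ z => SchwarzTriangle.shiftB z)) ∧
        (∃ e : ℕ → ℚ, e 0 = -1 ∧
          SchwarzTriangle.RationalAtVertex ν φ B C e n S (fun u z => u ^ n * z))) ∧
      -- the vertex `C`: `T ∘ ψ = u ^ p + c₂ u ^ (2 p) + ⋯` and `ψ = 1 + u ^ p + ⋯`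
      (∃ t : ℝ,
        let S := SchwarzTriangle.coordS ν νC t C
        0 < (S B).re ∧ (S B).im = 0 ∧ 0 < (S 0).im ∧
        (∃ c : ℕ → ℚ, c 0 = 0 ∧ c 1 = 1 ∧
          SchwarzTriangle.RationalAtVertex ν φ B C c p S
            (fun _ z => SchwarzTriangle.shiftC z)) ∧
        (∃ e : ℕ → ℚ, e 0 = 1 ∧ e 1 = 1 ∧
          SchwarzTriangle.RationalAtVertex ν φ B C e p S (fun _ z => z))) := by
  have hA : SchwarzTriangle.Hyperbolic α β γ := by
    subst hα hβ hγ
    exact ⟨by positivity, by positivity, by positivity, hyp⟩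
  have hB := hA.rotate
  have hC := hB.rotate
  have qα : ∃ q : ℚ, α = q := ⟨1 / m, by rw [hα]; push_cast; rfl⟩
  have qβ : ∃ q : ℚ, β = q := ⟨1 / n, by rw [hβ]; push_cast; rfl⟩
  have qγ : ∃ q : ℚ, γ = q := ⟨1 / p, by rw [hγ]; push_cast; rfl⟩
  subst hφ hν hνB hνC
  refine ⟨SchwarzTriangle.vertB α β γ, SchwarzTriangle.oneRadius α β γ,
    SchwarzTriangle.tendsto_phi_zero hA, SchwarzTriangle.tendsto_phi_cobounded hA,
    SchwarzTriangle.tendsto_phi_one hA, SchwarzTriangle.nu_pos hA, SchwarzTriangle.nu_pos hB,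
    SchwarzTriangle.nu_pos hC, SchwarzTriangle.norm_vertB_lt hA,
    SchwarzTriangle.norm_oneRadius_lt hA, SchwarzTriangle.vertB_im_pos hA,
    SchwarzTriangle.oneRadius_pos hA, ofReal_im _, SchwarzTriangle.hypAngle_zero hA,
    SchwarzTriangle.hypAngle_vertB hA, SchwarzTriangle.hypAngle_oneRadius hA,
    SchwarzTriangle.differentiableOn_phi hA, ?_,
    SchwarzTriangle.expansion_zero hA hm hα qβ qγ,
    ⟨Real.pi - Real.pi * α, ?_⟩, ⟨Real.pi + Real.pi * γ, ?_⟩⟩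
  · rw [SchwarzTriangle.hypTriangle_eq hA]
    exact SchwarzTriangle.bijOn_phi hA
  · change 0 < (SchwarzTriangle.stepS α β γ 0).re ∧ (SchwarzTriangle.stepS α β γ 0).im = 0 ∧
      0 < (SchwarzTriangle.stepS α β γ (SchwarzTriangle.oneRadius α β γ)).im ∧ _ ∧ _
    rw [SchwarzTriangle.stepS_zero, SchwarzTriangle.stepS_oneRadius hA]
    exact ⟨SchwarzTriangle.oneRadius_pos hB, ofReal_im _, SchwarzTriangle.vertB_im_pos hB,
      SchwarzTriangle.expansion_shiftB hA hn hβ qα qγ,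
      SchwarzTriangle.expansion_pole hA hn hβ qα qγ⟩
  · intro S
    -- The turn by `π + π γ` is multiplication by `-rot γ`, which makes this coordinate the inverse
    -- of the step that ends at the vertex `0`.
    have hS : S = SchwarzTriangle.stepInv γ α β := (SchwarzTriangle.stepInv_eq_coordS α β γ).symm
    rw [hS, SchwarzTriangle.stepInv_vertB hA, SchwarzTriangle.stepInv_zero hC]
    exact ⟨SchwarzTriangle.oneRadius_pos hC, ofReal_im _, SchwarzTriangle.vertB_im_pos hC,
      SchwarzTriangle.expansion_shiftC hA hp hγ qα qβ,
      SchwarzTriangle.expansion_one hA hp hγ qα qβ⟩
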